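/- Let $R$ be a complete discrete valuation ring of mixed characteristic $(0,p)$ with fraction field $K$ and perfect residue field $k$; let $K_0=\operatorname{Frac}W(k)\subset K$ and let $\sigma$ be the Frobenius of $K_0$. A *$p$-adic Hodge complex* $M=(M_0,\phi,M_{\mathrm{dR}},F,M_K,c,s)$ consists of a bounded complex $M_0$ of $K_0$-vector spaces with a $K_0$-linear morphism of complexes $\phi:M_0^\sigma:=M_0\otimes_{\sigma}K_0\to M_0$; a bounded complex $M_{\mathrm{dR}}$ of $K$-vector spaces with a descending exhaustive filtration $F$ by subcomplexes such that $F^N=0$ for $N\gg 0$; a bounded complex $M_K$ of $K$-vector spaces; and morphisms of complexes of $K$-vector spaces $M_{\mathrm{rig}}:=M_0\otimes_{K_0}K\xrightarrow{c}M_K\xleftarrow{s}M_{\mathrm{dR}}$; the cohomology of $M_{\mathrm{rig}}$ and of $M_{\mathrm{dR}}$ is required to be finitely generated over $K$. Morphisms and homotopies are systems of morphisms and homotopies compatible with $\phi$, $F$, $c$, $s$. This gives a category $pHC$, and $pHK$ is $pHC$ modulo homotopy. A morphism $f$ is a quasi-isomorphism if $f_{\mathrm{rig}}$, $f_K$ and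 $\operatorname{gr}^i_F(f_{\mathrm{dR}})$, $i\in\mathbb Z$, are quasi-isomorphisms, and $pHD$ is the localization of $pHK$ at the quasi-isomorphisms, with its additive structure (the unique one for which $pHK\to pHD$ is additive). For $M,M'\in pHC$ let $\operatorname{Hom}^{\bullet}$ denote the complexes of homogeneous maps ($\operatorname{Hom}^{\bullet,F}$: maps preserving the filtrations) and set $$\Gamma_0=\operatorname{Hom}^\bullet_{K_0}(M_0,M_0')\oplus\operatorname{Hom}^\bullet_K(M_K,M_K')\oplus\operatorname{Hom}^{\bullet,F}_K(M_{\mathrm{dR}},M_{\mathrm{dR}}'),$$ $$\Gamma_1=\operatorname{Hom}^\bullet_{K_0}(M_0^\sigma,M_0')\oplus\operatorname{Hom}^\bullet_K(M_{\mathrm{rig}},M_K')\oplus\operatorname{Hom}^\bullet_K(M_{\mathrm{dR}},M_K'),$$ $$\psi:\Gamma_0\to\Gamma_1,\quad (x_0,x_K,x_{\mathrm{dR}})\mapsto\bigl(-(x_0\phi-\phi'x_0^\sigma),\ c'(x_0\otimes\mathrm{id}_K)-x_Kc,\ x_Ks-s'x_{\mathrm{dR}}\bigr),$$ and $\Gamma(M,M')=\operatorname{Cone}(\psi)[-1]$.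 Then for all $M,M'\in pHC$ and $n\in\mathbb Z$ there is a canonical isomorphism of abelian groups $$\operatorname{Hom}_{pHD}(M,M'[n])\cong H^n(\Gamma(M,M')).$$ It is functorial in $M$ and $M'$, and it sends the image in $pHD$ of a morphism $f:M\to M'[n]$ of $pHC$ to the class of the cocycle $((f_0,f_K,f_{\mathrm{dR}}),0)$. If $M$ and $M'$ are concentrated in degree $0$, then $H^n(\Gamma(M,M'))=0$, and hence $\operatorname{Hom}_{pHD}(M,M'[n])=0$, for $n\ge 2$ and for $n<0$. -/

import Mathlib

universe u

open CategoryTheory Limits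

noncomputable section

namespace PadicHodge

/-! ## Filtered vector spaces -/

section Filtered

variable (K : Type u) [Field K]

/-- A `K`-vector space `V` with a descending filtration `F` indexed by `ℤ` which is
exhaustive and satisfies `F N = 0` for `N` large enough (so that it is separated). -/
structure Filt where
  /-- the underlying vector space -/
  V : ModuleCat.{u} K
  /-- the steps of the filtration -/
  F : ℤ → Submodule K V
  anti : Antitone F
  exhaustive : ⨆ i, F i = ⊤
  eventually_bot : ∃ N, F N = ⊥

namespace Filt

variable {K}

/-- Morphisms of filtered vector spaces: linear maps preserving the filtrations. -/
@[ext]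
structure Hom (V W : Filt K) where
  /-- the underlying linear map -/
  hom : V.V ⟶ W.V
  map_le : ∀ i, V.F i ≤ (W.F i).comap hom.hom

instance : Category (Filt K) where
  Hom := Hom
  id V := ⟨𝟙 V.V, fun _ _ hx => hx⟩
  comp f g := ⟨f.hom ≫ g.hom, fun i _ hx => g.map_le i (f.map_le i hx)⟩

@[ext]
lemma hom_ext {V W : Filt K} {f g : V ⟶ W} (h : f.hom = g.hom) : f = g := Hom.ext h

@[simp] lemma id_hom (V : Filt K) : Hom.hom (𝟙 V) = 𝟙 V.V := rfl

@[simp] lemma comp_hom {V W X : Filt K} (f : V ⟶ W) (g : W ⟶ X) :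
    (f ≫ g).hom = f.hom ≫ g.hom := rfl

variable {V W : Filt K}

instance : Zero (V ⟶ W) := ⟨⟨0, fun i _ _ => (W.F i).zero_mem⟩⟩
instance : Add (V ⟶ W) := ⟨fun f g =>
  ⟨f.hom + g.hom, fun i _ hx => (W.F i).add_mem (f.map_le i hx) (g.map_le i hx)⟩⟩
instance : Neg (V ⟶ W) := ⟨fun f => ⟨-f.hom, fun i _ hx => (W.F i).neg_mem (f.map_le i hx)⟩⟩
instance : Sub (V ⟶ W) := ⟨fun f g =>
  ⟨f.hom - g.hom, fun i _ hx => (W.F i).sub_mem (f.map_le i hx) (g.map_le i hx)⟩⟩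
instance : SMul ℕ (V ⟶ W) := ⟨fun n f =>
  ⟨n • f.hom, fun i _ hx => (W.F i).nsmul_mem (f.map_le i hx) n⟩⟩
instance : SMul ℤ (V ⟶ W) := ⟨fun n f =>
  ⟨n • f.hom, fun i _ hx => (W.F i).toAddSubgroup.zsmul_mem (f.map_le i hx) n⟩⟩

@[simp] lemma zero_hom : (0 : V ⟶ W).hom = 0 := rfl
@[simp] lemma add_hom (f g : V ⟶ W) : (f + g).hom = f.hom + g.hom := rfl

instance : AddCommGroup (V ⟶ W) :=
  Function.Injective.addCommGroup (Hom.hom : (V ⟶ W) → (V.V ⟶ W.V)) (fun _ _ h => hom_ext h)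
    rfl (fun _ _ => rfl) (fun _ => rfl) (fun _ _ => rfl) (fun _ _ => rfl) (fun _ _ => rfl)

instance : Preadditive (Filt K) where
  add_comp _ _ _ _ _ _ := hom_ext (Preadditive.add_comp _ _ _ _ _ _)
  comp_add _ _ _ _ _ _ := hom_ext (Preadditive.comp_add _ _ _ _ _ _)

variable (K)

/-- The functor forgetting the filtration. -/
def forget : Filt K ⥤ ModuleCat.{u} K where
  obj V := V.V
  map f := f.hom

instance : (forget K).Additive where
  map_add := rfl

/-- The graded piece `gr^i V = F^i V / F^{i+1} V`, as a functor. -/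
def gr (i : ℤ) : Filt K ⥤ ModuleCat.{u} K where
  obj V := ModuleCat.of K (V.F i ⧸ (V.F (i + 1)).comap (V.F i).subtype)
  map {V W} f := ModuleCat.ofHom
    (Submodule.mapQ _ _ (f.hom.hom.restrict (f.map_le i)) (fun _ hx => f.map_le (i + 1) hx))
  map_id V := by
    ext x
    rfl
  map_comp f g := by
    ext x
    rfl

instance (i : ℤ) : (gr K i).Additive where
  map_add := by
    intros
    apply ModuleCat.hom_ext
    apply Submodule.linearMap_qext
    rfl

end Filt

end Filtered

/-! ## Systems `M_rig ⟶ M_K ⟵ M_dR` in a single degree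

A cochain complex in the category `Sys K σ` below is the same thing as a complex `M₀` of
`K₀`-vector spaces with a morphism of complexes `φ : M₀^σ ⟶ M₀`, a complex `M_dR` of filtered
`K`-vector spaces, a complex `M_K` of `K`-vector spaces, and morphisms of complexes
`c : M₀ ⊗ K ⟶ M_K`, `s : M_dR ⟶ M_K`. Morphisms and homotopies in `Sys K σ` are systems of
morphisms and homotopies which are compatible with `φ`, with the filtrations, and with `c`, `s`. -/

section Systems

variable {K₀ : Type u} (K : Type u) [Field K₀] [Field K] [Algebra K₀ K] (σ : K₀ →+* K₀)

instance extendScalars_additive {A B : Type u} [CommRing A] [CommRing B] (f : A →+* B) :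
    (ModuleCat.extendScalars.{u, u, u} f).Additive :=
  (ModuleCat.extendRestrictScalarsAdj f).left_adjoint_additive

/-- `M₀ ↦ M₀^σ = M₀ ⊗_σ K₀`. -/
abbrev twist : ModuleCat.{u} K₀ ⥤ ModuleCat.{u} K₀ := ModuleCat.extendScalars σ

variable (K₀) in
/-- `M₀ ↦ M₀ ⊗_{K₀} K`. -/
abbrev baseChange : ModuleCat.{u} K₀ ⥤ ModuleCat.{u} K :=
  ModuleCat.extendScalars (algebraMap K₀ K)

/-- The data of `(M₀, φ)`, `(M_dR, F)`, `M_K`, `c`, `s` in one degree. -/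
structure Sys where
  /-- `M₀` -/
  rig : ModuleCat.{u} K₀
  /-- the Frobenius `φ : M₀^σ ⟶ M₀` -/
  frob : (twist σ).obj rig ⟶ rig
  /-- `M_dR` with its Hodge filtration -/
  dR : Filt K
  /-- `M_K` -/
  vec : ModuleCat.{u} K
  /-- `c : M_rig = M₀ ⊗ K ⟶ M_K` -/
  c : (baseChange K₀ K).obj rig ⟶ vec
  /-- `s : M_dR ⟶ M_K` -/
  s : dR.V ⟶ vec

namespace Sys

variable {K σ}

/-- Morphisms of systems. -/
@[ext]
structure Hom (M N : Sys K σ) where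
  /-- `f_rig`, given by the `K₀`-linear map `M₀ ⟶ N₀` -/
  rig : M.rig ⟶ N.rig
  /-- `f_dR` -/
  dR : M.dR ⟶ N.dR
  /-- `f_K` -/
  vec : M.vec ⟶ N.vec
  frob_comm : M.frob ≫ rig = (twist σ).map rig ≫ N.frob
  c_comm : M.c ≫ vec = (baseChange K₀ K).map rig ≫ N.c
  s_comm : M.s ≫ vec = dR.hom ≫ N.s

instance : Category (Sys K σ) where
  Hom := Hom
  id M := ⟨𝟙 _, 𝟙 _, 𝟙 _, by simp, by simp, by simp⟩
  comp f g := ⟨f.rig ≫ g.rig, f.dR ≫ g.dR, f.vec ≫ g.vec,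
    by rw [← Category.assoc, f.frob_comm, Category.assoc, g.frob_comm, Functor.map_comp,
      Category.assoc],
    by rw [← Category.assoc, f.c_comm, Category.assoc, g.c_comm, Functor.map_comp,
      Category.assoc],
    by rw [← Category.assoc, f.s_comm, Category.assoc, g.s_comm, Filt.comp_hom,
      Category.assoc]⟩

@[ext]
lemma hom_ext {M N : Sys K σ} {f g : M ⟶ N} (h₁ : f.rig = g.rig) (h₂ : f.dR = g.dR)
    (h₃ : f.vec = g.vec) : f = g := Hom.ext h₁ h₂ h₃

variable {M N : Sys K σ}

instance : Zero (M ⟶ N) := ⟨⟨0, 0, 0, by simp, by simp, by simp⟩⟩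
instance : Add (M ⟶ N) := ⟨fun f g => ⟨f.rig + g.rig, f.dR + g.dR, f.vec + g.vec,
  by simp [f.frob_comm, g.frob_comm, Functor.map_add],
  by simp [f.c_comm, g.c_comm, Functor.map_add],
  by simp [f.s_comm, g.s_comm]⟩⟩
instance : Neg (M ⟶ N) := ⟨fun f => ⟨-f.rig, -f.dR, -f.vec,
  by simp [f.frob_comm, Functor.map_neg],
  by simp [f.c_comm, Functor.map_neg],
  by
    rw [Preadditive.comp_neg, f.s_comm]
    exact (Preadditive.neg_comp _ _).symm⟩⟩
instance : Sub (M ⟶ N) := ⟨fun f g => ⟨f.rig - g.rig, f.dR - g.dR, f.vec - g.vec,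
  by simp [f.frob_comm, g.frob_comm, Functor.map_sub],
  by simp [f.c_comm, g.c_comm, Functor.map_sub],
  by
    rw [Preadditive.comp_sub, f.s_comm, g.s_comm]
    exact (Preadditive.sub_comp _ _ _).symm⟩⟩
instance : SMul ℕ (M ⟶ N) := ⟨fun n f => ⟨n • f.rig, n • f.dR, n • f.vec,
  by simp [f.frob_comm],
  by simp [f.c_comm],
  by
    rw [Preadditive.comp_nsmul, f.s_comm]
    exact (Preadditive.nsmul_comp _ _ _).symm⟩⟩
instance : SMul ℤ (M ⟶ N) := ⟨fun n f => ⟨n • f.rig, n • f.dR, n • f.vec,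
  by simp [f.frob_comm],
  by simp [f.c_comm],
  by
    rw [Preadditive.comp_zsmul, f.s_comm]
    exact (Preadditive.zsmul_comp _ _ _).symm⟩⟩

instance : AddCommGroup (M ⟶ N) :=
  Function.Injective.addCommGroup
    (fun f : M ⟶ N => ((f.rig, f.dR, f.vec) : (M.rig ⟶ N.rig) × (M.dR ⟶ N.dR) × (M.vec ⟶ N.vec)))
    (fun f g h => by
      simp only [Prod.mk.injEq] at h
      exact hom_ext h.1 h.2.1 h.2.2)
    rfl (fun _ _ => rfl) (fun _ => rfl) (fun _ _ => rfl) (fun _ _ => rfl) (fun _ _ => rfl)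

instance : Preadditive (Sys K σ) where
  add_comp _ _ _ _ _ _ := hom_ext (Preadditive.add_comp _ _ _ _ _ _)
    (Preadditive.add_comp _ _ _ _ _ _) (Preadditive.add_comp _ _ _ _ _ _)
  comp_add _ _ _ _ _ _ := hom_ext (Preadditive.comp_add _ _ _ _ _ _)
    (Preadditive.comp_add _ _ _ _ _ _) (Preadditive.comp_add _ _ _ _ _ _)

variable (K σ)

/-- `M ↦ M₀` -/
def rigFunctor : Sys K σ ⥤ ModuleCat.{u} K₀ where
  obj M := M.rig
  map f := f.rig

/-- `M ↦ (M_dR, F)` -/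
def dRFunctor : Sys K σ ⥤ Filt K where
  obj M := M.dR
  map f := f.dR

/-- `M ↦ M_K` -/
def vecFunctor : Sys K σ ⥤ ModuleCat.{u} K where
  obj M := M.vec
  map f := f.vec

instance : (rigFunctor K σ).Additive where
  map_add := rfl

instance : (dRFunctor K σ).Additive where
  map_add := rfl

instance : (vecFunctor K σ).Additive where
  map_add := rfl

end Sys

end Systems

/-! ## Complexes of systems: their components -/

section Components

variable {K₀ K : Type u} [Field K₀] [Field K] [Algebra K₀ K] {σ : K₀ →+* K₀}

/-- The additive functor `Φ` applied termwise to complexes. -/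
abbrev cx {A B : Type*} [Category* A] [Category* B] [Preadditive A] [Preadditive B]
    (Φ : A ⥤ B) [Φ.Additive] : CochainComplex A ℤ ⥤ CochainComplex B ℤ :=
  Φ.mapHomologicalComplex (ComplexShape.up ℤ)

variable (K σ) in
/-- The complex `M₀`. -/
abbrev zeroPart : CochainComplex (Sys K σ) ℤ ⥤ CochainComplex (ModuleCat.{u} K₀) ℤ :=
  cx (Sys.rigFunctor K σ)

variable (K σ) in
/-- The complex `M₀^σ`. -/
abbrev sigmaPart : CochainComplex (Sys K σ) ℤ ⥤ CochainComplex (ModuleCat.{u} K₀) ℤ :=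
  zeroPart K σ ⋙ cx (twist σ)

variable (K σ) in
/-- The complex `M_rig = M₀ ⊗ K`. -/
abbrev rigPart : CochainComplex (Sys K σ) ℤ ⥤ CochainComplex (ModuleCat.{u} K) ℤ :=
  zeroPart K σ ⋙ cx (baseChange K₀ K)

variable (K σ) in
/-- The filtered complex `(M_dR, F)`. -/
abbrev dRPart : CochainComplex (Sys K σ) ℤ ⥤ CochainComplex (Filt K) ℤ :=
  cx (Sys.dRFunctor K σ)

variable (K σ) in
/-- The complex of vector spaces underlying `M_dR`. -/
abbrev dRVecPart : CochainComplex (Sys K σ) ℤ ⥤ CochainComplex (ModuleCat.{u} K) ℤ :=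
  dRPart K σ ⋙ cx (Filt.forget K)

variable (K σ) in
/-- The complex `M_K`. -/
abbrev vecPart : CochainComplex (Sys K σ) ℤ ⥤ CochainComplex (ModuleCat.{u} K) ℤ :=
  cx (Sys.vecFunctor K σ)

variable (K σ) in
/-- `φ : M₀^σ ⟶ M₀` -/
def frob : sigmaPart K σ ⟶ zeroPart K σ where
  app M :=
    { f := fun n => (M.X n).frob
      comm' := fun i j _ => (M.d i j).frob_comm }
  naturality _ _ f := by
    ext1 n
    exact (f.f n).frob_comm.symm

variable (K σ) in
/-- `c : M_rig ⟶ M_K` -/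
def compC : rigPart K σ ⟶ vecPart K σ where
  app M :=
    { f := fun n => (M.X n).c
      comm' := fun i j _ => (M.d i j).c_comm }
  naturality _ _ f := by
    ext1 n
    exact (f.f n).c_comm.symm

variable (K σ) in
/-- `s : M_dR ⟶ M_K` -/
def compS : dRVecPart K σ ⟶ vecPart K σ where
  app M :=
    { f := fun n => (M.X n).s
      comm' := fun i j _ => (M.d i j).s_comm }
  naturality _ _ f := by
    ext1 n
    exact (f.f n).s_comm.symm

end Components

/-! ## The categories `pHC`, `pHK`, `pHD` -/

section Categories

variable {K₀ : Type u} (K : Type u) [Field K₀] [Field K] [Algebra K₀ K] (σ : K₀ →+* K₀)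

/-- The complex of systems `M` is bounded, and `H^*(M_rig)`, `H^*(M_dR)` are finitely generated
over `K`. -/
def isHodgeComplex : ObjectProperty (CochainComplex (Sys K σ) ℤ) := fun M =>
  (∃ a b : ℤ, ∀ n : ℤ, n < a ∨ b < n → IsZero (M.X n)) ∧
  (∀ n : ℤ, Module.Finite K (((rigPart K σ).obj M).homology n)) ∧
  (∀ n : ℤ, Module.Finite K (((dRVecPart K σ).obj M).homology n))

/-- The category of `p`-adic Hodge complexes. -/
abbrev pHC := (isHodgeComplex K σ).FullSubcategory

/-- The category of `p`-adic Hodge complexes modulo homotopy. -/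
abbrev pHK := ObjectProperty.FullSubcategory
  (fun X : HomotopyCategory (Sys K σ) (ComplexShape.up ℤ) => isHodgeComplex K σ X.as)

/-- The quotient functor `pHC ⥤ pHK`. -/
def toHK : pHC K σ ⥤ pHK K σ :=
  ObjectProperty.lift _ ((isHodgeComplex K σ).ι ⋙ HomotopyCategory.quotient _ _)
    (fun M => M.property)

/-- The termwise extension of an additive functor to `pHK`. -/
abbrev onHK {B : Type*} [Category* B] [Preadditive B] (Φ : Sys K σ ⥤ B) [Φ.Additive] :
    pHK K σ ⥤ HomotopyCategory B (ComplexShape.up ℤ) :=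
  ObjectProperty.ι _ ⋙ Φ.mapHomotopyCategory (ComplexShape.up ℤ)

/-- Quasi-isomorphisms: `f_rig` and `f_K` are quasi-isomorphisms, and `f_dR` is a filtered
quasi-isomorphism, i.e. `gr_F(f_dR)` is a quasi-isomorphism. -/
def quasiIso : MorphismProperty (pHK K σ) := fun _ _ f =>
  HomotopyCategory.quasiIso _ _ ((onHK K σ (Sys.rigFunctor K σ ⋙ baseChange K₀ K)).map f) ∧
  HomotopyCategory.quasiIso _ _ ((onHK K σ (Sys.vecFunctor K σ)).map f) ∧
  ∀ i : ℤ, HomotopyCategory.quasiIso _ _ ((onHK K σ (Sys.dRFunctor K σ ⋙ Filt.gr K i)).map f)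

/-- The localization of `pHK` with respect to quasi-isomorphisms. -/
abbrev pHD := (quasiIso K σ).Localization

/-- The functor `pHC ⥤ pHK ⥤ pHD`. -/
def toHD : pHC K σ ⥤ pHD K σ := toHK K σ ⋙ (quasiIso K σ).Q

variable {K σ}

lemma isHodgeComplex_shift {M : CochainComplex (Sys K σ) ℤ} (hM : isHodgeComplex K σ M) (n : ℤ) :
    isHodgeComplex K σ (M⟦n⟧) := by
  obtain ⟨⟨a, b, hab⟩, h₁, h₂⟩ := hM
  have key : ∀ (L L' : CochainComplex (ModuleCat.{u} K) ℤ) (_ : L' ≅ L⟦n⟧)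
      (_ : ∀ i, Module.Finite K (L.homology i)) (i : ℤ), Module.Finite K (L'.homology i) :=
    fun L L' e hL i => by
      have e₁ : L'.homology i ≅ (L⟦n⟧).homology i :=
        (HomologicalComplex.homologyFunctor _ _ i).mapIso e
      have e₂ : (L⟦n⟧).homology i ≅ L.homology (n + i) :=
        (CochainComplex.ShiftSequence.shiftIso (ModuleCat.{u} K) n i (n + i) rfl).app L
      have := hL (n + i)
      exact Module.Finite.equiv (e₁ ≪≫ e₂).toLinearEquiv.symm
  refine ⟨⟨a - n, b - n, fun i hi => ?_⟩, ?_, ?_⟩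
  · change IsZero (M.X (i + n))
    exact hab _ (by omega)
  · exact key _ _ (((Sys.rigFunctor K σ ⋙ baseChange K₀ K).mapCochainComplexShiftIso n).app M) h₁
  · exact key _ _ (((Sys.dRFunctor K σ ⋙ Filt.forget K).mapCochainComplexShiftIso n).app M) h₂

variable (K σ) in
/-- The shift `M ↦ M[n]` on `p`-adic Hodge complexes. -/
def shift (n : ℤ) : pHC K σ ⥤ pHC K σ :=
  ObjectProperty.lift _ ((isHodgeComplex K σ).ι ⋙ shiftFunctor _ n)
    (fun M => isHodgeComplex_shift M.property n)

end Categories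

/-! ## Functoriality of the complexes `Hom^•` -/

section HomComplex

open CochainComplex CochainComplex.HomComplex

variable {A : Type*} [Category.{u} A] [Preadditive A] {B : Type*} [Category.{u} B] [Preadditive B]

/-- `x ↦ x ∘ f` -/
def homPre {X Y : CochainComplex A ℤ} (f : X ⟶ Y) (L : CochainComplex A ℤ) :
    HomComplex Y L ⟶ HomComplex X L where
  f n := AddCommGrpCat.ofHom
    { toFun := fun z : Cochain Y L n => (Cochain.ofHom f).comp z (zero_add n)
      map_zero' := by simp
      map_add' := by simp }
  comm' i j _ := by
    ext z
    exact δ_ofHom_comp f z j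

/-- `x ↦ f ∘ x` -/
def homPost (X : CochainComplex A ℤ) {L L' : CochainComplex A ℤ} (f : L ⟶ L') :
    HomComplex X L ⟶ HomComplex X L' where
  f n := AddCommGrpCat.ofHom
    { toFun := fun z : Cochain X L n => z.comp (Cochain.ofHom f) (add_zero n)
      map_zero' := by simp
      map_add' := by simp }
  comm' i j _ := by
    ext z
    exact δ_comp_ofHom z f j

/-- `x ↦ Φ(x)` for an additive functor `Φ` -/
def homMap (Φ : A ⥤ B) [Φ.Additive] (X L : CochainComplex A ℤ) :
    HomComplex X L ⟶ HomComplex ((cx Φ).obj X) ((cx Φ).obj L) where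
  f n := AddCommGrpCat.ofHom
    { toFun := fun z : Cochain X L n => z.map Φ
      map_zero' := by
        ext
        simp
      map_add' := by
        intros
        ext
        simp }
  comm' i j _ := by
    ext z
    exact δ_map (Φ := Φ) (z := z) (m := j)

end HomComplex

/-! ## The complex `Γ(M, M')` -/

section Gamma

open CochainComplex

variable {K₀ K : Type u} [Field K₀] [Field K] [Algebra K₀ K] {σ : K₀ →+* K₀}
  (M M' : CochainComplex (Sys K σ) ℤ)

/-- `Γ₀(M, M') = Hom(M₀, M₀') ⊕ Hom(M_K, M_K') ⊕ Hom^F(M_dR, M_dR')` -/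
abbrev Gamma₀ : CochainComplex AddCommGrpCat.{u} ℤ :=
  HomComplex ((zeroPart K σ).obj M) ((zeroPart K σ).obj M') ⊞
    (HomComplex ((vecPart K σ).obj M) ((vecPart K σ).obj M') ⊞
      HomComplex ((dRPart K σ).obj M) ((dRPart K σ).obj M'))

/-- `Γ₁(M, M') = Hom(M₀^σ, M₀') ⊕ Hom(M_rig, M_K') ⊕ Hom(M_dR, M_K')` -/
abbrev Gamma₁ : CochainComplex AddCommGrpCat.{u} ℤ :=
  HomComplex ((sigmaPart K σ).obj M) ((zeroPart K σ).obj M') ⊞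
    (HomComplex ((rigPart K σ).obj M) ((vecPart K σ).obj M') ⊞
      HomComplex ((dRVecPart K σ).obj M) ((vecPart K σ).obj M'))

/-- `h₀(x₀) = x₀ ∘ φ - φ' ∘ x₀^σ` -/
def h₀ : HomComplex ((zeroPart K σ).obj M) ((zeroPart K σ).obj M') ⟶
    HomComplex ((sigmaPart K σ).obj M) ((zeroPart K σ).obj M') :=
  homPre ((frob K σ).app M) _ - homMap (twist σ) _ _ ≫ homPost _ ((frob K σ).app M')

/-- `h₁(x₀) = c' ∘ (x₀ ⊗ id_K)` -/
def h₁ : HomComplex ((zeroPart K σ).obj M) ((zeroPart K σ).obj M') ⟶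
    HomComplex ((rigPart K σ).obj M) ((vecPart K σ).obj M') :=
  homMap (baseChange K₀ K) _ _ ≫ homPost _ ((compC K σ).app M')

/-- `h₂(x_K) = x_K ∘ c` -/
def h₂ : HomComplex ((vecPart K σ).obj M) ((vecPart K σ).obj M') ⟶
    HomComplex ((rigPart K σ).obj M) ((vecPart K σ).obj M') :=
  homPre ((compC K σ).app M) _

/-- `h₃(x_K) = x_K ∘ s` -/
def h₃ : HomComplex ((vecPart K σ).obj M) ((vecPart K σ).obj M') ⟶
    HomComplex ((dRVecPart K σ).obj M) ((vecPart K σ).obj M') :=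
  homPre ((compS K σ).app M) _

/-- `h₄(x_dR) = s' ∘ x_dR` -/
def h₄ : HomComplex ((dRPart K σ).obj M) ((dRPart K σ).obj M') ⟶
    HomComplex ((dRVecPart K σ).obj M) ((vecPart K σ).obj M') :=
  homMap (Filt.forget K) _ _ ≫ homPost _ ((compS K σ).app M')

/-- `ψ(x₀, x_K, x_dR) = (-h₀(x₀), h₁(x₀) - h₂(x_K), h₃(x_K) - h₄(x_dR))` -/
def psi : Gamma₀ M M' ⟶ Gamma₁ M M' :=
  biprod.desc (biprod.lift (-h₀ M M') (biprod.lift (h₁ M M') 0))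
    (biprod.desc (biprod.lift 0 (biprod.lift (-h₂ M M') (h₃ M M')))
      (biprod.lift 0 (biprod.lift 0 (-h₄ M M'))))

/-- `Γ(M, M') = Cone(ψ)[-1]` -/
def Gamma : CochainComplex AddCommGrpCat.{u} ℤ := (mappingCone (psi M M'))⟦(-1 : ℤ)⟧

variable {M M'}
variable {N N' : CochainComplex (Sys K σ) ℤ} (f : N ⟶ M) (g : M' ⟶ N')

/-- The map `Γ₀(M, M') ⟶ Γ₀(N, N')`, `x ↦ g ∘ x ∘ f`. -/
def Gamma₀.map : Gamma₀ M M' ⟶ Gamma₀ N N' :=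
  biprod.map (homPre ((zeroPart K σ).map f) _ ≫ homPost _ ((zeroPart K σ).map g))
    (biprod.map (homPre ((vecPart K σ).map f) _ ≫ homPost _ ((vecPart K σ).map g))
      (homPre ((dRPart K σ).map f) _ ≫ homPost _ ((dRPart K σ).map g)))

/-- The map `Γ₁(M, M') ⟶ Γ₁(N, N')`, `x ↦ g ∘ x ∘ f`. -/
def Gamma₁.map : Gamma₁ M M' ⟶ Gamma₁ N N' :=
  biprod.map (homPre ((sigmaPart K σ).map f) _ ≫ homPost _ ((zeroPart K σ).map g))
    (biprod.map (homPre ((rigPart K σ).map f) _ ≫ homPost _ ((vecPart K σ).map g))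
      (homPre ((dRVecPart K σ).map f) _ ≫ homPost _ ((vecPart K σ).map g)))

section naturality

variable {A : Type*} [Category.{u} A] [Preadditive A] {B : Type*} [Category.{u} B] [Preadditive B]

open HomComplex

lemma homPre_homPre {X Y Z : CochainComplex A ℤ} (a : X ⟶ Y) (b : Y ⟶ Z)
    (L : CochainComplex A ℤ) : homPre b L ≫ homPre a L = homPre (a ≫ b) L := by
  ext n (z : Cochain Z L n)
  change (Cochain.ofHom a).comp ((Cochain.ofHom b).comp z (zero_add n)) (zero_add n) =
    (Cochain.ofHom (a ≫ b)).comp z (zero_add n)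
  ext
  simp

lemma homPost_homPost {L L' L'' : CochainComplex A ℤ} (X : CochainComplex A ℤ) (a : L ⟶ L')
    (b : L' ⟶ L'') : homPost X a ≫ homPost X b = homPost X (a ≫ b) := by
  ext n (z : Cochain X L n)
  change (z.comp (Cochain.ofHom a) (add_zero n)).comp (Cochain.ofHom b) (add_zero n) =
    z.comp (Cochain.ofHom (a ≫ b)) (add_zero n)
  ext
  simp

lemma homPre_homPost {X Y L L' : CochainComplex A ℤ} (a : X ⟶ Y) (b : L ⟶ L') :
    homPre a L ≫ homPost X b = homPost Y b ≫ homPre a L' := by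
  ext n (z : Cochain Y L n)
  change ((Cochain.ofHom a).comp z (zero_add n)).comp (Cochain.ofHom b) (add_zero n) =
    (Cochain.ofHom a).comp (z.comp (Cochain.ofHom b) (add_zero n)) (zero_add n)
  ext
  simp

lemma homPre_homMap (Φ : A ⥤ B) [Φ.Additive] {X Y : CochainComplex A ℤ} (a : X ⟶ Y)
    (L : CochainComplex A ℤ) :
    homPre a L ≫ homMap Φ X L = homMap Φ Y L ≫ homPre ((cx Φ).map a) _ := by
  ext n (z : Cochain Y L n)
  change ((Cochain.ofHom a).comp z (zero_add n)).map Φ =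
    (Cochain.ofHom ((cx Φ).map a)).comp (z.map Φ) (zero_add n)
  ext
  simp

lemma homPost_homMap (Φ : A ⥤ B) [Φ.Additive] (X : CochainComplex A ℤ)
    {L L' : CochainComplex A ℤ} (b : L ⟶ L') :
    homPost X b ≫ homMap Φ X L' = homMap Φ X L ≫ homPost _ ((cx Φ).map b) := by
  ext n (z : Cochain X L n)
  change (z.comp (Cochain.ofHom b) (add_zero n)).map Φ =
    (z.map Φ).comp (Cochain.ofHom ((cx Φ).map b)) (add_zero n)
  ext
  simp

lemma homPre_homPre_assoc {X Y Z : CochainComplex A ℤ} (a : X ⟶ Y) (b : Y ⟶ Z)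
    {L : CochainComplex A ℤ} {W : CochainComplex AddCommGrpCat.{u} ℤ} (k : HomComplex X L ⟶ W) :
    homPre b L ≫ homPre a L ≫ k = homPre (a ≫ b) L ≫ k := by
  rw [← Category.assoc, homPre_homPre]

lemma homPre_homPost_assoc {X Y L L' : CochainComplex A ℤ} (a : X ⟶ Y) (b : L ⟶ L')
    {W : CochainComplex AddCommGrpCat.{u} ℤ} (k : HomComplex X L' ⟶ W) :
    homPre a L ≫ homPost X b ≫ k = homPost Y b ≫ homPre a L' ≫ k := by
  rw [← Category.assoc, homPre_homPost, Category.assoc]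

lemma homPre_homMap_assoc (Φ : A ⥤ B) [Φ.Additive] {X Y : CochainComplex A ℤ} (a : X ⟶ Y)
    (L : CochainComplex A ℤ) {W : CochainComplex AddCommGrpCat.{u} ℤ}
    (k : HomComplex ((cx Φ).obj X) ((cx Φ).obj L) ⟶ W) :
    homPre a L ≫ homMap Φ X L ≫ k = homMap Φ Y L ≫ homPre ((cx Φ).map a) _ ≫ k := by
  rw [← Category.assoc, homPre_homMap, Category.assoc]

lemma homPost_homMap_assoc (Φ : A ⥤ B) [Φ.Additive] (X : CochainComplex A ℤ)
    {L L' : CochainComplex A ℤ} (b : L ⟶ L') {W : CochainComplex AddCommGrpCat.{u} ℤ}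
    (k : HomComplex ((cx Φ).obj X) ((cx Φ).obj L') ⟶ W) :
    homPost X b ≫ homMap Φ X L' ≫ k = homMap Φ X L ≫ homPost _ ((cx Φ).map b) ≫ k := by
  rw [← Category.assoc, homPost_homMap, Category.assoc]

lemma homMap_natural (Φ : A ⥤ B) [Φ.Additive] {X Y L L' : CochainComplex A ℤ} (a : X ⟶ Y)
    (b : L ⟶ L') {P P' : CochainComplex B ℤ} (t : (cx Φ).obj L ⟶ P) (t' : (cx Φ).obj L' ⟶ P')
    (e : P ⟶ P') (h : (cx Φ).map b ≫ t' = t ≫ e) :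
    (homMap Φ Y L ≫ homPost _ t) ≫ homPre ((cx Φ).map a) _ ≫ homPost _ e =
      (homPre a L ≫ homPost _ b) ≫ homMap Φ X L' ≫ homPost _ t' := by
  simp only [Category.assoc]
  rw [← homPre_homPost_assoc, homPost_homPost, homPost_homMap_assoc, homPost_homPost,
    homPre_homMap_assoc, h]

end naturality

lemma h₀_map : h₀ M M' ≫ homPre ((sigmaPart K σ).map f) _ ≫ homPost _ ((zeroPart K σ).map g) =
    (homPre ((zeroPart K σ).map f) _ ≫ homPost _ ((zeroPart K σ).map g)) ≫ h₀ N N' := by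
  have e₁ := (frob K σ).naturality f
  rw [h₀, h₀, Preadditive.sub_comp, Preadditive.comp_sub]
  congr 1
  · rw [(homPre_homPre_assoc ((sigmaPart K σ).map f)), e₁, Category.assoc, ← homPre_homPost,
      (homPre_homPre_assoc ((frob K σ).app N))]
  · exact homMap_natural (twist σ) ((zeroPart K σ).map f) ((zeroPart K σ).map g) _ _ _
      ((frob K σ).naturality g)

lemma h₁_map : h₁ M M' ≫ homPre ((rigPart K σ).map f) _ ≫ homPost _ ((vecPart K σ).map g) =
    (homPre ((zeroPart K σ).map f) _ ≫ homPost _ ((zeroPart K σ).map g)) ≫ h₁ N N' :=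
  homMap_natural (baseChange K₀ K) ((zeroPart K σ).map f) ((zeroPart K σ).map g) _ _ _
    ((compC K σ).naturality g)

lemma h₂_map : h₂ M M' ≫ homPre ((rigPart K σ).map f) _ ≫ homPost _ ((vecPart K σ).map g) =
    (homPre ((vecPart K σ).map f) _ ≫ homPost _ ((vecPart K σ).map g)) ≫ h₂ N N' := by
  have e₁ := (compC K σ).naturality f
  simp only [h₂, Category.assoc]
  rw [(homPre_homPre_assoc ((rigPart K σ).map f)), e₁, ← homPre_homPost,
    (homPre_homPre_assoc ((compC K σ).app N))]

lemma h₃_map : h₃ M M' ≫ homPre ((dRVecPart K σ).map f) _ ≫ homPost _ ((vecPart K σ).map g) =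
    (homPre ((vecPart K σ).map f) _ ≫ homPost _ ((vecPart K σ).map g)) ≫ h₃ N N' := by
  have e₁ := (compS K σ).naturality f
  simp only [h₃, Category.assoc]
  rw [(homPre_homPre_assoc ((dRVecPart K σ).map f)), e₁, ← homPre_homPost,
    (homPre_homPre_assoc ((compS K σ).app N))]

lemma h₄_map : h₄ M M' ≫ homPre ((dRVecPart K σ).map f) _ ≫ homPost _ ((vecPart K σ).map g) =
    (homPre ((dRPart K σ).map f) _ ≫ homPost _ ((dRPart K σ).map g)) ≫ h₄ N N' :=
  homMap_natural (Filt.forget K) ((dRPart K σ).map f) ((dRPart K σ).map g) _ _ _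
    ((compS K σ).naturality g)

lemma psi_map : psi M M' ≫ Gamma₁.map f g = Gamma₀.map f g ≫ psi N N' := by
  have e₀ := h₀_map f g
  have e₁ := h₁_map f g
  have e₂ := h₂_map f g
  have e₃ := h₃_map f g
  have e₄ := h₄_map f g
  apply biprod.hom_ext' _ _ _ (biprod.hom_ext' _ _ _ _)
  · apply biprod.hom_ext _ _ _ (biprod.hom_ext _ _ _ _) <;>
      simp [-Functor.comp_map, -Functor.comp_obj, psi, Gamma₀.map, Gamma₁.map, e₀, e₁]
  · apply biprod.hom_ext _ _ _ (biprod.hom_ext _ _ _ _) <;>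
      simp [-Functor.comp_map, -Functor.comp_obj, psi, Gamma₀.map, Gamma₁.map, e₂, e₃]
  · apply biprod.hom_ext _ _ _ (biprod.hom_ext _ _ _ _) <;>
      simp [-Functor.comp_map, -Functor.comp_obj, psi, Gamma₀.map, Gamma₁.map, e₄]

/-- The map `Γ(M, M') ⟶ Γ(N, N')`, `x ↦ g ∘ x ∘ f`, induced by `f : N ⟶ M` and
`g : M' ⟶ N'`. -/
def Gamma.map : Gamma M M' ⟶ Gamma N N' :=
  (mappingCone.map (psi M M') (psi N N') (Gamma₀.map f g) (Gamma₁.map f g)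
    (psi_map f g))⟦(-1 : ℤ)⟧'

variable (M M')

/-- The inclusion `Hom^•(M, M') ⟶ Γ₀(M, M')`, `x ↦ (x₀, x_K, x_dR)`, of the complex of
homogeneous maps of all degrees `M ⟶ M'` which are compatible with all the structures. -/
def homToGamma₀ : HomComplex M M' ⟶ Gamma₀ M M' :=
  biprod.lift (homMap (Sys.rigFunctor K σ) M M')
    (biprod.lift (homMap (Sys.vecFunctor K σ) M M') (homMap (Sys.dRFunctor K σ) M M'))

lemma homToGamma₀_psi : homToGamma₀ M M' ≫ psi M M' = 0 := by
  have e₀ : homMap (Sys.rigFunctor K σ) M M' ≫ h₀ M M' = 0 := by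
    rw [h₀, Preadditive.comp_sub, sub_eq_zero]
    ext n (z : HomComplex.Cochain M M' n)
    change (HomComplex.Cochain.ofHom ((frob K σ).app M)).comp (z.map (Sys.rigFunctor K σ))
      (zero_add n) = ((z.map (Sys.rigFunctor K σ)).map (twist σ)).comp
        (HomComplex.Cochain.ofHom ((frob K σ).app M')) (add_zero n)
    refine HomComplex.Cochain.ext _ _ fun p q hpq => ?_
    rw [HomComplex.Cochain.zero_cochain_comp_v, HomComplex.Cochain.comp_zero_cochain_v,
      HomComplex.Cochain.ofHom_v, HomComplex.Cochain.ofHom_v]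
    exact (z.v p q hpq).frob_comm
  have e₁ : homMap (Sys.rigFunctor K σ) M M' ≫ h₁ M M' =
      homMap (Sys.vecFunctor K σ) M M' ≫ h₂ M M' := by
    ext n (z : HomComplex.Cochain M M' n)
    change ((z.map (Sys.rigFunctor K σ)).map (baseChange K₀ K)).comp
        (HomComplex.Cochain.ofHom ((compC K σ).app M')) (add_zero n) =
      (HomComplex.Cochain.ofHom ((compC K σ).app M)).comp (z.map (Sys.vecFunctor K σ)) (zero_add n)
    refine HomComplex.Cochain.ext _ _ fun p q hpq => ?_
    rw [HomComplex.Cochain.zero_cochain_comp_v, HomComplex.Cochain.comp_zero_cochain_v,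
      HomComplex.Cochain.ofHom_v, HomComplex.Cochain.ofHom_v]
    exact (z.v p q hpq).c_comm.symm
  have e₂ : homMap (Sys.vecFunctor K σ) M M' ≫ h₃ M M' =
      homMap (Sys.dRFunctor K σ) M M' ≫ h₄ M M' := by
    ext n (z : HomComplex.Cochain M M' n)
    change (HomComplex.Cochain.ofHom ((compS K σ).app M)).comp (z.map (Sys.vecFunctor K σ))
        (zero_add n) = ((z.map (Sys.dRFunctor K σ)).map (Filt.forget K)).comp
        (HomComplex.Cochain.ofHom ((compS K σ).app M')) (add_zero n)
    refine HomComplex.Cochain.ext _ _ fun p q hpq => ?_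
    rw [HomComplex.Cochain.zero_cochain_comp_v, HomComplex.Cochain.comp_zero_cochain_v,
      HomComplex.Cochain.ofHom_v, HomComplex.Cochain.ofHom_v]
    exact (z.v p q hpq).s_comm
  apply biprod.hom_ext _ _ _ (biprod.hom_ext _ _ _ _) <;>
    simp [psi, homToGamma₀, e₀, e₁, e₂]

/-- The morphism of complexes `Hom^•(M, M') ⟶ Γ(M, M')`, `x ↦ ((x₀, x_K, x_dR), 0)`. -/
def homToGamma : HomComplex M M' ⟶ Gamma M M' :=
  mappingCocone.lift (psi M M') (homToGamma₀ M M') 0 (by simp [homToGamma₀_psi])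

variable {M M'}

/-- The class in `H^n(Γ(M, M'))` of a morphism of complexes of systems `f : M ⟶ M'[n]`:
`f` is a cocycle of degree `n` of `Hom^•(M, M')`, and its class is that of
`((f₀, f_K, f_dR), 0)`. -/
def homClass {n : ℤ} (f : M ⟶ M'⟦n⟧) : (Gamma M M').homology n :=
  HomologicalComplex.homologyMap (homToGamma M M') n
    ((HomComplex.homologyAddEquiv M M' n).symm
      (HomComplex.CohomologyClass.mk (HomComplex.Cocycle.equivHomShift f)))

end Gamma

/-! ## The arithmetic situation -/

section Witt

variable (p : ℕ) [Fact p.Prime] (R : Type u) [CommRing R] [IsLocalRing R]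

/-- `K₀ = Frac W(k)`, where `k` is the residue field of `R`. -/
abbrev Kzero : Type u := FractionRing (WittVector p (IsLocalRing.ResidueField R))

/-- The Frobenius `σ` of `K₀`. -/
abbrev sigma [CharP (IsLocalRing.ResidueField R) p] [PerfectRing (IsLocalRing.ResidueField R) p] :
    Kzero p R →+* Kzero p R :=
  WittVector.FractionRing.frobeniusRingHom p (IsLocalRing.ResidueField R)

end Witt

end PadicHodge

end

open PadicHodge

/-! Over a field every quasi-isomorphism of complexes is a homotopy equivalence. The same holds for
filtered quasi-isomorphisms when the filtrations are exhaustive and vanish in high degree: a basis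
adapted to the filtration splits strict exact complexes (`exists_filtered_section`,
`nonempty_contraction_of_strict_exact`). Hence the quasi-isomorphisms of pHC are exactly the
morphisms whose components f₀, f_K, f_dR are homotopy equivalences, with inverses that need not
respect φ, c, s (`quasiIso_toHK_map_iff`). As Γ₀ and Γ₁ see only the components, Hⁿ(Γ(M, M')) is
invariant under quasi-isomorphisms in both variables (`isIso_homologyMap_gamma`).

The kernel of ψ is the complex of maps strictly compatible with all structures, whose cohomology is
Hom in pHK. The map ψ need not be surjective, but any y in Γ₁(M, M') of degree m is hit after a
quasi-isomorphism t : N → M (`exists_psi_eq_gamma₁_map`). Let P be the cone of the identity of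
M'[m]; it is contractible and carries a universal cochain P → M' of degree m. On M ⊕ P one adds to
φ, c, s off-diagonal terms M → P that encode y. The result N has the components of M ⊕ P, still
projects to M, and the universal cochain gives q with ψ(q) = y t.

If (x, y) is a cocycle of Γ(M, M'), then z = x t + d q is strict, and (z, 0) differs from the
pullback of (x, y) by d(q, 0). So every class comes, after a quasi-isomorphism, from a genuine
morphism. The same correction one degree lower shows that a genuine morphism with zero class becomes
null-homotopic after a quasi-isomorphism.

Together with invariance, these two facts first give a right calculus of fractions on pHK. Then they
show that Hⁿ(Γ(-, M')), which factors through pHD, is represented there by M'[n], the universal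
element being the class of the identity (`exists_addEquiv_of_localization`). For complexes in degree
0 the vanishing is immediate, since Γⁿ = Γ₀ⁿ ⊕ Γ₁ⁿ⁻¹ is zero unless n is 0 or 1. -/

noncomputable section

namespace PadicHodge

/-! ### Adapted bases and filtered sections -/

section Splitting

variable {k : Type*} [Field k] {V W : Type*} [AddCommGroup V] [Module k V]
  [AddCommGroup W] [Module k W]

/-- A basis of each step extends to a basis of the next. The recursion starts from the empty set,
which spans F 0 = ⊥, and the union remains independent because the sets form a chain. -/
lemma exists_adapted_basis (F : ℕ → Submodule k V) (hF : Monotone F) (h0 : F 0 = ⊥) :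
    ∃ B : ℕ → Set V, Monotone B ∧ (∀ n, B n ⊆ F n) ∧
      (∀ n, (F n : Set V) ⊆ Submodule.span k (B n)) ∧
      LinearIndepOn k id (⋃ n, B n) := by
  have step : ∀ (n : ℕ) (s : {s : Set V // s ⊆ F n ∧ LinearIndepOn k id s}),
      ∃ t : {s : Set V // s ⊆ F (n + 1) ∧ LinearIndepOn k id s},
        s.1 ⊆ t.1 ∧ (F (n + 1) : Set V) ⊆ Submodule.span k t.1 := fun n s => by
    obtain ⟨b, hb, hsb, htb, hli⟩ := exists_linearIndepOn_id_extension s.2.2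
      (s.2.1.trans (hF n.le_succ))
    exact ⟨⟨b, hb, hli⟩, hsb, htb⟩
  choose ext hext₁ hext₂ using step
  let B : ∀ n, {s : Set V // s ⊆ F n ∧ LinearIndepOn k id s} := fun n =>
    Nat.rec ⟨∅, by simp, linearIndependent_empty_type⟩ ext n
  have hB : Monotone (fun n => (B n).1) := monotone_nat_of_le_succ fun n => hext₁ n (B n)
  refine ⟨fun n => (B n).1, hB, fun n => (B n).2.1, fun n => ?_, ?_⟩
  · cases n with
    | zero => simp [h0]
    | succ n => exact hext₂ n (B n)
  · exact linearIndepOn_iUnion_of_directed hB.directed_le fun n => (B n).2.2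

/-- A strict surjection of filtered vector spaces has a filtered section, if the filtration of the
target is exhaustive and vanishes in large degrees. -/
lemma exists_filtered_section (F : ℤ → Submodule k V) (hF : Antitone F) (hex : ∀ v, ∃ i, v ∈ F i)
    (N : ℤ) (hN : F N = ⊥) (G : ℤ → Submodule k W) (hG : Antitone G) (d : W →ₗ[k] V)
    (hd : ∀ i, ∀ v ∈ F i, ∃ w ∈ G i, d w = v) :
    ∃ s : V →ₗ[k] W, (∀ v, d (s v) = v) ∧ ∀ i, ∀ v ∈ F i, s v ∈ G i := by
  classical
  -- Counting down from N, where F vanishes, turns the descending filtration into an ascending one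
  -- that starts at zero.
  obtain ⟨B, hB, hBF, hFB, hli⟩ := exists_adapted_basis (fun n : ℕ => F (N - n))
    (fun a b h => hF (by omega)) (by simpa using hN)
  have hspan : ⊤ ≤ Submodule.span k (Set.range ((↑) : (⋃ n, B n) → V)) := by
    rintro v -
    obtain ⟨i, hi⟩ := hex v
    rw [Subtype.range_coe]
    refine Submodule.span_mono (Set.subset_iUnion B (N - i).toNat) (hFB _ ?_)
    exact hF (by omega) hi
  let b : Module.Basis (⋃ n, B n) k V := Module.Basis.mk hli hspan
  have hex' : ∀ x : (⋃ n, B n), ∃ n, x.1 ∈ B n := fun x => Set.mem_iUnion.1 x.2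
  -- The lift is taken at the first n with x in B n, that is, in the smallest available step of G.
  -- As G is descending, this one lift serves every later n.
  have key : ∀ x : (⋃ n, B n), ∃ w : W, d w = x ∧ ∀ n, x.1 ∈ B n → w ∈ G (N - n) := fun x => by
    obtain ⟨w, hw, hdw⟩ := hd _ _ (hBF _ (Nat.find_spec (hex' x)))
    refine ⟨w, hdw, fun n hn => hG ?_ hw⟩
    have := Nat.find_min' (hex' x) hn
    omega
  choose w hdw hw using key
  have hsw : ∀ x : (⋃ n, B n), b.constr k w x.1 = w x := fun x => by
    have := b.constr_basis k w x
    rwa [show b x = x.1 from by simp [b]] at this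
  refine ⟨b.constr k w, fun v => ?_, fun i v hv => ?_⟩
  · suffices d ∘ₗ b.constr k w = LinearMap.id from LinearMap.congr_fun this v
    refine b.ext fun x => ?_
    rw [LinearMap.comp_apply, b.constr_basis, hdw]
    simp [b]
  · by_cases hi : N ≤ i
    · have := hF hi hv
      rw [hN, Submodule.mem_bot] at this
      simp [this]
    · obtain ⟨n, hn⟩ : ∃ n : ℕ, i = N - n := ⟨(N - i).toNat, by omega⟩
      subst hn
      have : Submodule.span k (B n) ≤ (G (N - n)).comap (b.constr k w) := by
        rw [Submodule.span_le]
        intro x hx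
        have := hsw ⟨x, Set.mem_iUnion.2 ⟨n, hx⟩⟩
        simp only [Submodule.comap_coe, Set.mem_preimage, SetLike.mem_coe]
        rw [this]
        exact hw _ _ hx
      exact this (hFB n hv)

end Splitting

/-! ### Contractibility of strictly exact filtered complexes -/

section Contractible

variable {K : Type u} [Field K]

lemma Filt.exists_mem_F (V : Filt K) (v : V.V) : ∃ i, v ∈ V.F i := by
  have := V.exhaustive ▸ Submodule.mem_top (x := v)
  exact (Submodule.mem_iSup_of_directed _ (V.anti.directed_le)).1 this

/-- A complex of filtered vector spaces all of whose steps are acyclic is contractible. -/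
lemma nonempty_contraction_of_strict_exact (C : CochainComplex (Filt K) ℤ)
    (hC : ∀ (n i : ℤ) (z : (C.X (n + 1)).V), z ∈ (C.X (n + 1)).F i →
      (C.d (n + 1) (n + 1 + 1)).hom.hom z = 0 →
        ∃ w ∈ (C.X n).F i, (C.d n (n + 1)).hom.hom w = z) :
    Nonempty (Homotopy (𝟙 C) 0) := by
  have hdd : ∀ (a b c : ℤ) x, (C.d b c).hom.hom ((C.d a b).hom.hom x) = 0 := fun a b c x => by
    have := congrArg (fun f => f.hom.hom x) (C.d_comp_d a b c)
    exact this
  -- The filtration induced on the cocycles of degree n + 1 is exhaustive and vanishes at the same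
  -- N. The hypothesis says that d maps each step of Cⁿ onto the corresponding step of the cocycles,
  -- so d has a filtered section on them.
  have hs : ∀ n : ℤ, ∃ s : LinearMap.ker (C.d (n + 1) (n + 1 + 1)).hom.hom →ₗ[K] (C.X n).V,
      (∀ v, (C.d n (n + 1)).hom.hom (s v) = v) ∧
        ∀ i v, v.1 ∈ (C.X (n + 1)).F i → s v ∈ (C.X n).F i := fun n => by
    obtain ⟨N, hN⟩ := (C.X (n + 1)).eventually_bot
    obtain ⟨s, h₁, h₂⟩ := exists_filtered_section
      (fun i => ((C.X (n + 1)).F i).comap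
        (LinearMap.ker (C.d (n + 1) (n + 1 + 1)).hom.hom).subtype)
      (fun i j h v hv => (C.X (n + 1)).anti h hv) (fun v => (C.X (n + 1)).exists_mem_F v.1) N
      (by
        rw [hN]
        exact LinearMap.ker_eq_bot.2 (Submodule.injective_subtype _))
      (C.X n).F (C.X n).anti
      (((C.d n (n + 1)).hom.hom).codRestrict _ (fun x => hdd _ _ _ x))
      (fun i v hv => by
        obtain ⟨w, hw, hdw⟩ := hC n i v.1 hv v.2
        exact ⟨w, hw, Subtype.ext hdw⟩)
    exact ⟨s, fun v => congrArg Subtype.val (h₁ v), h₂⟩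
  choose s hs₁ hs₂ using hs
  -- The contraction is h = s (1 - s d); the vector x - s(dx) is a cocycle because d s = 1 on
  -- cocycles. Then d(hx) = x - s(dx), and h(dx) = s(dx) since d(dx) = 0, so dh + hd = 1.
  let h : ∀ n : ℤ, C.X (n + 1) ⟶ C.X n := fun n =>
    { hom := ModuleCat.ofHom (s n ∘ₗ (LinearMap.codRestrict _
        (LinearMap.id - (s (n + 1)) ∘ₗ ((C.d (n + 1) (n + 1 + 1)).hom.hom.codRestrict _
          (fun x => hdd _ _ _ x)))
        (fun x => by
          have := hs₁ (n + 1) ⟨(C.d (n + 1) (n + 1 + 1)).hom.hom x, hdd _ _ _ x⟩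
          simp only [LinearMap.mem_ker, LinearMap.sub_apply, map_sub, LinearMap.id_apply,
            LinearMap.comp_apply]
          exact sub_eq_zero.2 this.symm)))
      map_le := fun i x hx => by
        refine hs₂ n i _ ?_
        rw [LinearMap.codRestrict_apply]
        exact ((C.X (n + 1)).F i).sub_mem hx
          (hs₂ (n + 1) i ⟨_, hdd _ _ _ x⟩ ((C.d (n + 1) (n + 1 + 1)).map_le i hx)) }
  have hh : ∀ n x, (h n).hom.hom x = s n ⟨x - s (n + 1) ⟨(C.d (n + 1) (n + 1 + 1)).hom.hom x,
      hdd _ _ _ x⟩, by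
        have := hs₁ (n + 1) ⟨(C.d (n + 1) (n + 1 + 1)).hom.hom x, hdd _ _ _ x⟩
        rw [LinearMap.mem_ker, map_sub]
        exact sub_eq_zero.2 this.symm⟩ := fun n x => rfl
  have hrel : ∀ n : ℤ, h (n + 1) ≫ C.d (n + 1) (n + 1 + 1) +
      C.d (n + 1 + 1) (n + 1 + 1 + 1) ≫ h (n + 1 + 1) = 𝟙 _ := fun n => by
    apply Filt.hom_ext
    ext x
    change (C.d (n + 1) (n + 1 + 1)).hom.hom ((h (n + 1)).hom.hom x) +
      (h (n + 1 + 1)).hom.hom ((C.d (n + 1 + 1) (n + 1 + 1 + 1)).hom.hom x) = x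
    rw [hh, hs₁, hh]
    have : (C.d (n + 1 + 1 + 1) (n + 1 + 1 + 1 + 1)).hom.hom
      ((C.d (n + 1 + 1) (n + 1 + 1 + 1)).hom.hom x) = 0 := hdd _ _ _ _
    simp only [this]
    have e : s (n + 1 + 1 + 1) ⟨0, Submodule.zero_mem _⟩ = 0 := map_zero _
    simp [e]
  refine ⟨⟨fun i j => if hij : j + 1 = i then (C.XIsoOfEq hij.symm).hom ≫ h j else 0,
    fun i j hij => dif_neg hij, fun i => ?_⟩⟩
  -- With the degree in this form both components of the homotopy that occur are values of `h` up to
  -- a trivial cast, and `hrel` applies.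
  obtain ⟨n, rfl⟩ : ∃ n, i = n + 1 + 1 := ⟨i - 1 - 1, by ring⟩
  rw [dNext_eq _ (show (ComplexShape.up ℤ).Rel (n + 1 + 1) (n + 1 + 1 + 1) from rfl),
    prevD_eq _ (show (ComplexShape.up ℤ).Rel (n + 1) (n + 1 + 1) from rfl)]
  simp only [HomologicalComplex.id_f, HomologicalComplex.zero_f, add_zero, dite_true]
  refine Eq.trans ?_ (add_comm _ _)
  simpa using (hrel n).symm

end Contractible

/-! ### Direct sums of filtered vector spaces and of systems -/

section Biproducts

namespace Filt

variable {K : Type u} [Field K]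

lemma exhaustive_of_exists_mem {V : Type*} [AddCommGroup V] [Module K V]
    (F : ℤ → Submodule K V) (h : ∀ v, ∃ i, v ∈ F i) : ⨆ i, F i = ⊤ :=
  eq_top_iff.2 fun v _ => by
    obtain ⟨i, hi⟩ := h v
    exact Submodule.mem_iSup_of_mem i hi

/-- The direct sum of two filtered vector spaces. -/
def prod (V W : Filt K) : Filt K where
  V := ModuleCat.of K (V.V × W.V)
  F i := (V.F i).prod (W.F i)
  anti _ _ h := Submodule.prod_mono (V.anti h) (W.anti h)
  exhaustive := exhaustive_of_exists_mem _ fun v => by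
    obtain ⟨i, hi⟩ := V.exists_mem_F v.1
    obtain ⟨j, hj⟩ := W.exists_mem_F v.2
    exact ⟨min i j, V.anti (min_le_left i j) hi, W.anti (min_le_right i j) hj⟩
  eventually_bot := by
    obtain ⟨i, hi⟩ := V.eventually_bot
    obtain ⟨j, hj⟩ := W.eventually_bot
    refine ⟨max i j, ?_⟩
    rw [eq_bot_iff, ← Submodule.prod_bot, ← hi, ← hj]
    exact Submodule.prod_mono (V.anti (le_max_left i j)) (W.anti (le_max_right i j))

/-- The direct sum of two filtered vector spaces, as a bicone. -/
def prodBicone (V W : Filt K) : BinaryBicone V W where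
  pt := prod V W
  fst := ⟨ModuleCat.ofHom (LinearMap.fst K V.V W.V), fun _ _ h => h.1⟩
  snd := ⟨ModuleCat.ofHom (LinearMap.snd K V.V W.V), fun _ _ h => h.2⟩
  inl := ⟨ModuleCat.ofHom (LinearMap.inl K V.V W.V), fun i _ h => ⟨h, (W.F i).zero_mem⟩⟩
  inr := ⟨ModuleCat.ofHom (LinearMap.inr K V.V W.V), fun i _ h => ⟨(V.F i).zero_mem, h⟩⟩

instance : HasBinaryBiproducts (Filt K) where
  has_binary_biproduct V W := ⟨⟨{
    bicone := prodBicone V W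
    isBilimit := isBinaryBilimitOfTotal _ (by
      apply hom_ext
      ext x
      exact Prod.fst_add_snd (M := V.V) (N := W.V) x) }⟩⟩

variable (K) in
/-- The functor which endows a vector space `V` with the filtration such that `F^i V = V` for
`i ≤ 0` and `F^i V = 0` for `i > 0`. -/
def triv : ModuleCat.{u} K ⥤ Filt K where
  obj V :=
    { V := V
      F := fun i => if i ≤ 0 then ⊤ else ⊥
      anti := fun i j h => by
        dsimp only
        split_ifs <;> first | exact le_top | exact bot_le | omega
      exhaustive := exhaustive_of_exists_mem _ fun v => ⟨0, by simp⟩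
      eventually_bot := ⟨1, by simp⟩ }
  map f :=
    { hom := f
      map_le := fun i => by
        by_cases h : i ≤ 0 <;> simp [h] }

lemma mem_triv_F (V : ModuleCat.{u} K) (i : ℤ) (v : V) :
    v ∈ ((triv K).obj V).F i ↔ i ≤ 0 ∨ v = 0 := by
  change v ∈ (if i ≤ 0 then ⊤ else ⊥ : Submodule K V) ↔ _
  split_ifs with h <;> simp [h]

instance : (triv K).Additive where
  map_add := rfl

/-- A zero object, together with binary biproducts, gives the homotopy category of `Filt K` its
mapping cone triangles. -/
instance : HasZeroObject (Filt K) := by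
  obtain ⟨Z, hZ⟩ := (inferInstance : HasZeroObject (ModuleCat.{u} K))
  refine ⟨(triv K).obj Z, ?_⟩
  rw [IsZero.iff_id_eq_zero] at hZ ⊢
  rw [← (triv K).map_id, hZ, (triv K).map_zero]

end Filt

namespace Sys

variable {K₀ K : Type u} [Field K₀] [Field K] [Algebra K₀ K] {σ : K₀ →+* K₀}

/-- The direct sum of two systems. -/
def biprod (M N : Sys K σ) : Sys K σ where
  rig := M.rig ⊞ N.rig
  frob := (twist σ).map biprod.fst ≫ M.frob ≫ biprod.inl +
    (twist σ).map biprod.snd ≫ N.frob ≫ biprod.inr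
  dR := M.dR ⊞ N.dR
  vec := M.vec ⊞ N.vec
  c := (baseChange K₀ K).map biprod.fst ≫ M.c ≫ biprod.inl +
    (baseChange K₀ K).map biprod.snd ≫ N.c ≫ biprod.inr
  s := (biprod.fst : M.dR ⊞ N.dR ⟶ _).hom ≫ M.s ≫ biprod.inl +
    (biprod.snd : M.dR ⊞ N.dR ⟶ _).hom ≫ N.s ≫ biprod.inr

/-- The direct sum of two systems, as a bicone. -/
def biprodBicone (M N : Sys K σ) : BinaryBicone M N where
  pt := biprod M N
  fst := ⟨biprod.fst, biprod.fst, biprod.fst, by simp [biprod], by simp [biprod], by simp [biprod]⟩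
  snd := ⟨biprod.snd, biprod.snd, biprod.snd, by simp [biprod], by simp [biprod], by simp [biprod]⟩
  inl := ⟨biprod.inl, biprod.inl, biprod.inl,
    by simp [biprod, ← Functor.map_comp_assoc], by simp [biprod, ← Functor.map_comp_assoc], by
      simp only [biprod, Preadditive.comp_add, ← Category.assoc, ← Filt.comp_hom]
      simp⟩
  inr := ⟨biprod.inr, biprod.inr, biprod.inr,
    by simp [biprod, ← Functor.map_comp_assoc], by simp [biprod, ← Functor.map_comp_assoc], by
      simp only [biprod, Preadditive.comp_add, ← Category.assoc, ← Filt.comp_hom]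
      simp⟩
  inl_fst := hom_ext biprod.inl_fst biprod.inl_fst biprod.inl_fst
  inl_snd := hom_ext biprod.inl_snd biprod.inl_snd biprod.inl_snd
  inr_fst := hom_ext biprod.inr_fst biprod.inr_fst biprod.inr_fst
  inr_snd := hom_ext biprod.inr_snd biprod.inr_snd biprod.inr_snd

instance : HasBinaryBiproducts (Sys K σ) where
  has_binary_biproduct M N := ⟨⟨{
    bicone := biprodBicone M N
    isBilimit := isBinaryBilimitOfTotal _
      (hom_ext biprod.total biprod.total biprod.total) }⟩⟩

end Sys

end Biproducts

/-! ### Quasi-isomorphisms over a field are homotopy equivalences -/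

section QuasiIso

open CochainComplex

lemma acyclic_mappingCone_of_quasiIso {A : Type*} [Category* A] [Abelian A]
    {X Y : CochainComplex A ℤ} (f : X ⟶ Y) (hf : QuasiIso f) : (mappingCone f).Acyclic := by
  have h := (HomotopyCategory.quotient_map_mem_quasiIso_iff f).2 hf
  rw [HomotopyCategory.quasiIso_eq_trW_subcategoryAcyclic] at h
  exact (HomotopyCategory.quotient_obj_mem_subcategoryAcyclic_iff_acyclic _).1
    ((ObjectProperty.trW_iff_of_distinguished _ _
      (HomotopyCategory.mappingCone_triangleh_distinguished f)).1 h)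

/-- Additive functors commute with mapping cones, so exactness of the cone of Φ(f) can be read on
elements of the cone of f itself. It serves for Φ = gr^i, the identity, and base change to K. -/
lemma exists_d_eq_of_quasiIso_map {A : Type*} [Category* A] [Preadditive A]
    [HasBinaryBiproducts A] {k : Type u} [Field k] (Φ : A ⥤ ModuleCat.{u} k) [Φ.Additive]
    {X Y : CochainComplex A ℤ} (f : X ⟶ Y) (hf : QuasiIso ((cx Φ).map f)) (n : ℤ)
    (z : Φ.obj ((mappingCone f).X (n + 1)))
    (hz : (Φ.map ((mappingCone f).d (n + 1) (n + 1 + 1))).hom z = 0) :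
    ∃ w, (Φ.map ((mappingCone f).d n (n + 1))).hom w = z := by
  have h := (acyclic_mappingCone_of_quasiIso _ hf) (n + 1)
  have h' : ((cx Φ).obj (mappingCone f)).ExactAt (n + 1) := by
    rw [HomologicalComplex.exactAt_iff_isZero_homology] at h ⊢
    exact h.of_iso ((HomologicalComplex.homologyFunctor _ _ (n + 1)).mapIso
      (mappingCone.mapHomologicalComplexIso f Φ))
  rw [HomologicalComplex.exactAt_iff' _ n (n + 1) (n + 1 + 1) (by simp) (by simp),
    ShortComplex.moduleCat_exact_iff] at h'
  exact h' z hz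

lemma isIso_quotient_map_of_contraction {A : Type*} [Category* A] [Preadditive A]
    [HasZeroObject A] [HasBinaryBiproducts A] {X Y : CochainComplex A ℤ} (f : X ⟶ Y)
    (h : Nonempty (Homotopy (𝟙 (mappingCone f)) 0)) :
    IsIso ((HomotopyCategory.quotient A (ComplexShape.up ℤ)).map f) :=
  (Pretriangulated.Triangle.isZero₃_iff_isIso₁ _
    (HomotopyCategory.mappingCone_triangleh_distinguished f)).1
    ((HomotopyCategory.isZero_quotient_obj_iff _).2 h)

variable {K : Type u} [Field K]

/-- A filtered quasi-isomorphism is a filtered homotopy equivalence. -/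
lemma isIso_quotient_map_of_quasiIso_gr {X Y : CochainComplex (Filt K) ℤ} (f : X ⟶ Y)
    (hf : ∀ i, QuasiIso ((cx (Filt.gr K i)).map f)) :
    IsIso ((HomotopyCategory.quotient _ (ComplexShape.up ℤ)).map f) := by
  refine isIso_quotient_map_of_contraction f (nonempty_contraction_of_strict_exact _ ?_)
  intro n i z hz hdz
  have hdd : ∀ (a b c : ℤ) x, ((mappingCone f).d b c).hom.hom (((mappingCone f).d a b).hom.hom x)
      = 0 := fun a b c x => congrArg (fun f => f.hom.hom x) ((mappingCone f).d_comp_d a b c)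
  obtain ⟨N, hN⟩ := ((mappingCone f).X (n + 1)).eventually_bot
  -- Descending induction on i, which starts at i ≥ N, where the step is zero. Exactness of gr^i
  -- solves d w = z modulo F^{i+1}; the error d w - z is a cocycle in F^{i+1}, to which the
  -- induction hypothesis applies.
  obtain ⟨k, hk⟩ : ∃ k : ℕ, N ≤ i + k := ⟨(N - i).toNat, by omega⟩
  induction k generalizing i z with
  | zero =>
    have := ((mappingCone f).X (n + 1)).anti hk (by simpa using hz)
    rw [hN, Submodule.mem_bot] at this
    exact ⟨0, Submodule.zero_mem _, by rw [this, map_zero]⟩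
  | succ k ih =>
    obtain ⟨w, hw⟩ := exists_d_eq_of_quasiIso_map (Filt.gr K i) f (hf i) n
      (Submodule.Quotient.mk ⟨z, hz⟩) (by
        change Submodule.Quotient.mk _ = _
        exact (Submodule.Quotient.mk_eq_zero _).2 (by
          refine (Submodule.mem_comap).2 ?_
          change ((mappingCone f).d (n + 1) (n + 1 + 1)).hom.hom z ∈
            ((mappingCone f).X (n + 1 + 1)).F (i + 1)
          rw [hdz]
          exact Submodule.zero_mem _))
    obtain ⟨w, rfl⟩ := Submodule.Quotient.mk_surjective _ w
    have hw' : ((mappingCone f).d n (n + 1)).hom.hom w.1 - z ∈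
        ((mappingCone f).X (n + 1)).F (i + 1) :=
      (Submodule.Quotient.eq ((((mappingCone f).X (n + 1)).F (i + 1)).comap
        (((mappingCone f).X (n + 1)).F i).subtype)).1 hw
    obtain ⟨v, hv, hdv⟩ := ih (i + 1) _ hw' (by rw [map_sub, hdd, hdz, sub_zero])
      (by push_cast at hk; omega)
    refine ⟨w.1 - v, Submodule.sub_mem _ w.2 (((mappingCone f).X n).anti (by omega) hv), ?_⟩
    rw [map_sub, hdv, sub_sub_cancel]

/-- For the trivial filtration strict exactness is plain exactness; forgetting the filtration
afterwards keeps the contraction. -/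
lemma isIso_quotient_map_of_quasiIso {X Y : CochainComplex (ModuleCat.{u} K) ℤ} (f : X ⟶ Y)
    (hf : QuasiIso f) : IsIso ((HomotopyCategory.quotient _ (ComplexShape.up ℤ)).map f) := by
  refine isIso_quotient_map_of_contraction f ?_
  obtain ⟨h⟩ := nonempty_contraction_of_strict_exact ((cx (Filt.triv K)).obj (mappingCone f))
    (fun n i z hz hdz => by
      replace hz := (Filt.mem_triv_F _ _ _).1 hz
      simp_rw [show ∀ w, (w ∈ (((cx (Filt.triv _)).obj (mappingCone f)).X n).F i) ↔ _ from
        Filt.mem_triv_F _ i]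
      by_cases hi : i ≤ 0
      · obtain ⟨w, hw⟩ := exists_d_eq_of_quasiIso_map (𝟭 _) f (by
          change QuasiIso f
          exact hf) n z hdz
        exact ⟨w, Or.inl hi, hw⟩
      · obtain rfl := hz.resolve_left hi
        exact ⟨0, Or.inr rfl, map_zero _⟩)
  exact ⟨(Filt.forget K).mapHomotopy h⟩

variable {K₀ : Type u} [Field K₀] [Algebra K₀ K]

/-- A K₀-linear form l on K with l(1) = 1 makes V a natural direct summand of V ⊗ K, so exactness
may be tested after base change. -/
lemma exists_retraction_baseChange :
    ∃ (ι : ∀ V : ModuleCat.{u} K₀, V →+ (baseChange K₀ K).obj V)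
      (ρ : ∀ V : ModuleCat.{u} K₀, (baseChange K₀ K).obj V →+ V),
      (∀ V v, ρ V (ι V v) = v) ∧
      (∀ (V W : ModuleCat.{u} K₀) (f : V ⟶ W) v,
        ((baseChange K₀ K).map f).hom (ι V v) = ι W (f.hom v)) ∧
      ∀ (V W : ModuleCat.{u} K₀) (f : V ⟶ W) x,
        ρ W (((baseChange K₀ K).map f).hom x) = f.hom (ρ V x) := by
  let L := (ModuleCat.restrictScalars (algebraMap K₀ K)).obj (ModuleCat.of K K)
  let e : L := (1 : K)
  obtain ⟨l, hl⟩ := (LinearMap.toSpanSingleton K₀ L e).exists_leftInverse_of_injective (by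
    refine LinearMap.ker_eq_bot.2 fun a b hab => (algebraMap K₀ K).injective ?_
    have h : algebraMap K₀ K a * 1 = algebraMap K₀ K b * 1 := hab
    simpa using h)
  have hl' : l e = 1 := by simpa using LinearMap.congr_fun hl 1
  refine ⟨fun V => (TensorProduct.mk K₀ L V e).toAddMonoidHom,
    fun V => ((TensorProduct.lid K₀ V).toLinearMap ∘ₗ l.rTensor V).toAddMonoidHom,
    fun V v => ?_, fun V W f v => rfl, fun V W f x => ?_⟩
  · change TensorProduct.lid K₀ V (l.rTensor V (e ⊗ₜ v)) = v
    simp [hl']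
  · induction x using TensorProduct.induction_on with
    | zero => exact (map_zero _).trans (map_zero _).symm
    | tmul a v =>
      change TensorProduct.lid K₀ W (l.rTensor W (a ⊗ₜ f.hom v)) =
        f.hom (TensorProduct.lid K₀ V (l.rTensor V (a ⊗ₜ v)))
      simp
    | add x y hx hy =>
      refine (congrArg _ (map_add _ x y)).trans ?_
      refine (map_add _ _ _).trans ((congrArg₂ (· + ·) hx hy).trans ?_)
      exact (map_add f.hom _ _).symm.trans (congrArg f.hom (map_add _ x y).symm)

/-- A cocycle z of the cone becomes a boundary d w over K, and the natural retraction ρ gives z =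
d(ρ w). So the cone is exact over K₀, hence contractible. -/
lemma quasiIso_of_quasiIso_baseChange {X Y : CochainComplex (ModuleCat.{u} K₀) ℤ} (f : X ⟶ Y)
    (hf : QuasiIso ((cx (baseChange K₀ K)).map f)) :
    IsIso ((HomotopyCategory.quotient _ (ComplexShape.up ℤ)).map f) := by
  refine isIso_quotient_map_of_contraction f ?_
  obtain ⟨ι, ρ, hρι, hι, hρ⟩ := exists_retraction_baseChange (K₀ := K₀) (K := K)
  obtain ⟨h⟩ := nonempty_contraction_of_strict_exact ((cx (Filt.triv K₀)).obj (mappingCone f))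
    (fun n i z hz hdz => by
      replace hz := (Filt.mem_triv_F _ _ _).1 hz
      simp_rw [show ∀ w, (w ∈ (((cx (Filt.triv _)).obj (mappingCone f)).X n).F i) ↔ _ from
        Filt.mem_triv_F _ i]
      by_cases hi : i ≤ 0
      · obtain ⟨w, hw⟩ := exists_d_eq_of_quasiIso_map (baseChange K₀ K) f hf n (ι _ z)
          ((hι _ _ _ z).trans ((congrArg (ι _) hdz).trans (map_zero _)))
        refine ⟨ρ _ w, Or.inl hi, ?_⟩
        exact (hρ _ _ _ w).symm.trans ((congrArg (ρ _) hw).trans (hρι _ z))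
      · obtain rfl := hz.resolve_left hi
        exact ⟨0, Or.inr rfl, map_zero _⟩)
  exact ⟨(Filt.forget K₀).mapHomotopy h⟩

end QuasiIso

/-! ### Homology classes and their representing cocycles -/

section HomologyClasses

variable {C D : CochainComplex AddCommGrpCat.{u} ℤ} {n : ℤ}

/-- The homology class `ξ` is the class of the cocycle `z`. -/
def IsClass (ξ : C.homology n) (z : C.X n) : Prop :=
  ∃ c : C.cycles n, C.iCycles n c = z ∧ C.homologyπ n c = ξ

lemma exists_isClass (ξ : C.homology n) : ∃ z, IsClass ξ z := by
  obtain ⟨c, hc⟩ := (AddCommGrpCat.epi_iff_surjective (C.homologyπ n)).1 inferInstance ξ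
  exact ⟨_, c, rfl, hc⟩

lemma IsClass.d_eq_zero {ξ : C.homology n} {z : C.X n} (h : IsClass ξ z) (m : ℤ) :
    C.d n m z = 0 := by
  obtain ⟨c, rfl, -⟩ := h
  exact ConcreteCategory.congr_hom (C.iCycles_d n m) c

lemma IsClass.add {ξ ξ' : C.homology n} {z z' : C.X n} (h : IsClass ξ z) (h' : IsClass ξ' z') :
    IsClass (ξ + ξ') (z + z') := by
  obtain ⟨c, rfl, rfl⟩ := h
  obtain ⟨c', rfl, rfl⟩ := h'
  exact ⟨c + c', map_add _ _ _, map_add _ _ _⟩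

lemma IsClass.sub {ξ ξ' : C.homology n} {z z' : C.X n} (h : IsClass ξ z) (h' : IsClass ξ' z') :
    IsClass (ξ - ξ') (z - z') := by
  obtain ⟨c, rfl, rfl⟩ := h
  obtain ⟨c', rfl, rfl⟩ := h'
  exact ⟨c - c', map_sub _ _ _, map_sub _ _ _⟩

lemma IsClass.map {ξ : C.homology n} {z : C.X n} (h : IsClass ξ z) (f : C ⟶ D) :
    IsClass (HomologicalComplex.homologyMap f n ξ) (f.f n z) := by
  obtain ⟨c, rfl, rfl⟩ := h
  refine ⟨HomologicalComplex.cyclesMap f n c, ?_, ?_⟩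
  · exact ConcreteCategory.congr_hom (HomologicalComplex.cyclesMap_i f n) c
  · exact (ConcreteCategory.congr_hom (HomologicalComplex.homologyπ_naturality f n) c).symm

lemma IsClass.eq_zero_iff {ξ : C.homology n} {z : C.X n} (h : IsClass ξ z) (m : ℤ)
    (hm : m + 1 = n) : ξ = 0 ↔ ∃ w : C.X m, C.d m n w = z := by
  obtain ⟨c, rfl, rfl⟩ := h
  have hex := ((ShortComplex.mk (C.toCycles m n) (C.homologyπ n) (by simp)).ab_exact_iff).1
    (ShortComplex.exact_of_g_is_cokernel _ (C.homologyIsCokernel m n (by simp [← hm])))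
  constructor
  · intro h0
    obtain ⟨w, hw⟩ := hex c h0
    refine ⟨w, ?_⟩
    rw [← ConcreteCategory.congr_hom (C.toCycles_i m n) w]
    exact congrArg (C.iCycles n) hw
  · rintro ⟨w, hw⟩
    rw [← ConcreteCategory.congr_hom (C.toCycles_i m n) w] at hw
    have := (AddCommGrpCat.mono_iff_injective (C.iCycles n)).1 inferInstance hw
    rw [← this]
    exact ConcreteCategory.congr_hom (C.toCycles_comp_homologyπ m n) w

lemma IsClass.eq {ξ ξ' : C.homology n} {z : C.X n} (h : IsClass ξ z) (h' : IsClass ξ' z) :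
    ξ = ξ' :=
  sub_eq_zero.1 (((h.sub h').eq_zero_iff (n - 1) (by simp)).2 ⟨0, by simp⟩)

open CochainComplex in
lemma isClass_homologyAddEquiv_symm {A : Type*} [Category.{u} A] [Preadditive A]
    {X Y : CochainComplex A ℤ} (z : HomComplex.Cocycle X Y n) :
    IsClass ((HomComplex.homologyAddEquiv X Y n).symm (HomComplex.CohomologyClass.mk z))
      (show (HomComplex X Y).X n from z.1) := by
  let h := HomComplex.leftHomologyData X Y n
  refine ⟨h.cyclesIso.inv z, ?_, ?_⟩
  · exact ConcreteCategory.congr_hom h.cyclesIso_inv_comp_iCycles z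
  · exact ConcreteCategory.congr_hom h.π_comp_homologyIso_inv.symm z

end HomologyClasses

/-! ### Pairs (x, y) as elements of Cone(ψ)[-1] -/

section MappingCocone

open CochainComplex HomComplex

variable {C D : CochainComplex AddCommGrpCat.{u} ℤ} (ψ : C ⟶ D)

/-- The element `(x, y)` of `Cone(ψ)[-1]`. -/
def coneElt (m n : ℤ) (h : m + 1 = n) (x : C.X n) (y : D.X m) : (mappingCocone ψ).X n :=
  (mappingCocone.inl ψ).v n n (add_zero n) x + (mappingCocone.inr ψ).1.v m n h y

lemma exists_coneElt (m n : ℤ) (h : m + 1 = n) (w : (mappingCocone ψ).X n) :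
    ∃ x y, w = coneElt ψ m n h x y := by
  refine ⟨(mappingCocone.fst ψ).f n w, (mappingCocone.snd ψ).v n m (by omega) w, ?_⟩
  exact (ConcreteCategory.congr_hom (mappingCocone.id_X ψ n m (by omega)) w).symm

lemma coneElt_eq_iff (m n : ℤ) (h : m + 1 = n) (x x' : C.X n) (y y' : D.X m) :
    coneElt ψ m n h x y = coneElt ψ m n h x' y' ↔ x = x' ∧ y = y' := by
  refine ⟨fun e => ?_, by rintro ⟨rfl, rfl⟩; rfl⟩
  have h₁ : ∀ x y, (mappingCocone.fst ψ).f n (coneElt ψ m n h x y) = x := fun x y => by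
    rw [coneElt, map_add]
    erw [ConcreteCategory.congr_hom (mappingCocone.inl_v_fst_f ψ n) x,
      ConcreteCategory.congr_hom (mappingCocone.inr_v_fst_f ψ m n h) y]
    exact add_zero x
  have h₂ : ∀ x y, (mappingCocone.snd ψ).v n m (by omega) (coneElt ψ m n h x y) = y := fun x y => by
    rw [coneElt, map_add]
    erw [ConcreteCategory.congr_hom (mappingCocone.inl_v_snd_v ψ n m (by omega)) x,
      ConcreteCategory.congr_hom (mappingCocone.inr_v_snd_v ψ m n h) y]
    exact zero_add y
  exact ⟨by rw [← h₁ x y, e, h₁], by rw [← h₂ x y, e, h₂]⟩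

lemma coneElt_sub (m n : ℤ) (h : m + 1 = n) (x x' : C.X n) (y y' : D.X m) :
    coneElt ψ m n h x y - coneElt ψ m n h x' y' = coneElt ψ m n h (x - x') (y - y') := by
  rw [coneElt, coneElt, coneElt, map_sub, map_sub]
  abel

lemma coneElt_zero (m n : ℤ) (h : m + 1 = n) : coneElt ψ m n h 0 0 = 0 := by
  rw [coneElt, map_zero, map_zero, add_zero]

/-- The term -dy expresses that `inr` is a cocycle of degree 1, and the term -ψ x comes from the
coboundary of `inl`. -/
lemma d_coneElt (m n k : ℤ) (h : m + 1 = n) (h' : n + 1 = k) (x : C.X n) (y : D.X m) :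
    (mappingCocone ψ).d n k (coneElt ψ m n h x y) =
      coneElt ψ n k h' (C.d n k x) (-(D.d m n y) - ψ.f n x) := by
  have h₁ : (mappingCocone.inr ψ).1.v m n h ≫ (mappingCocone ψ).d n k =
      - D.d m n ≫ (mappingCocone.inr ψ).1.v n k h' := by
    have := Cochain.congr_v ((mappingCocone.inr ψ).δ_eq_zero 2) m k (by omega)
    rw [δ_v 1 2 rfl _ m k (by omega) n n (by omega) h] at this
    rw [eq_neg_iff_add_eq_zero]
    simpa [Int.negOnePow_even 2 ⟨1, rfl⟩] using this
  have h₂ : (mappingCocone.inl ψ).v n n (add_zero n) ≫ (mappingCocone ψ).d n k =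
      C.d n k ≫ (mappingCocone.inl ψ).v k k (add_zero k) -
        ψ.f n ≫ (mappingCocone.inr ψ).1.v n k h' := by
    -- Seen as the lift of the pair (1, 0), `inl` has a coboundary given by the general formula for
    -- lifts.
    have e : mappingCocone.liftCochain ψ (Cochain.ofHom (𝟙 C)) 0 (neg_add_cancel 1) =
        mappingCocone.inl ψ := by
      refine Cochain.ext₀ _ _ fun p => ?_
      rw [← cancel_mono (𝟙 _), ← mappingCocone.id_X ψ p (p + -1) rfl]
      simp
    have := Cochain.congr_v (mappingCocone.δ_liftCochain ψ (Cochain.ofHom (𝟙 C))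
      (0 : Cochain C D (-1)) (neg_add_cancel 1) 1 (zero_add 1)) n k h'
    rw [e, δ_v 0 1 rfl _ n k h' n k (by omega) h'] at this
    rw [sub_eq_add_neg, ← sub_eq_iff_eq_add', sub_eq_add_neg]
    simpa using this
  rw [coneElt, coneElt, map_add]
  refine (congrArg₂ (· + ·) (ConcreteCategory.congr_hom h₂ x)
    (ConcreteCategory.congr_hom h₁ y)).trans ?_
  rw [map_sub, map_neg]
  change (mappingCocone.inl ψ).v k k (add_zero k) (C.d n k x) -
    (mappingCocone.inr ψ).1.v n k h' (ψ.f n x) + -((mappingCocone.inr ψ).1.v n k h' (D.d m n y)) = _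
  abel

end MappingCocone

/-! ### Homotopy invariance of Hom complexes and cones -/

section HomPrePost

open CochainComplex HomComplex

variable {A : Type*} [Category.{u} A] [Preadditive A]

/-- Precomposition with homotopic morphisms gives homotopic morphisms. -/
def homotopyHomPre {X Y : CochainComplex A ℤ} {f g : X ⟶ Y} (h : Homotopy f g)
    (L : CochainComplex A ℤ) : Homotopy (homPre f L) (homPre g L) := by
  let γ := Cochain.ofHomotopy h
  -- In the Leibniz rule for γ followed by z, the term with δγ carries the sign (-1)^n. The factor
  -- (-1)^i in the homotopy removes it and makes the two terms with δz cancel.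
  refine Homotopy.equivSubZero.symm ((Homotopy.ofEq ?_).trans (Homotopy.nullHomotopy'
    (fun i j hij => AddCommGrpCat.ofHom (AddMonoidHom.mk'
      (fun z : Cochain Y L i => (i.negOnePow •
        γ.comp z (show -1 + i = j by have : j + 1 = i := hij; omega) : Cochain X L j))
      (fun a b => (congrArg (i.negOnePow • ·) (Cochain.comp_add γ a b _)).trans (smul_add _ _ _))))))
  ext n (z : Cochain Y L n)
  rw [Homotopy.nullHomotopicMap'_f (k₀ := n + 1) (k₁ := n) (k₂ := n - 1) (by simp) (by simp)]
  change (Cochain.ofHom f).comp z (zero_add n) - (Cochain.ofHom g).comp z (zero_add n) =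
    (n + 1).negOnePow • γ.comp (δ n (n + 1) z) _ + δ (n - 1) n (n.negOnePow • γ.comp z _)
  rw [δ_units_smul, δ_comp γ z _ 0 (n + 1) n (by omega) (by omega) rfl, δ_ofHomotopy,
    Cochain.sub_comp, smul_add, smul_smul, Int.units_mul_self, one_smul, Int.negOnePow_succ,
    Units.neg_smul]
  abel

/-- Postcomposition with homotopic morphisms gives homotopic morphisms. -/
def homotopyHomPost (X : CochainComplex A ℤ) {L L' : CochainComplex A ℤ} {f g : L ⟶ L'}
    (h : Homotopy f g) : Homotopy (homPost X f) (homPost X g) := by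
  let γ := Cochain.ofHomotopy h
  -- No sign is needed here: since γ has degree -1, the Leibniz rule puts the sign -1 on the term
  -- with δz, which then cancels.
  refine Homotopy.equivSubZero.symm ((Homotopy.ofEq ?_).trans (Homotopy.nullHomotopy'
    (fun i j hij => AddCommGrpCat.ofHom (AddMonoidHom.mk'
      (fun z : Cochain X L i =>
        (z.comp γ (show i + -1 = j by have : j + 1 = i := hij; omega) : Cochain X L' j))
      (fun a b => Cochain.add_comp a b γ _)))))
  ext n (z : Cochain X L n)
  rw [Homotopy.nullHomotopicMap'_f (k₀ := n + 1) (k₁ := n) (k₂ := n - 1) (by simp) (by simp)]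
  change z.comp (Cochain.ofHom f) (add_zero n) - z.comp (Cochain.ofHom g) (add_zero n) =
    (δ n (n + 1) z).comp γ (by omega) + δ (n - 1) n (z.comp γ (by omega))
  rw [δ_comp z γ _ (n + 1) 0 n (by omega) rfl (by omega), δ_ofHomotopy, Cochain.comp_sub]
  simp

lemma homPre_id (X L : CochainComplex A ℤ) : homPre (𝟙 X) L = 𝟙 _ := by
  ext n (z : Cochain X L n)
  exact Cochain.id_comp z

lemma homPost_id (X L : CochainComplex A ℤ) : homPost X (𝟙 L) = 𝟙 _ := by
  ext n (z : Cochain X L n)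
  exact Cochain.comp_id z

lemma exists_homotopyInverse {B : Type*} [Category* B] [Preadditive B] {X Y : CochainComplex B ℤ}
    (f : X ⟶ Y) (hf : IsIso ((HomotopyCategory.quotient B (ComplexShape.up ℤ)).map f)) :
    ∃ g : Y ⟶ X, Nonempty (Homotopy (f ≫ g) (𝟙 X)) ∧ Nonempty (Homotopy (g ≫ f) (𝟙 Y)) := by
  obtain ⟨g, hg⟩ := Functor.map_surjective _
    (inv ((HomotopyCategory.quotient B (ComplexShape.up ℤ)).map f))
  exact ⟨g, ⟨HomotopyCategory.homotopyOfEq _ _ (by simp [hg])⟩,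
    ⟨HomotopyCategory.homotopyOfEq _ _ (by simp [hg])⟩⟩

lemma isIso_quotient_map_of_homotopyInverse {B : Type*} [Category* B] [Preadditive B]
    {X Y : CochainComplex B ℤ} (f : X ⟶ Y) (g : Y ⟶ X) (h₁ : Homotopy (f ≫ g) (𝟙 X))
    (h₂ : Homotopy (g ≫ f) (𝟙 Y)) :
    IsIso ((HomotopyCategory.quotient B (ComplexShape.up ℤ)).map f) :=
  ⟨(HomotopyCategory.quotient B (ComplexShape.up ℤ)).map g, by
    rw [← Functor.map_comp, HomotopyCategory.eq_of_homotopy _ _ h₁, (HomotopyCategory.quotient _ _).map_id], by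
    rw [← Functor.map_comp, HomotopyCategory.eq_of_homotopy _ _ h₂, (HomotopyCategory.quotient _ _).map_id]⟩

lemma isIso_quotient_map_homPre {X Y : CochainComplex A ℤ} (f : X ⟶ Y)
    (hf : IsIso ((HomotopyCategory.quotient A (ComplexShape.up ℤ)).map f))
    (L : CochainComplex A ℤ) :
    IsIso ((HomotopyCategory.quotient _ (ComplexShape.up ℤ)).map (homPre f L)) := by
  obtain ⟨g, ⟨h₁⟩, ⟨h₂⟩⟩ := exists_homotopyInverse f hf
  refine isIso_quotient_map_of_homotopyInverse _ (homPre g L) ?_ ?_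
  · exact (Homotopy.ofEq (homPre_homPre g f L)).trans
      ((homotopyHomPre h₂ L).trans (Homotopy.ofEq (homPre_id Y L)))
  · exact (Homotopy.ofEq (homPre_homPre f g L)).trans
      ((homotopyHomPre h₁ L).trans (Homotopy.ofEq (homPre_id X L)))

lemma isIso_quotient_map_homPost (X : CochainComplex A ℤ) {L L' : CochainComplex A ℤ} (f : L ⟶ L')
    (hf : IsIso ((HomotopyCategory.quotient A (ComplexShape.up ℤ)).map f)) :
    IsIso ((HomotopyCategory.quotient _ (ComplexShape.up ℤ)).map (homPost X f)) := by
  obtain ⟨g, ⟨h₁⟩, ⟨h₂⟩⟩ := exists_homotopyInverse f hf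
  refine isIso_quotient_map_of_homotopyInverse _ (homPost X g) ?_ ?_
  · exact (Homotopy.ofEq (homPost_homPost X f g)).trans
      ((homotopyHomPost X h₁).trans (Homotopy.ofEq (homPost_id X L)))
  · exact (Homotopy.ofEq (homPost_homPost X g f)).trans
      ((homotopyHomPost X h₂).trans (Homotopy.ofEq (homPost_id X L')))

/-- The inverse is assembled from the images of the projections and inclusions, so nothing is
required of biproducts in the target, which will be a homotopy category. -/
lemma isIso_map_biprodMap {B E : Type*} [Category* B] [Preadditive B] [HasBinaryBiproducts B]
    [Category* E] [Preadditive E] (F : B ⥤ E) [F.Additive] {X Y X' Y' : B} (a : X ⟶ X')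
    (b : Y ⟶ Y') (ha : IsIso (F.map a)) (hb : IsIso (F.map b)) : IsIso (F.map (biprod.map a b)) := by
  refine ⟨F.map biprod.fst ≫ inv (F.map a) ≫ F.map biprod.inl +
    F.map biprod.snd ≫ inv (F.map b) ≫ F.map biprod.inr, ?_, ?_⟩
  · rw [Preadditive.comp_add, ← F.map_comp_assoc, ← F.map_comp_assoc, biprod.map_fst,
      biprod.map_snd, F.map_comp, F.map_comp, Category.assoc, Category.assoc,
      IsIso.hom_inv_id_assoc, IsIso.hom_inv_id_assoc, ← F.map_comp, ← F.map_comp, ← F.map_add,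
      biprod.total, F.map_id]
  · rw [Preadditive.add_comp, Category.assoc, Category.assoc, Category.assoc, Category.assoc,
      ← F.map_comp, ← F.map_comp, biprod.inl_map, biprod.inr_map, F.map_comp, F.map_comp,
      IsIso.inv_hom_id_assoc, IsIso.inv_hom_id_assoc, ← F.map_comp, ← F.map_comp, ← F.map_add,
      biprod.total, F.map_id]

/-- A morphism of distinguished triangles that is invertible at two vertices is invertible at the
third. -/
lemma isIso_quotient_map_mappingCone_map {B : Type*} [Category* B] [Abelian B]
    {X Y X' Y' : CochainComplex B ℤ} (f : X ⟶ Y) (f' : X' ⟶ Y') (a : X ⟶ X') (b : Y ⟶ Y')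
    (comm : f ≫ b = a ≫ f')
    (ha : IsIso ((HomotopyCategory.quotient B (ComplexShape.up ℤ)).map a))
    (hb : IsIso ((HomotopyCategory.quotient B (ComplexShape.up ℤ)).map b)) :
    IsIso ((HomotopyCategory.quotient B (ComplexShape.up ℤ)).map
      (mappingCone.map f f' a b comm)) :=
  Pretriangulated.isIso₃_of_isIso₁₂
    ((HomotopyCategory.quotient B (ComplexShape.up ℤ)).mapTriangle.map
      (mappingCone.triangleMap f f' a b comm))
    (HomotopyCategory.mappingCone_triangleh_distinguished f)
    (HomotopyCategory.mappingCone_triangleh_distinguished f') ha hb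

end HomPrePost

/-! ### Invariance and functoriality of Γ -/

section GammaInvariance

open CochainComplex

variable {K₀ K : Type u} [Field K₀] [Field K] [Algebra K₀ K] {σ : K₀ →+* K₀}

lemma isIso_quotient_map_cx {A B : Type*} [Category* A] [Category* B] [Preadditive A]
    [Preadditive B] (Φ : A ⥤ B) [Φ.Additive] {X Y : CochainComplex A ℤ} (f : X ⟶ Y)
    (hf : IsIso ((HomotopyCategory.quotient A (ComplexShape.up ℤ)).map f)) :
    IsIso ((HomotopyCategory.quotient B (ComplexShape.up ℤ)).map ((cx Φ).map f)) :=
  inferInstanceAs (IsIso ((Φ.mapHomotopyCategory (ComplexShape.up ℤ)).map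
    ((HomotopyCategory.quotient A (ComplexShape.up ℤ)).map f)))

/-- The components `f₀`, `f_dR`, `f_K` of `f` are homotopy equivalences (which are not required to
be compatible with the structure morphisms). -/
structure ComponentwiseEquiv {M N : CochainComplex (Sys K σ) ℤ} (f : M ⟶ N) : Prop where
  zero : IsIso ((HomotopyCategory.quotient _ (ComplexShape.up ℤ)).map ((zeroPart K σ).map f))
  dR : IsIso ((HomotopyCategory.quotient _ (ComplexShape.up ℤ)).map ((dRPart K σ).map f))
  vec : IsIso ((HomotopyCategory.quotient _ (ComplexShape.up ℤ)).map ((vecPart K σ).map f))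

lemma ComponentwiseEquiv.of_isIso {M N : CochainComplex (Sys K σ) ℤ} (f : M ⟶ N)
    (hf : IsIso ((HomotopyCategory.quotient _ (ComplexShape.up ℤ)).map f)) :
    ComponentwiseEquiv f :=
  ⟨isIso_quotient_map_cx _ f hf, isIso_quotient_map_cx _ f hf, isIso_quotient_map_cx _ f hf⟩

lemma componentwiseEquiv_id (M : CochainComplex (Sys K σ) ℤ) : ComponentwiseEquiv (𝟙 M) :=
  .of_isIso _ inferInstance

lemma mem_quasiIso_of_isIso {A B : Type*} [Category* A] [Category* B] [Preadditive A]
    [Abelian B] (Φ : A ⥤ B) [Φ.Additive] {X Y : CochainComplex A ℤ} (f : X ⟶ Y)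
    (hf : IsIso ((HomotopyCategory.quotient A (ComplexShape.up ℤ)).map f)) :
    HomotopyCategory.quasiIso B (ComplexShape.up ℤ) ((HomotopyCategory.quotient B
      (ComplexShape.up ℤ)).map ((cx Φ).map f)) := fun n => by
  have := isIso_quotient_map_cx Φ f hf
  infer_instance

/-- Each condition is upgraded to a homotopy equivalence: f₀ by descent from K to K₀, f_dR by
filtered splittings, f_K by plain linear algebra. Conversely, additive functors preserve homotopy
equivalences. From here on quasi-isomorphisms are handled in this form. -/
lemma quasiIso_toHK_map_iff {M N : pHC K σ} (f : M ⟶ N) :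
    quasiIso K σ ((toHK K σ).map f) ↔ ComponentwiseEquiv f.hom := by
  constructor
  · rintro ⟨h₁, h₂, h₃⟩
    refine ⟨?_, ?_, ?_⟩
    · exact quasiIso_of_quasiIso_baseChange (K := K) _
        ((HomotopyCategory.quotient_map_mem_quasiIso_iff _).1 h₁)
    · exact isIso_quotient_map_of_quasiIso_gr _ fun i =>
        (HomotopyCategory.quotient_map_mem_quasiIso_iff _).1 (h₃ i)
    · exact isIso_quotient_map_of_quasiIso _
        ((HomotopyCategory.quotient_map_mem_quasiIso_iff _).1 h₂)
  · rintro ⟨h₁, h₂, h₃⟩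
    exact ⟨mem_quasiIso_of_isIso (baseChange K₀ K) _ h₁,
      mem_quasiIso_of_isIso (𝟭 _) _ h₃, fun i => mem_quasiIso_of_isIso (Filt.gr K i) _ h₂⟩

variable {M M' N N' : CochainComplex (Sys K σ) ℤ}

lemma isIso_quotient_map_homPre_homPost {A : Type*} [Category.{u} A] [Preadditive A]
    {X Y L L' : CochainComplex A ℤ} (f : X ⟶ Y) (g : L ⟶ L')
    (hf : IsIso ((HomotopyCategory.quotient A (ComplexShape.up ℤ)).map f))
    (hg : IsIso ((HomotopyCategory.quotient A (ComplexShape.up ℤ)).map g)) :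
    IsIso ((HomotopyCategory.quotient _ (ComplexShape.up ℤ)).map (homPre f L ≫ homPost X g)) := by
  have := isIso_quotient_map_homPre f hf L
  have := isIso_quotient_map_homPost X g hg
  rw [Functor.map_comp]
  infer_instance

lemma isIso_quotient_map_gamma₀ (f : N ⟶ M) (g : M' ⟶ N') (hf : ComponentwiseEquiv f)
    (hg : ComponentwiseEquiv g) :
    IsIso ((HomotopyCategory.quotient _ (ComplexShape.up ℤ)).map (Gamma₀.map f g)) :=
  isIso_map_biprodMap _ _ _ (isIso_quotient_map_homPre_homPost _ _ hf.zero hg.zero)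
    (isIso_map_biprodMap _ _ _ (isIso_quotient_map_homPre_homPost _ _ hf.vec hg.vec)
      (isIso_quotient_map_homPre_homPost _ _ hf.dR hg.dR))

lemma isIso_quotient_map_gamma₁ (f : N ⟶ M) (g : M' ⟶ N') (hf : ComponentwiseEquiv f)
    (hg : ComponentwiseEquiv g) :
    IsIso ((HomotopyCategory.quotient _ (ComplexShape.up ℤ)).map (Gamma₁.map f g)) :=
  isIso_map_biprodMap _ _ _
    (isIso_quotient_map_homPre_homPost _ _ (isIso_quotient_map_cx (twist σ) _ hf.zero) hg.zero)
    (isIso_map_biprodMap _ _ _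
      (isIso_quotient_map_homPre_homPost _ _
        (isIso_quotient_map_cx (baseChange K₀ K) _ hf.zero) hg.vec)
      (isIso_quotient_map_homPre_homPost _ _
        (isIso_quotient_map_cx (Filt.forget K) _ hf.dR) hg.vec))

/-- Γ₀ and Γ₁ are built from the components alone, so the induced maps on them are homotopy
equivalences even if the inverses do not respect φ, c, s. The cone of ψ and its shift follow. -/
lemma isIso_homologyMap_gamma (f : N ⟶ M) (g : M' ⟶ N') (hf : ComponentwiseEquiv f)
    (hg : ComponentwiseEquiv g) (n : ℤ) :
    IsIso (HomologicalComplex.homologyMap (Gamma.map f g) n) := by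
  have h := isIso_quotient_map_mappingCone_map _ _ _ _ (psi_map f g)
    (isIso_quotient_map_gamma₀ f g hf hg) (isIso_quotient_map_gamma₁ f g hf hg)
  have h' : IsIso ((HomotopyCategory.quotient _ (ComplexShape.up ℤ)).map (Gamma.map f g)) :=
    (NatIso.isIso_map_iff ((HomotopyCategory.quotient AddCommGrpCat.{u}
      (ComplexShape.up ℤ)).commShiftIso (-1 : ℤ)) _).2
      (inferInstanceAs (IsIso ((CategoryTheory.shiftFunctor _ (-1 : ℤ)).map
        ((HomotopyCategory.quotient _ (ComplexShape.up ℤ)).map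
          (mappingCone.map _ _ _ _ (psi_map f g))))))
  have : QuasiIso (Gamma.map f g) :=
    (HomotopyCategory.quotient_map_mem_quasiIso_iff _).1 fun n => inferInstance
  infer_instance

lemma biprod_map_id {B : Type*} [Category* B] [Preadditive B] [HasBinaryBiproducts B] (X Y : B) :
    biprod.map (𝟙 X) (𝟙 Y) = 𝟙 _ := by
  ext <;> simp

lemma biprod_map_comp {B : Type*} [Category* B] [Preadditive B] [HasBinaryBiproducts B]
    {X Y X' Y' X'' Y'' : B} (a : X ⟶ X') (a' : X' ⟶ X'') (b : Y ⟶ Y') (b' : Y' ⟶ Y'') :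
    biprod.map (a ≫ a') (b ≫ b') = biprod.map a b ≫ biprod.map a' b' := by
  ext <;> simp

lemma homPre_homPost_eq_id {A : Type*} [Category.{u} A] [Preadditive A]
    {X L : CochainComplex A ℤ} {f : X ⟶ X} {g : L ⟶ L} (hf : f = 𝟙 X) (hg : g = 𝟙 L) :
    homPre f L ≫ homPost X g = 𝟙 _ := by
  rw [hf, hg, homPre_id, homPost_id, Category.comp_id]

lemma gamma₀_map_id (M M' : CochainComplex (Sys K σ) ℤ) : Gamma₀.map (𝟙 M) (𝟙 M') = 𝟙 _ := by
  rw [Gamma₀.map, homPre_homPost_eq_id ((zeroPart K σ).map_id _) ((zeroPart K σ).map_id _),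
    homPre_homPost_eq_id ((vecPart K σ).map_id _) ((vecPart K σ).map_id _),
    homPre_homPost_eq_id ((dRPart K σ).map_id _) ((dRPart K σ).map_id _), biprod_map_id,
    biprod_map_id]

lemma gamma₁_map_id (M M' : CochainComplex (Sys K σ) ℤ) : Gamma₁.map (𝟙 M) (𝟙 M') = 𝟙 _ := by
  rw [Gamma₁.map, homPre_homPost_eq_id ((sigmaPart K σ).map_id _) ((zeroPart K σ).map_id _),
    homPre_homPost_eq_id ((rigPart K σ).map_id _) ((vecPart K σ).map_id _),
    homPre_homPost_eq_id ((dRVecPart K σ).map_id _) ((vecPart K σ).map_id _), biprod_map_id,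
    biprod_map_id]

lemma gamma_map_id (M M' : CochainComplex (Sys K σ) ℤ) : Gamma.map (𝟙 M) (𝟙 M') = 𝟙 _ := by
  have e : mappingCone.map _ _ _ _ (psi_map (𝟙 M) (𝟙 M')) = 𝟙 _ := by
    simp only [gamma₀_map_id, gamma₁_map_id, mappingCone.map_id]
  exact (congrArg (fun φ => φ⟦(-1 : ℤ)⟧') e).trans (CategoryTheory.Functor.map_id _ _)

lemma homPre_homPost_comp {A : Type*} [Category.{u} A] [Preadditive A]
    {X Y Z L L' L'' : CochainComplex A ℤ} (f : X ⟶ Y) (f' : Y ⟶ Z) (g : L ⟶ L') (g' : L' ⟶ L'') :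
    homPre (f ≫ f') L ≫ homPost X (g ≫ g') =
      (homPre f' L ≫ homPost Y g) ≫ homPre f L' ≫ homPost X g' := by
  rw [Category.assoc, ← homPre_homPost_assoc, homPre_homPre_assoc, homPost_homPost]

variable {P P' : CochainComplex (Sys K σ) ℤ}

lemma gamma₀_map_comp (f : N ⟶ M) (g : M' ⟶ N') (f' : P ⟶ N) (g' : N' ⟶ P') :
    Gamma₀.map (f' ≫ f) (g ≫ g') = Gamma₀.map f g ≫ Gamma₀.map f' g' := by
  simp only [Gamma₀.map, Functor.map_comp, homPre_homPost_comp, biprod_map_comp]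

lemma gamma₁_map_comp (f : N ⟶ M) (g : M' ⟶ N') (f' : P ⟶ N) (g' : N' ⟶ P') :
    Gamma₁.map (f' ≫ f) (g ≫ g') = Gamma₁.map f g ≫ Gamma₁.map f' g' := by
  simp only [Gamma₁.map, Functor.map_comp, homPre_homPost_comp, biprod_map_comp]

lemma gamma_map_comp (f : N ⟶ M) (g : M' ⟶ N') (f' : P ⟶ N) (g' : N' ⟶ P') :
    Gamma.map (f' ≫ f) (g ≫ g') = Gamma.map f g ≫ Gamma.map f' g' := by
  have e : mappingCone.map _ _ _ _ (psi_map (f' ≫ f) (g ≫ g')) =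
      mappingCone.map _ _ _ _ (psi_map f g) ≫ mappingCone.map _ _ _ _ (psi_map f' g') := by
    rw [← mappingCone.map_comp]
    simp only [gamma₀_map_comp, gamma₁_map_comp]
  exact (congrArg (fun φ => φ⟦(-1 : ℤ)⟧') e).trans (Functor.map_comp _ _ _)

end GammaInvariance

/-! ### Contractible complexes with a universal cochain -/

section Cofree

open CochainComplex HomComplex

variable {A : Type*} [Category* A] [Preadditive A] [HasBinaryBiproducts A]

/-- The contractible complex with a universal cochain of degree `m` to `L`. -/
abbrev cofree (L : CochainComplex A ℤ) (m : ℤ) : CochainComplex A ℤ := mappingCone (𝟙 (L⟦m⟧))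

/-- The universal cochain of degree `m`. -/
abbrev cofreeProj (L : CochainComplex A ℤ) (m : ℤ) : Cochain (cofree L m) L m :=
  (mappingCone.snd (𝟙 (L⟦m⟧))).rightUnshift m (zero_add m)

lemma exists_contraction_cofree (L : CochainComplex A ℤ) (m : ℤ) :
    Nonempty (Homotopy (𝟙 (cofree L m)) 0) := by
  suffices ∀ G : CochainComplex A ℤ, Nonempty (Homotopy (𝟙 (mappingCone (𝟙 G))) 0) from this _
  intro G
  refine ⟨(Cochain.equivHomotopy _ _).symm
    ⟨(mappingCone.snd (𝟙 G)).comp (mappingCone.inl (𝟙 G)) (zero_add (-1)), ?_⟩⟩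
  rw [Cochain.ofHom_zero, add_zero, δ_zero_cochain_comp _ _ 0 (neg_add_cancel 1),
    mappingCone.δ_inl, mappingCone.δ_snd, ← mappingCone.id]
  simpa using add_comm _ _

/-- Up to sign, ι is the inclusion of the summand of the cone on which the universal cochain
vanishes. The two identities are equational, so additive functors preserve them, and they suffice
for the universal property. -/
lemma exists_cofreeIncl (L : CochainComplex A ℤ) (m : ℤ) :
    ∃ ι : Cochain L (cofree L m) (-1 - m),
      ι.comp (cofreeProj L m) (show -1 - m + m = -1 by omega) = 0 ∧
      ι.comp (δ m (m + 1) (cofreeProj L m)) (show -1 - m + (m + 1) = 0 by omega) =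
        Cochain.ofHom (𝟙 L) := by
  let ι : Cochain L (mappingCone (𝟙 (L⟦m⟧))) (-1 - m) := Cochain.mk fun p q hpq =>
    (L.shiftFunctorObjXIso m (p - m) p (by omega)).inv ≫
      (mappingCone.inl (𝟙 (L⟦m⟧))).v (p - m) q (by omega)
  have hι (p q hpq) : ι.v p q hpq = (L.shiftFunctorObjXIso m (p - m) p (by omega)).inv ≫
      (mappingCone.inl (𝟙 (L⟦m⟧))).v (p - m) q (by omega) := rfl
  have h₁ : ι.comp (mappingCone.snd (𝟙 (L⟦m⟧))) (add_zero _) = 0 := by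
    ext p q hpq
    rw [Cochain.comp_v _ _ (add_zero _) p q q hpq (add_zero q), hι, Category.assoc,
      mappingCone.inl_v_snd_v, comp_zero, Cochain.zero_v]
  have h₂ : (ι.comp ((mappingCone.fst (𝟙 (L⟦m⟧))).1.rightUnshift (m + 1) (add_comm _ _))
      (show -1 - m + (m + 1) = 0 by omega)) = Cochain.ofHom (𝟙 L) := by
    ext p
    rw [Cochain.comp_v _ _ _ p (p - m - 1) p (by omega) (by omega), hι,
      Cochain.rightUnshift_v _ _ _ _ _ _ (p - m) (by omega), Category.assoc,
      mappingCone.inl_v_fst_v_assoc, Iso.inv_hom_id, Cochain.ofHom_v, HomologicalComplex.id_f]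
  -- The sign compensates the factor -(-1)^m which the coboundary of `cofreeProj` acquires from the
  -- unshift.
  refine ⟨-(m.negOnePow • ι), ?_, ?_⟩
  · rw [Cochain.neg_comp, Cochain.units_smul_comp]
    change -(m.negOnePow • ι.comp ((mappingCone.snd (𝟙 (L⟦m⟧))).rightUnshift m (zero_add m)) _) = 0
    rw [← Cochain.rightUnshift_comp ι _ (add_zero (-1 - m)) (-1) (by omega) m (zero_add m), h₁,
      Cochain.rightUnshift_zero, smul_zero, neg_zero]
  · have e : δ m (m + 1) (cofreeProj L m) = -(m.negOnePow •
        (mappingCone.fst (𝟙 (L⟦m⟧))).1.rightUnshift (m + 1) (add_comm _ _)) := by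
      dsimp only [cofreeProj]
      rw [Cochain.δ_rightUnshift _ m (zero_add m) (m + 1) 1 (add_comm _ _), mappingCone.δ_snd,
        Cochain.comp_id, Cochain.rightUnshift_neg, smul_neg]
    rw [e]
    refine Eq.trans ?_ h₂
    rw [Cochain.neg_comp, Cochain.units_smul_comp, Cochain.comp_neg, Cochain.comp_units_smul,
      smul_neg, neg_neg, smul_smul, Int.units_mul_self, one_smul]

lemma isZero_cofree (L : CochainComplex A ℤ) (m i : ℤ) (h₁ : IsZero (L.X (i + m)))
    (h₂ : IsZero (L.X (i + 1 + m))) : IsZero ((cofree L m).X i) :=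
  (mappingCone.isZero_X_iff (𝟙 (L⟦m⟧)) i).2 ⟨h₂, h₁⟩

/-- The universal property of the cochain `cofreeProj L m`, which is inherited by its image under an
additive functor. -/
lemma exists_comp_map_cofreeProj_eq {B : Type*} [Category* B] [Preadditive B] (Φ : A ⥤ B)
    [Φ.Additive] (L : CochainComplex A ℤ) (m : ℤ) {X : CochainComplex B ℤ}
    (y : Cochain X ((cx Φ).obj L) m) :
    ∃ ζ : X ⟶ (cx Φ).obj (cofree L m),
      (Cochain.ofHom ζ).comp ((cofreeProj L m).map Φ) (zero_add m) = y := by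
  obtain ⟨ι, h₁, h₂⟩ := exists_cofreeIncl L m
  -- Write π for the image of `cofreeProj`. As γ followed by π is zero and γ followed by δπ is y,
  -- the Leibniz rule shows that δγ followed by π is -(-1)^m y. Thus ζ = -(-1)^m δγ works; being a
  -- coboundary of degree 0, it is a morphism of complexes.
  let γ : Cochain X ((cx Φ).obj (cofree L m)) (-1) := y.comp (ι.map Φ) (by omega)
  have hγ : (δ (-1) 0 γ).comp ((cofreeProj L m).map Φ) (zero_add m) = -(m.negOnePow • y) := by
    have e₁ : γ.comp ((cofreeProj L m).map Φ) (show -1 + m = m - 1 by omega) = 0 := by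
      dsimp only [γ]
      rw [Cochain.comp_assoc _ _ _ _ (show -1 - m + m = -1 by omega) (by omega),
        ← Cochain.map_comp, h₁, Cochain.map_zero, Cochain.comp_zero]
    have e₂ := δ_comp γ ((cofreeProj L m).map Φ) (show -1 + m = m - 1 by omega) 0 (m + 1) m
      (by omega) rfl rfl
    have e₃ : γ.comp (δ m (m + 1) ((cofreeProj L m).map Φ)) (show -1 + (m + 1) = m by omega) =
        y := by
      dsimp only [γ]
      rw [Cochain.comp_assoc _ _ _ _ (show -1 - m + (m + 1) = 0 by omega) (by omega), δ_map,
        ← Cochain.map_comp, h₂, Cochain.map_ofHom, CategoryTheory.Functor.map_id, Cochain.comp_id]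
    rw [e₁, δ_zero, e₃] at e₂
    have e₄ : m.negOnePow • (δ (-1) 0 γ).comp ((cofreeProj L m).map Φ) (zero_add m) = -y :=
      eq_neg_of_add_eq_zero_right e₂.symm
    rw [← smul_neg, ← e₄, smul_smul, Int.units_mul_self, one_smul]
  refine ⟨Cocycle.homOf (Cocycle.mk (-(m.negOnePow • δ (-1) 0 γ)) 1 rfl (by simp [δ_δ])), ?_⟩
  rw [Cocycle.cochain_ofHom_homOf_eq_coe]
  change (-(m.negOnePow • δ (-1) 0 γ)).comp _ _ = y
  rw [Cochain.neg_comp, Cochain.units_smul_comp, hγ, smul_neg, neg_neg, smul_smul,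
    Int.units_mul_self, one_smul]

lemma isIso_quotient_map_biprod_fst (X Y : CochainComplex A ℤ)
    (hY : Nonempty (Homotopy (𝟙 Y) 0)) :
    IsIso ((HomotopyCategory.quotient A (ComplexShape.up ℤ)).map (biprod.fst : X ⊞ Y ⟶ X)) := by
  obtain ⟨h⟩ := hY
  refine isIso_quotient_map_of_homotopyInverse _ biprod.inl ?_ (Homotopy.ofEq biprod.inl_fst)
  -- Replacing the zero endomorphism of Y by the identity, to which it is homotopic, turns fst ≫ inl
  -- into the identity of X ⊞ Y.
  exact (Homotopy.ofEq (show biprod.fst ≫ biprod.inl = biprod.fst ≫ biprod.inl +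
      biprod.snd ≫ (0 : Y ⟶ Y) ≫ biprod.inr by simp)).trans
    (((Homotopy.refl _).add ((h.symm.compRight biprod.inr).compLeft biprod.snd)).trans
      (Homotopy.ofEq (by rw [Category.id_comp, biprod.total])))

end Cofree

/-! ### Perturbing the structure morphisms φ, c, s -/

section Perturb

open CochainComplex HomComplex

variable {K₀ K : Type u} [Field K₀] [Field K] [Algebra K₀ K] {σ : K₀ →+* K₀}

/-- The system obtained from `S` by adding `a`, `b`, `c` to the structure morphisms `φ`, `c`, `s`. -/
def Sys.perturb (S : Sys K σ) (a : (twist σ).obj S.rig ⟶ S.rig)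
    (b : (baseChange K₀ K).obj S.rig ⟶ S.vec) (c : S.dR.V ⟶ S.vec) : Sys K σ where
  rig := S.rig
  frob := S.frob + a
  dR := S.dR
  vec := S.vec
  c := S.c + b
  s := S.s + c

/-- A morphism of systems which is compatible with the perturbations. -/
def Sys.perturbMap {S T : Sys K σ} (f : S ⟶ T) {a : (twist σ).obj S.rig ⟶ S.rig}
    {b : (baseChange K₀ K).obj S.rig ⟶ S.vec} {c : S.dR.V ⟶ S.vec}
    {a' : (twist σ).obj T.rig ⟶ T.rig} {b' : (baseChange K₀ K).obj T.rig ⟶ T.vec}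
    {c' : T.dR.V ⟶ T.vec} (ha : a ≫ f.rig = (twist σ).map f.rig ≫ a')
    (hb : b ≫ f.vec = (baseChange K₀ K).map f.rig ≫ b') (hc : c ≫ f.vec = f.dR.hom ≫ c') :
    S.perturb a b c ⟶ T.perturb a' b' c' where
  rig := f.rig
  dR := f.dR
  vec := f.vec
  frob_comm := (Preadditive.add_comp _ _ _ _ _ _).trans
    ((congrArg₂ (· + ·) f.frob_comm ha).trans (Preadditive.comp_add _ _ _ _ _ _).symm)
  c_comm := (Preadditive.add_comp _ _ _ _ _ _).trans
    ((congrArg₂ (· + ·) f.c_comm hb).trans (Preadditive.comp_add _ _ _ _ _ _).symm)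
  s_comm := (Preadditive.add_comp _ _ _ _ _ _).trans
    ((congrArg₂ (· + ·) f.s_comm hc).trans (Preadditive.comp_add _ _ _ _ _ _).symm)

/-- A morphism of systems which kills the perturbations. -/
def Sys.perturbDesc {S T : Sys K σ} (f : S ⟶ T) {a : (twist σ).obj S.rig ⟶ S.rig}
    {b : (baseChange K₀ K).obj S.rig ⟶ S.vec} {c : S.dR.V ⟶ S.vec}
    (ha : a ≫ f.rig = 0) (hb : b ≫ f.vec = 0) (hc : c ≫ f.vec = 0) : S.perturb a b c ⟶ T where
  rig := f.rig
  dR := f.dR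
  vec := f.vec
  frob_comm := (Preadditive.add_comp _ _ _ _ _ _).trans
    ((congrArg₂ (· + ·) f.frob_comm ha).trans (add_zero _))
  c_comm := (Preadditive.add_comp _ _ _ _ _ _).trans
    ((congrArg₂ (· + ·) f.c_comm hb).trans (add_zero _))
  s_comm := (Preadditive.add_comp _ _ _ _ _ _).trans
    ((congrArg₂ (· + ·) f.s_comm hc).trans (add_zero _))

/-- The complex of systems obtained from `E` by adding `θ₀`, `θ₁`, `θ₂` to the structure morphisms
`φ`, `c`, `s`. -/
def perturb (E : CochainComplex (Sys K σ) ℤ)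
    (θ₀ : (sigmaPart K σ).obj E ⟶ (zeroPart K σ).obj E)
    (θ₁ : (rigPart K σ).obj E ⟶ (vecPart K σ).obj E)
    (θ₂ : (dRVecPart K σ).obj E ⟶ (vecPart K σ).obj E) : CochainComplex (Sys K σ) ℤ where
  X i := (E.X i).perturb (θ₀.f i) (θ₁.f i) (θ₂.f i)
  d i j := Sys.perturbMap (E.d i j) (θ₀.comm i j) (θ₁.comm i j) (θ₂.comm i j)
  shape i j hij := by
    have := E.shape i j hij
    exact Sys.hom_ext (congrArg (fun f : E.X i ⟶ E.X j => Sys.Hom.rig f) this)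
      (congrArg (fun f : E.X i ⟶ E.X j => Sys.Hom.dR f) this)
      (congrArg (fun f : E.X i ⟶ E.X j => Sys.Hom.vec f) this)
  d_comp_d' i j k _ _ := by
    have := E.d_comp_d i j k
    exact Sys.hom_ext (congrArg (fun f : E.X i ⟶ E.X k => Sys.Hom.rig f) this)
      (congrArg (fun f : E.X i ⟶ E.X k => Sys.Hom.dR f) this)
      (congrArg (fun f : E.X i ⟶ E.X k => Sys.Hom.vec f) this)

variable {E M : CochainComplex (Sys K σ) ℤ}
    {θ₀ : (sigmaPart K σ).obj E ⟶ (zeroPart K σ).obj E}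
    {θ₁ : (rigPart K σ).obj E ⟶ (vecPart K σ).obj E}
    {θ₂ : (dRVecPart K σ).obj E ⟶ (vecPart K σ).obj E}

/-- A morphism `f : E ⟶ M` defines a morphism on a perturbation of `E` if it kills the
perturbations. -/
def perturbDesc (f : E ⟶ M) (h₀ : θ₀ ≫ (zeroPart K σ).map f = 0)
    (h₁ : θ₁ ≫ (vecPart K σ).map f = 0) (h₂ : θ₂ ≫ (vecPart K σ).map f = 0) :
    perturb E θ₀ θ₁ θ₂ ⟶ M where
  f i := Sys.perturbDesc (f.f i) (HomologicalComplex.congr_hom h₀ i)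
    (HomologicalComplex.congr_hom h₁ i) (HomologicalComplex.congr_hom h₂ i)
  comm' i j _ := by
    have := f.comm i j
    exact Sys.hom_ext (congrArg (fun f : E.X i ⟶ M.X j => Sys.Hom.rig f) this)
      (congrArg (fun f : E.X i ⟶ M.X j => Sys.Hom.dR f) this)
      (congrArg (fun f : E.X i ⟶ M.X j => Sys.Hom.vec f) this)

lemma isZero_perturb_X (i : ℤ) (h : IsZero (E.X i)) : IsZero ((perturb E θ₀ θ₁ θ₂).X i) := by
  rw [IsZero.iff_id_eq_zero] at h ⊢
  exact Sys.hom_ext (congrArg (fun f : E.X i ⟶ E.X i => Sys.Hom.rig f) h)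
    (congrArg (fun f : E.X i ⟶ E.X i => Sys.Hom.dR f) h)
    (congrArg (fun f : E.X i ⟶ E.X i => Sys.Hom.vec f) h)

/-- The complexes M₀, M_dR and M_K are untouched, so the finiteness conditions are literally the
same. -/
lemma isHodgeComplex_perturb (hE : isHodgeComplex K σ E) :
    isHodgeComplex K σ (perturb E θ₀ θ₁ θ₂) := by
  obtain ⟨⟨a, b, h⟩, h₁, h₂⟩ := hE
  exact ⟨⟨a, b, fun n hn => isZero_perturb_X n (h n hn)⟩, h₁, h₂⟩

lemma componentwiseEquiv_perturbDesc (f : E ⟶ M) (h₀ : θ₀ ≫ (zeroPart K σ).map f = 0)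
    (h₁ : θ₁ ≫ (vecPart K σ).map f = 0) (h₂ : θ₂ ≫ (vecPart K σ).map f = 0)
    (hf : ComponentwiseEquiv f) : ComponentwiseEquiv (perturbDesc f h₀ h₁ h₂) :=
  ⟨hf.zero, hf.dR, hf.vec⟩

lemma finite_homology_of_isIso {A : Type*} [Category* A] [Preadditive A]
    (Φ : A ⥤ ModuleCat.{u} K) [Φ.Additive] {X Y : CochainComplex A ℤ} (f : X ⟶ Y)
    (hf : IsIso ((HomotopyCategory.quotient A (ComplexShape.up ℤ)).map f)) (n : ℤ)
    (hY : Module.Finite K (((cx Φ).obj Y).homology n)) :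
    Module.Finite K (((cx Φ).obj X).homology n) := by
  have : QuasiIso ((cx Φ).map f) :=
    (HomotopyCategory.quotient_map_mem_quasiIso_iff _).1 (mem_quasiIso_of_isIso Φ f hf)
  exact Module.Finite.equiv
    (asIso (HomologicalComplex.homologyMap ((cx Φ).map f) n)).toLinearEquiv.symm

lemma isHodgeComplex_biprod_cofree {M M' : CochainComplex (Sys K σ) ℤ} (hM : isHodgeComplex K σ M)
    (hM' : isHodgeComplex K σ M') (m : ℤ) : isHodgeComplex K σ (M ⊞ cofree M' m) := by
  have hfst := isIso_quotient_map_biprod_fst M _ (exists_contraction_cofree M' m)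
  obtain ⟨⟨a, b, h⟩, h₁, h₂⟩ := hM
  obtain ⟨⟨a', b', h'⟩, -, -⟩ := hM'
  -- In degree n the cofree complex is M'^{n+m+1} ⊕ M'^{n+m}, whence the bounds a' - m - 1 and b' -
  -- m. Cohomology is that of M, because the projection to M is a homotopy equivalence of complexes
  -- of systems.
  refine ⟨⟨min a (a' - m - 1), max b (b' - m), fun n hn => ?_⟩,
    fun n => finite_homology_of_isIso (Sys.rigFunctor K σ ⋙ baseChange K₀ K) _ hfst n (h₁ n),
    fun n => finite_homology_of_isIso (Sys.dRFunctor K σ ⋙ Filt.forget K) _ hfst n (h₂ n)⟩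
  refine IsZero.of_iso ?_ (HomologicalComplex.biprodXIso M (cofree M' m) n)
  have z₁ := h n (by omega)
  have z₂ := isZero_cofree M' m n (h' _ (by omega)) (h' _ (by omega))
  rw [IsZero.iff_id_eq_zero]
  exact biprod.hom_ext _ _ (z₁.eq_of_tgt _ _) (z₂.eq_of_tgt _ _)

end Perturb

/-! ### Γ and ψ on elements -/

section GammaElements

open CochainComplex HomComplex

section

variable {C D C' D' : CochainComplex AddCommGrpCat.{u} ℤ} {ψ : C ⟶ D} {ψ' : C' ⟶ D'}

lemma shift_map_coneElt (a : C ⟶ C') (b : D ⟶ D') (comm : ψ ≫ b = a ≫ ψ') (m n : ℤ) (h : m + 1 = n)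
    (x : C.X n) (y : D.X m) :
    HomologicalComplex.Hom.f (show mappingCocone ψ ⟶ mappingCocone ψ' from
      (mappingCone.map ψ ψ' a b comm)⟦(-1 : ℤ)⟧') n (coneElt ψ m n h x y) =
      coneElt ψ' m n h (a.f n x) (b.f m y) := by
  obtain rfl : m = n + -1 := by omega
  have h₁ : (mappingCocone.inl ψ).v n n (add_zero n) ≫
      HomologicalComplex.Hom.f (show mappingCocone ψ ⟶ mappingCocone ψ' from
      (mappingCone.map ψ ψ' a b comm)⟦(-1 : ℤ)⟧') n =
      a.f n ≫ (mappingCocone.inl ψ').v n n (add_zero n) := by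
    dsimp only [mappingCocone.inl, mappingCocone]
    rw [Cochain.rightShift_v _ _ _ _ n n _ (n + -1) (by omega),
      Cochain.rightShift_v _ _ _ _ n n _ (n + -1) (by omega)]
    simp only [mappingCone.map, HomologicalComplex.XIsoOfEq_rfl, shiftFunctor_map_f', shiftFunctorObjXIso, Iso.refl_inv]
    erw [Category.comp_id, Category.comp_id, mappingCone.inl_v_desc_f]
    simp
  have h₂ : (mappingCocone.inr ψ).1.v (n + -1) n h ≫
      HomologicalComplex.Hom.f (show mappingCocone ψ ⟶ mappingCocone ψ' from
      (mappingCone.map ψ ψ' a b comm)⟦(-1 : ℤ)⟧') n =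
      b.f (n + -1) ≫ (mappingCocone.inr ψ').1.v (n + -1) n h := by
    dsimp only [mappingCocone.inr, mappingCocone, Cocycle.rightShift]
    simp only [Cocycle.mk_coe]
    rw [Cochain.rightShift_v _ _ _ _ (n + -1) n _ (n + -1) (by omega),
      Cochain.rightShift_v _ _ _ _ (n + -1) n _ (n + -1) (by omega)]
    simp only [mappingCone.map, HomologicalComplex.XIsoOfEq_rfl, shiftFunctor_map_f', shiftFunctorObjXIso, Iso.refl_inv]
    erw [Cochain.ofHom_v, Cochain.ofHom_v, Category.comp_id, Category.comp_id, mappingCone.inr_f_desc_f]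
    rfl
  rw [coneElt, map_add]
  exact congrArg₂ (· + ·) (ConcreteCategory.congr_hom h₁ x) (ConcreteCategory.congr_hom h₂ y)

lemma lift_eq_coneElt {B : CochainComplex AddCommGrpCat.{u} ℤ} (α : B ⟶ C)
    (hα : δ (-1) 0 (0 : Cochain B D (-1)) + Cochain.ofHom (α ≫ ψ) = 0) (m n : ℤ) (h : m + 1 = n)
    (b : B.X n) :
    (mappingCocone.lift ψ α 0 hα).f n b = coneElt ψ m n h (α.f n b) 0 := by
  have e := ConcreteCategory.congr_hom (mappingCocone.id_X ψ n m (by omega))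
    ((mappingCocone.lift ψ α 0 hα).f n b)
  refine e.symm.trans ?_
  change (mappingCocone.inl ψ).v n n (add_zero n) _ + (mappingCocone.inr ψ).1.v m n h _ =
    (mappingCocone.inl ψ).v n n (add_zero n) _ + (mappingCocone.inr ψ).1.v m n h _
  refine congrArg₂ (· + ·) (congrArg _ ?_) (congrArg _ ?_)
  · exact ConcreteCategory.congr_hom (mappingCocone.lift_f_fst_f ψ α 0 hα n) b
  · refine (ConcreteCategory.congr_hom (mappingCocone.lift_f_snd_v ψ α 0 hα n m (by omega)) b).trans ?_
    rw [Cochain.zero_v]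
    rfl

end

variable {K₀ K : Type u} [Field K₀] [Field K] [Algebra K₀ K] {σ : K₀ →+* K₀}
  {M M' N N' : CochainComplex (Sys K σ) ℤ}

lemma gamma_map_coneElt (f : N ⟶ M) (g : M' ⟶ N') (m n : ℤ) (h : m + 1 = n)
    (x : (Gamma₀ M M').X n) (y : (Gamma₁ M M').X m) :
    (Gamma.map f g).f n (coneElt (psi M M') m n h x y) =
      coneElt (psi N N') m n h ((Gamma₀.map f g).f n x) ((Gamma₁.map f g).f m y) :=
  shift_map_coneElt _ _ _ m n h x y

lemma homToGamma_eq_coneElt (m n : ℤ) (h : m + 1 = n) (z : (HomComplex M M').X n) :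
    (homToGamma M M').f n z = coneElt (psi M M') m n h ((homToGamma₀ M M').f n z) 0 :=
  lift_eq_coneElt _ _ m n h z

lemma homToGamma₀_map (f : N ⟶ M) (g : M' ⟶ N') :
    homToGamma₀ M M' ≫ Gamma₀.map f g = (homPre f _ ≫ homPost _ g) ≫ homToGamma₀ N N' := by
  apply biprod.hom_ext _ _ _ (biprod.hom_ext _ _ _ _) 
  all_goals
    simp only [homToGamma₀, Gamma₀.map, Category.assoc, biprod.map_fst, biprod.map_snd,
      biprod.lift_fst, biprod.lift_snd, biprod.lift_fst_assoc,
      biprod.lift_snd_assoc]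
    rw [← homPre_homMap_assoc, ← homPost_homMap]

lemma psi_fst : psi M M' ≫ biprod.fst = -(biprod.fst ≫ h₀ M M') := by
  apply biprod.hom_ext' _ _ _ (biprod.hom_ext' _ _ _ _) <;> simp [psi]

lemma psi_snd_fst : psi M M' ≫ biprod.snd ≫ biprod.fst =
    biprod.fst ≫ h₁ M M' - biprod.snd ≫ biprod.fst ≫ h₂ M M' := by
  apply biprod.hom_ext' _ _ _ (biprod.hom_ext' _ _ _ _) <;> simp [psi]

lemma psi_snd_snd : psi M M' ≫ biprod.snd ≫ biprod.snd =
    biprod.snd ≫ biprod.fst ≫ h₃ M M' - biprod.snd ≫ biprod.snd ≫ h₄ M M' := by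
  apply biprod.hom_ext' _ _ _ (biprod.hom_ext' _ _ _ _) <;> simp [psi]

end GammaElements

/-! ### Elements of a threefold direct sum -/

section Triples

variable {A B C : CochainComplex AddCommGrpCat.{u} ℤ} {n : ℤ}

lemma exists_triple (a : A.X n) (b : B.X n) (c : C.X n) : ∃ x : (A ⊞ (B ⊞ C)).X n,
    (biprod.fst : A ⊞ (B ⊞ C) ⟶ A).f n x = a ∧
    (biprod.snd ≫ biprod.fst : A ⊞ (B ⊞ C) ⟶ B).f n x = b ∧
    (biprod.snd ≫ biprod.snd : A ⊞ (B ⊞ C) ⟶ C).f n x = c := by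
  let ia : A ⟶ A ⊞ (B ⊞ C) := biprod.inl
  let ib : B ⟶ A ⊞ (B ⊞ C) := biprod.inl ≫ biprod.inr
  let ic : C ⟶ A ⊞ (B ⊞ C) := biprod.inr ≫ biprod.inr
  have key {X Y : CochainComplex AddCommGrpCat.{u} ℤ} (p : A ⊞ (B ⊞ C) ⟶ Y) (i : X ⟶ A ⊞ (B ⊞ C))
      (j : X ⟶ Y) (h : i ≫ p = j) (x : X.X n) : p.f n (i.f n x) = j.f n x :=
    ConcreteCategory.congr_hom (HomologicalComplex.congr_hom h n) x
  refine ⟨ia.f n a + ib.f n b + ic.f n c, ?_, ?_, ?_⟩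
  · rw [map_add, map_add, key _ ia (𝟙 A) (by simp [ia]), key _ ib 0 (by simp [ib]),
      key _ ic 0 (by simp [ic])]
    exact (add_zero _).trans (add_zero _)
  · rw [map_add, map_add, key _ ia 0 (by simp [ia]), key _ ib (𝟙 B) (by simp [ib]),
      key _ ic 0 (by simp [ic])]
    exact (add_zero _).trans (zero_add _)
  · rw [map_add, map_add, key _ ia 0 (by simp [ia]), key _ ib 0 (by simp [ib]),
      key _ ic (𝟙 C) (by simp [ic])]
    exact (congrArg (· + c) (zero_add (0 : C.X n))).trans (zero_add _)

lemma triple_ext {x y : (A ⊞ (B ⊞ C)).X n}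
    (h₁ : (biprod.fst : A ⊞ (B ⊞ C) ⟶ A).f n x = (biprod.fst : A ⊞ (B ⊞ C) ⟶ A).f n y)
    (h₂ : (biprod.snd ≫ biprod.fst : A ⊞ (B ⊞ C) ⟶ B).f n x =
      (biprod.snd ≫ biprod.fst : A ⊞ (B ⊞ C) ⟶ B).f n y)
    (h₃ : (biprod.snd ≫ biprod.snd : A ⊞ (B ⊞ C) ⟶ C).f n x =
      (biprod.snd ≫ biprod.snd : A ⊞ (B ⊞ C) ⟶ C).f n y) : x = y := by
  have e : 𝟙 (A ⊞ (B ⊞ C)) = biprod.fst ≫ biprod.inl + (biprod.snd ≫ biprod.fst) ≫ biprod.inl ≫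
      biprod.inr + (biprod.snd ≫ biprod.snd) ≫ biprod.inr ≫ biprod.inr := by
    apply biprod.hom_ext _ _ _ (biprod.hom_ext _ _ _ _) <;> simp
  have e' (w : (A ⊞ (B ⊞ C)).X n) : w = (biprod.inl : A ⟶ A ⊞ (B ⊞ C)).f n
      ((biprod.fst : A ⊞ (B ⊞ C) ⟶ A).f n w) + (biprod.inl ≫ biprod.inr : B ⟶ A ⊞ (B ⊞ C)).f n
      ((biprod.snd ≫ biprod.fst : A ⊞ (B ⊞ C) ⟶ B).f n w) +
      (biprod.inr ≫ biprod.inr : C ⟶ A ⊞ (B ⊞ C)).f n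
      ((biprod.snd ≫ biprod.snd : A ⊞ (B ⊞ C) ⟶ C).f n w) :=
    ConcreteCategory.congr_hom (HomologicalComplex.congr_hom e n) w
  rw [e' x, e' y, h₁, h₂, h₃]

end Triples

/-! ### The kernel of ψ, and surjectivity of ψ up to quasi-isomorphism -/

section Strict

open CochainComplex HomComplex

variable {K₀ K : Type u} [Field K₀] [Field K] [Algebra K₀ K] {σ : K₀ →+* K₀}
  {M M' N E L : CochainComplex (Sys K σ) ℤ} {n : ℤ}

lemma homToGamma₀_fst (z : Cochain M M' n) :
    (biprod.fst : Gamma₀ M M' ⟶ _).f n ((homToGamma₀ M M').f n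
      (show (HomComplex M M').X n from z)) = z.map (Sys.rigFunctor K σ) :=
  ConcreteCategory.congr_hom (HomologicalComplex.congr_hom
    (show homToGamma₀ M M' ≫ biprod.fst = homMap (Sys.rigFunctor K σ) M M' by
      simp [homToGamma₀]) n) _

lemma homToGamma₀_snd_fst (z : Cochain M M' n) :
    (biprod.snd ≫ biprod.fst : Gamma₀ M M' ⟶ _).f n ((homToGamma₀ M M').f n
      (show (HomComplex M M').X n from z)) = z.map (Sys.vecFunctor K σ) :=
  ConcreteCategory.congr_hom (HomologicalComplex.congr_hom
    (show homToGamma₀ M M' ≫ biprod.snd ≫ biprod.fst = homMap (Sys.vecFunctor K σ) M M' by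
      simp [homToGamma₀]) n) _

lemma homToGamma₀_snd_snd (z : Cochain M M' n) :
    (biprod.snd ≫ biprod.snd : Gamma₀ M M' ⟶ _).f n ((homToGamma₀ M M').f n
      (show (HomComplex M M').X n from z)) = z.map (Sys.dRFunctor K σ) :=
  ConcreteCategory.congr_hom (HomologicalComplex.congr_hom
    (show homToGamma₀ M M' ≫ biprod.snd ≫ biprod.snd = homMap (Sys.dRFunctor K σ) M M' by
      simp [homToGamma₀]) n) _

/-- This allows cocycle and coboundary identities between strict maps to be checked in Γ₀. -/
lemma homToGamma₀_injective (z : Cochain M M' n)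
    (h : (homToGamma₀ M M').f n (show (HomComplex M M').X n from z) = 0) : z = 0 := by
  have e₁ := homToGamma₀_fst z
  have e₂ := homToGamma₀_snd_fst z
  have e₃ := homToGamma₀_snd_snd z
  rw [h, map_zero] at e₁ e₂ e₃
  refine Cochain.ext _ _ fun p q hpq => Sys.hom_ext ?_ ?_ ?_
  · exact (Cochain.congr_v (show (0 : Cochain _ _ n) = _ from e₁) p q hpq).symm
  · exact (Cochain.congr_v (show (0 : Cochain _ _ n) = _ from e₃) p q hpq).symm
  · exact (Cochain.congr_v (show (0 : Cochain _ _ n) = _ from e₂) p q hpq).symm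

lemma psi_apply_fst (x : (Gamma₀ M M').X n) :
    (biprod.fst : Gamma₁ M M' ⟶ _).f n ((psi M M').f n x) =
      -(h₀ M M').f n ((biprod.fst : Gamma₀ M M' ⟶ _).f n x) :=
  ConcreteCategory.congr_hom (HomologicalComplex.congr_hom psi_fst n) x

lemma psi_apply_snd_fst (x : (Gamma₀ M M').X n) :
    (biprod.snd ≫ biprod.fst : Gamma₁ M M' ⟶ _).f n ((psi M M').f n x) =
      (h₁ M M').f n ((biprod.fst : Gamma₀ M M' ⟶ _).f n x) -
        (h₂ M M').f n ((biprod.snd ≫ biprod.fst : Gamma₀ M M' ⟶ _).f n x) :=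
  ConcreteCategory.congr_hom (HomologicalComplex.congr_hom psi_snd_fst n) x

lemma psi_apply_snd_snd (x : (Gamma₀ M M').X n) :
    (biprod.snd ≫ biprod.snd : Gamma₁ M M' ⟶ _).f n ((psi M M').f n x) =
      (h₃ M M').f n ((biprod.snd ≫ biprod.fst : Gamma₀ M M' ⟶ _).f n x) -
        (h₄ M M').f n ((biprod.snd ≫ biprod.snd : Gamma₀ M M' ⟶ _).f n x) :=
  ConcreteCategory.congr_hom (HomologicalComplex.congr_hom psi_snd_snd n) x

lemma psi_homToGamma₀ (z : (HomComplex M M').X n) :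
    (psi M M').f n ((homToGamma₀ M M').f n z) = 0 :=
  ConcreteCategory.congr_hom (HomologicalComplex.congr_hom (homToGamma₀_psi M M') n) z

lemma homPre_add {A : Type*} [Category.{u} A] [Preadditive A] {X Y : CochainComplex A ℤ}
    (f g : X ⟶ Y) (L : CochainComplex A ℤ) : homPre (f + g) L = homPre f L + homPre g L := by
  ext n (z : Cochain Y L n)
  exact (congrArg (fun w : Cochain X Y 0 => w.comp z (zero_add n)) (Cochain.ofHom_add f g)).trans
    (Cochain.add_comp _ _ _ _)

/-- The kernel of `ψ` consists of the homogeneous maps which are compatible with all the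
structures. -/
lemma exists_homToGamma₀_eq (x : (Gamma₀ M M').X n) (hx : (psi M M').f n x = 0) :
    ∃ z : Cochain M M' n, (homToGamma₀ M M').f n (show (HomComplex M M').X n from z) = x := by
  have e₁ := psi_apply_fst x
  have e₂ := psi_apply_snd_fst x
  have e₃ := psi_apply_snd_snd x
  rw [hx, map_zero] at e₁ e₂ e₃
  replace e₁ := neg_eq_zero.1 e₁.symm
  generalize ha : (biprod.fst : Gamma₀ M M' ⟶ _).f n x = a at e₁ e₂ e₃
  generalize hb : (biprod.snd ≫ biprod.fst : Gamma₀ M M' ⟶ _).f n x = b at e₁ e₂ e₃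
  generalize hc : (biprod.snd ≫ biprod.snd : Gamma₀ M M' ⟶ _).f n x = c at e₁ e₂ e₃
  change Cochain _ _ n at a b c
  have f₁ : (Cochain.ofHom ((frob K σ).app M)).comp a (zero_add n) =
      (a.map (twist σ)).comp (Cochain.ofHom ((frob K σ).app M')) (add_zero n) := sub_eq_zero.1 e₁
  have f₂ : (a.map (baseChange K₀ K)).comp (Cochain.ofHom ((compC K σ).app M')) (add_zero n) =
      (Cochain.ofHom ((compC K σ).app M)).comp b (zero_add n) := sub_eq_zero.1 e₂.symm
  have f₃ : (Cochain.ofHom ((compS K σ).app M)).comp b (zero_add n) =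
      (c.map (Filt.forget K)).comp (Cochain.ofHom ((compS K σ).app M')) (add_zero n) :=
    sub_eq_zero.1 e₃.symm
  -- In each degree, the vanishing of the three components of ψ(x) is exactly the compatibility of
  -- the triple with φ, c and s.
  let z : Cochain M M' n := Cochain.mk fun p q hpq =>
    { rig := a.v p q hpq
      dR := c.v p q hpq
      vec := b.v p q hpq
      frob_comm := by
        have := Cochain.congr_v f₁ p q hpq
        rw [Cochain.zero_cochain_comp_v, Cochain.comp_zero_cochain_v, Cochain.ofHom_v,
          Cochain.ofHom_v] at this
        exact this
      c_comm := by
        have := (Cochain.congr_v f₂ p q hpq).symm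
        rw [Cochain.zero_cochain_comp_v, Cochain.comp_zero_cochain_v, Cochain.ofHom_v,
          Cochain.ofHom_v] at this
        exact this
      s_comm := by
        have := Cochain.congr_v f₃ p q hpq
        rw [Cochain.zero_cochain_comp_v, Cochain.comp_zero_cochain_v, Cochain.ofHom_v,
          Cochain.ofHom_v] at this
        exact this }
  exact ⟨z, triple_ext ((homToGamma₀_fst z).trans ha.symm) ((homToGamma₀_snd_fst z).trans hb.symm)
    ((homToGamma₀_snd_snd z).trans hc.symm)⟩

section

variable {θ₀ : (sigmaPart K σ).obj E ⟶ (zeroPart K σ).obj E}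
    {θ₁ : (rigPart K σ).obj E ⟶ (vecPart K σ).obj E}
    {θ₂ : (dRVecPart K σ).obj E ⟶ (vecPart K σ).obj E}

/-- A cochain z that is strict for E is killed by ψ for E, so ψ for the perturbed complex sees only
the added terms. In the three components of ψ these are -z θ₀, -z θ₁ and z θ₂. -/
lemma h₀_perturb (z : Cochain E L n) :
    (h₀ (perturb E θ₀ θ₁ θ₂) L).f n (show Cochain ((zeroPart K σ).obj E) _ n from
      z.map (Sys.rigFunctor K σ)) =
    (homPre θ₀ ((zeroPart K σ).obj L)).f n (z.map (Sys.rigFunctor K σ)) := by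
  have e : (show HomComplex ((zeroPart K σ).obj E) ((zeroPart K σ).obj L) ⟶
      HomComplex ((sigmaPart K σ).obj E) ((zeroPart K σ).obj L) from
        h₀ (perturb E θ₀ θ₁ θ₂) L) = h₀ E L + homPre θ₀ _ :=
    (congrArg (· - homMap (twist σ) _ _ ≫ homPost _ ((frob K σ).app L))
      (homPre_add ((frob K σ).app E) θ₀ _)).trans (sub_add_eq_add_sub _ _ _).symm
  refine (ConcreteCategory.congr_hom (HomologicalComplex.congr_hom e n) _).trans
    ((congrArg (· + _) ?_).trans (zero_add _))
  have e' := psi_apply_fst ((homToGamma₀ E L).f n (show (HomComplex E L).X n from z))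
  rw [psi_homToGamma₀, map_zero, homToGamma₀_fst] at e'
  exact neg_eq_zero.1 e'.symm

lemma h₁_sub_h₂_perturb (z : Cochain E L n) :
    (h₁ (perturb E θ₀ θ₁ θ₂) L).f n (show Cochain ((zeroPart K σ).obj E) _ n from
      z.map (Sys.rigFunctor K σ)) -
    (h₂ (perturb E θ₀ θ₁ θ₂) L).f n (show Cochain ((vecPart K σ).obj E) _ n from
      z.map (Sys.vecFunctor K σ)) =
    -(homPre θ₁ ((vecPart K σ).obj L)).f n (z.map (Sys.vecFunctor K σ)) := by
  have e : (show HomComplex ((vecPart K σ).obj E) ((vecPart K σ).obj L) ⟶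
      HomComplex ((rigPart K σ).obj E) ((vecPart K σ).obj L) from
        h₂ (perturb E θ₀ θ₁ θ₂) L) = h₂ E L + homPre θ₁ _ :=
    homPre_add ((compC K σ).app E) θ₁ _
  have e' := psi_apply_snd_fst ((homToGamma₀ E L).f n (show (HomComplex E L).X n from z))
  rw [psi_homToGamma₀, map_zero, homToGamma₀_fst, homToGamma₀_snd_fst] at e'
  refine (congrArg₂ (· - ·) (sub_eq_zero.1 e'.symm)
    (ConcreteCategory.congr_hom (HomologicalComplex.congr_hom e n) _)).trans ?_
  exact sub_add_cancel_left _ _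

lemma h₃_sub_h₄_perturb (z : Cochain E L n) :
    (h₃ (perturb E θ₀ θ₁ θ₂) L).f n (show Cochain ((vecPart K σ).obj E) _ n from
      z.map (Sys.vecFunctor K σ)) -
    (h₄ (perturb E θ₀ θ₁ θ₂) L).f n (show Cochain ((dRPart K σ).obj E) _ n from
      z.map (Sys.dRFunctor K σ)) =
    (homPre θ₂ ((vecPart K σ).obj L)).f n (z.map (Sys.vecFunctor K σ)) := by
  have e : (show HomComplex ((vecPart K σ).obj E) ((vecPart K σ).obj L) ⟶
      HomComplex ((dRVecPart K σ).obj E) ((vecPart K σ).obj L) from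
        h₃ (perturb E θ₀ θ₁ θ₂) L) = h₃ E L + homPre θ₂ _ :=
    homPre_add ((compS K σ).app E) θ₂ _
  have e' := psi_apply_snd_snd ((homToGamma₀ E L).f n (show (HomComplex E L).X n from z))
  rw [psi_homToGamma₀, map_zero, homToGamma₀_snd_snd, homToGamma₀_snd_fst] at e'
  refine (congrArg₂ (· - ·) (ConcreteCategory.congr_hom (HomologicalComplex.congr_hom e n) _)
    (sub_eq_zero.1 e'.symm).symm).trans ?_
  exact add_sub_cancel_left _ _

end

lemma gamma₁_map_fst (f : N ⟶ M) (y : (Gamma₁ M M').X n) :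
    (biprod.fst : Gamma₁ N M' ⟶ _).f n ((Gamma₁.map f (𝟙 M')).f n y) =
      (Cochain.ofHom ((sigmaPart K σ).map f)).comp
        (show Cochain _ _ n from (biprod.fst : Gamma₁ M M' ⟶ _).f n y) (zero_add n) := by
  have e : Gamma₁.map f (𝟙 M') ≫ biprod.fst = biprod.fst ≫ homPre ((sigmaPart K σ).map f) _ := by
    rw [Gamma₁.map, biprod.map_fst, (zeroPart K σ).map_id, homPost_id, Category.comp_id]
  exact ConcreteCategory.congr_hom (HomologicalComplex.congr_hom e n) y

lemma gamma₁_map_snd_fst (f : N ⟶ M) (y : (Gamma₁ M M').X n) :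
    (biprod.snd ≫ biprod.fst : Gamma₁ N M' ⟶ _).f n ((Gamma₁.map f (𝟙 M')).f n y) =
      (Cochain.ofHom ((rigPart K σ).map f)).comp
        (show Cochain _ _ n from (biprod.snd ≫ biprod.fst : Gamma₁ M M' ⟶ _).f n y)
        (zero_add n) := by
  have e : Gamma₁.map f (𝟙 M') ≫ biprod.snd ≫ biprod.fst =
      (biprod.snd ≫ biprod.fst) ≫ homPre ((rigPart K σ).map f) _ := by
    rw [Gamma₁.map, biprod.map_snd_assoc, biprod.map_fst, (vecPart K σ).map_id, homPost_id,
      Category.comp_id, Category.assoc]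
  exact ConcreteCategory.congr_hom (HomologicalComplex.congr_hom e n) y

lemma gamma₁_map_snd_snd (f : N ⟶ M) (y : (Gamma₁ M M').X n) :
    (biprod.snd ≫ biprod.snd : Gamma₁ N M' ⟶ _).f n ((Gamma₁.map f (𝟙 M')).f n y) =
      (Cochain.ofHom ((dRVecPart K σ).map f)).comp
        (show Cochain _ _ n from (biprod.snd ≫ biprod.snd : Gamma₁ M M' ⟶ _).f n y)
        (zero_add n) := by
  have e : Gamma₁.map f (𝟙 M') ≫ biprod.snd ≫ biprod.snd =
      (biprod.snd ≫ biprod.snd) ≫ homPre ((dRVecPart K σ).map f) _ := by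
    rw [Gamma₁.map, biprod.map_snd_assoc, biprod.map_snd, (vecPart K σ).map_id, homPost_id,
      Category.comp_id, Category.assoc]
  exact ConcreteCategory.congr_hom (HomologicalComplex.congr_hom e n) y

lemma comp_inr_comp_map_snd {A B : Type*} [Category* A] [Preadditive A] [HasBinaryBiproducts A]
    [Category* B] [Preadditive B] (Φ : A ⥤ B) [Φ.Additive] {M P L : CochainComplex A ℤ}
    {X Y : CochainComplex B ℤ} (τ : X ⟶ Y) (ζ : Y ⟶ (cx Φ).obj P) (w : Cochain P L n) :
    (Cochain.ofHom (τ ≫ ζ ≫ (cx Φ).map (biprod.inr : P ⟶ M ⊞ P))).comp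
      (((Cochain.ofHom (biprod.snd : M ⊞ P ⟶ P)).comp w (zero_add n)).map Φ) (zero_add n) =
    (Cochain.ofHom τ).comp ((Cochain.ofHom ζ).comp (w.map Φ) (zero_add n)) (zero_add n) := by
  have e : (cx Φ).map (biprod.inr : P ⟶ M ⊞ P) ≫ (cx Φ).map (biprod.snd : M ⊞ P ⟶ P) = 𝟙 _ := by
    rw [← Functor.map_comp, biprod.inr_snd, CategoryTheory.Functor.map_id]
  rw [Cochain.map_comp, Cochain.map_ofHom, ← Cochain.comp_assoc_of_second_is_zero_cochain,
    ← Cochain.ofHom_comp, Category.assoc, Category.assoc, e, Category.comp_id, Cochain.ofHom_comp,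
    Cochain.comp_assoc_of_second_is_zero_cochain]

lemma comp_inr_comp_map_fst {A B : Type*} [Category* A] [Preadditive A] [HasBinaryBiproducts A]
    [Category* B] [Preadditive B] (Φ : A ⥤ B) [Φ.Additive] {M P : CochainComplex A ℤ}
    {X Y : CochainComplex B ℤ} (τ : X ⟶ Y) (ζ : Y ⟶ (cx Φ).obj P) :
    (τ ≫ ζ ≫ (cx Φ).map (biprod.inr : P ⟶ M ⊞ P)) ≫ (cx Φ).map biprod.fst = 0 := by
  rw [Category.assoc, Category.assoc, ← Functor.map_comp, biprod.inr_fst, Functor.map_zero,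
    comp_zero, comp_zero]

/-- After a componentwise homotopy equivalence `t : N ⟶ M`, every element of `Γ₁(M, M')` is in the
image of `ψ`. -/
lemma exists_psi_eq_gamma₁_map (hM : isHodgeComplex K σ M) (hM' : isHodgeComplex K σ M') (m : ℤ)
    (y : (Gamma₁ M M').X m) :
    ∃ (N : CochainComplex (Sys K σ) ℤ) (_ : isHodgeComplex K σ N) (t : N ⟶ M)
      (_ : ComponentwiseEquiv t) (q : (Gamma₀ N M').X m),
      (psi N M').f m q = (Gamma₁.map t (𝟙 M')).f m y := by
  -- The first two components of y enter with a minus sign, to match the signs with which ψ sees a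
  -- perturbation.
  obtain ⟨ζ₀, hζ₀⟩ := exists_comp_map_cofreeProj_eq (Sys.rigFunctor K σ) M' m
    (-(show Cochain ((sigmaPart K σ).obj M) _ m from (biprod.fst : Gamma₁ M M' ⟶ _).f m y))
  obtain ⟨ζ₁, hζ₁⟩ := exists_comp_map_cofreeProj_eq (Sys.vecFunctor K σ) M' m
    (-(show Cochain ((rigPart K σ).obj M) _ m from
      (biprod.snd ≫ biprod.fst : Gamma₁ M M' ⟶ _).f m y))
  obtain ⟨ζ₂, hζ₂⟩ := exists_comp_map_cofreeProj_eq (Sys.vecFunctor K σ) M' m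
    (show Cochain ((dRVecPart K σ).obj M) _ m from
      (biprod.snd ≫ biprod.snd : Gamma₁ M M' ⟶ _).f m y)
  -- The added terms factor through M → P with P = `cofree M' m`. The projection to M kills them, so
  -- it remains a morphism on the perturbed complex.
  let E := M ⊞ cofree M' m
  let θ₀ : (sigmaPart K σ).obj E ⟶ (zeroPart K σ).obj E :=
    (sigmaPart K σ).map biprod.fst ≫ ζ₀ ≫ (zeroPart K σ).map biprod.inr
  let θ₁ : (rigPart K σ).obj E ⟶ (vecPart K σ).obj E :=
    (rigPart K σ).map biprod.fst ≫ ζ₁ ≫ (vecPart K σ).map biprod.inr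
  let θ₂ : (dRVecPart K σ).obj E ⟶ (vecPart K σ).obj E :=
    (dRVecPart K σ).map biprod.fst ≫ ζ₂ ≫ (vecPart K σ).map biprod.inr
  let t : perturb E θ₀ θ₁ θ₂ ⟶ M := perturbDesc biprod.fst (comp_inr_comp_map_fst _ _ _)
    (comp_inr_comp_map_fst _ _ _) (comp_inr_comp_map_fst _ _ _)
  -- This z is strict for E; for the perturbed complex its components are merely an element q of Γ₀,
  -- and the defect ψ(q) is y pulled back to N.
  let z : Cochain E M' m := (Cochain.ofHom biprod.snd).comp (cofreeProj M' m) (zero_add m)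
  obtain ⟨q, hq₀, hq₁, hq₂⟩ := exists_triple
    (A := HomComplex ((zeroPart K σ).obj (perturb E θ₀ θ₁ θ₂)) ((zeroPart K σ).obj M'))
    (B := HomComplex ((vecPart K σ).obj (perturb E θ₀ θ₁ θ₂)) ((vecPart K σ).obj M'))
    (C := HomComplex ((dRPart K σ).obj (perturb E θ₀ θ₁ θ₂)) ((dRPart K σ).obj M'))
    (show Cochain ((zeroPart K σ).obj E) _ m from z.map (Sys.rigFunctor K σ))
    (show Cochain ((vecPart K σ).obj E) _ m from z.map (Sys.vecFunctor K σ))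
    (show Cochain ((dRPart K σ).obj E) _ m from z.map (Sys.dRFunctor K σ))
  refine ⟨perturb E θ₀ θ₁ θ₂, isHodgeComplex_perturb (isHodgeComplex_biprod_cofree hM hM' m), t,
    componentwiseEquiv_perturbDesc _ _ _ _ (.of_isIso _
      (isIso_quotient_map_biprod_fst M _ (exists_contraction_cofree M' m))), q, triple_ext ?_ ?_ ?_⟩
  · rw [psi_apply_fst, gamma₁_map_fst, hq₀]
    have e := comp_inr_comp_map_snd (M := M) (Sys.rigFunctor K σ) ((sigmaPart K σ).map (biprod.fst : E ⟶ M))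
      ζ₀ (cofreeProj M' m)
    rw [hζ₀, Cochain.comp_neg] at e
    exact (congrArg Neg.neg ((h₀_perturb z).trans e)).trans (neg_neg _)
  · rw [psi_apply_snd_fst, gamma₁_map_snd_fst, hq₀, hq₁]
    have e := comp_inr_comp_map_snd (M := M) (Sys.vecFunctor K σ) ((rigPart K σ).map (biprod.fst : E ⟶ M))
      ζ₁ (cofreeProj M' m)
    rw [hζ₁, Cochain.comp_neg] at e
    exact (h₁_sub_h₂_perturb z).trans ((congrArg Neg.neg e).trans (neg_neg _))
  · rw [psi_apply_snd_snd, gamma₁_map_snd_snd, hq₁, hq₂]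
    have e := comp_inr_comp_map_snd (M := M) (Sys.vecFunctor K σ) ((dRVecPart K σ).map (biprod.fst : E ⟶ M))
      ζ₂ (cofreeProj M' m)
    rw [hζ₂] at e
    exact (h₃_sub_h₄_perturb z).trans e

end Strict

/-! ### Representing classes by strict cocycles -/

section CocycleClasses

open CochainComplex HomComplex

variable {K₀ K : Type u} [Field K₀] [Field K] [Algebra K₀ K] {σ : K₀ →+* K₀}
  {M M' N N' : CochainComplex (Sys K σ) ℤ} {n : ℤ}

/-- The class in `H^n(Γ(M, M'))` of a cocycle of `Hom^•(M, M')`. -/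
def cocycleClass : Cocycle M M' n →+ (Gamma M M').homology n :=
  (HomologicalComplex.homologyMap (homToGamma M M') n).hom.comp
    ((homologyAddEquiv M M' n).symm.toAddMonoidHom.comp (CohomologyClass.mkAddMonoidHom M M' n))

lemma isClass_cocycleClass (z : Cocycle M M' n) :
    IsClass (cocycleClass z) ((homToGamma M M').f n (show (HomComplex M M').X n from z.1)) :=
  (isClass_homologyAddEquiv_symm z).map _

lemma homToGamma₀_map_apply (f : N ⟶ M) (g : M' ⟶ N') (z : Cochain M M' n) :
    (Gamma₀.map f g).f n ((homToGamma₀ M M').f n (show (HomComplex M M').X n from z)) =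
      (homToGamma₀ N N').f n (show (HomComplex N N').X n from
        ((Cochain.ofHom f).comp z (zero_add n)).comp (Cochain.ofHom g) (add_zero n)) :=
  ConcreteCategory.congr_hom (HomologicalComplex.congr_hom (homToGamma₀_map f g) n) z

lemma homologyMap_gamma_cocycleClass (f : N ⟶ M) (g : M' ⟶ N') (z : Cocycle M M' n) :
    HomologicalComplex.homologyMap (Gamma.map f g) n (cocycleClass z) =
      cocycleClass ((z.precomp f).postcomp g) := by
  refine ((isClass_cocycleClass z).map (Gamma.map f g)).eq ?_
  rw [homToGamma_eq_coneElt (n - 1) n (by omega), gamma_map_coneElt, homToGamma₀_map_apply, map_zero,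
    ← homToGamma_eq_coneElt]
  exact isClass_cocycleClass ((z.precomp f).postcomp g)

lemma gamma₀_map_psi_apply (f : N ⟶ M) (g : M' ⟶ N') (x : (Gamma₀ M M').X n) :
    (psi N N').f n ((Gamma₀.map f g).f n x) = (Gamma₁.map f g).f n ((psi M M').f n x) :=
  (ConcreteCategory.congr_hom (HomologicalComplex.congr_hom (psi_map f g) n) x).symm

lemma f_d_apply {C D : CochainComplex AddCommGrpCat.{u} ℤ} (f : C ⟶ D) (m n : ℤ) (x : C.X m) :
    f.f n (C.d m n x) = D.d m n (f.f m x) :=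
  (ConcreteCategory.congr_hom (f.comm m n) x).symm

lemma d_d_apply (C : CochainComplex AddCommGrpCat.{u} ℤ) (m n k : ℤ) (x : C.X m) :
    C.d n k (C.d m n x) = 0 :=
  ConcreteCategory.congr_hom (C.d_comp_d m n k) x

/-- An element of `Γ₀(M, M')` whose image by `ψ` is a coboundary becomes, after a componentwise
homotopy equivalence and up to a coboundary, compatible with all the structures. -/
lemma exists_strict (hM : isHodgeComplex K σ M) (hM' : isHodgeComplex K σ M') (m : ℤ)
    (x : (Gamma₀ M M').X n) (y : (Gamma₁ M M').X m)
    (h : -((Gamma₁ M M').d m n y) - (psi M M').f n x = 0) :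
    ∃ (N : CochainComplex (Sys K σ) ℤ) (_ : isHodgeComplex K σ N) (t : N ⟶ M)
      (_ : ComponentwiseEquiv t) (q : (Gamma₀ N M').X m) (z : Cochain N M' n),
      (psi N M').f m q = (Gamma₁.map t (𝟙 M')).f m y ∧
      (homToGamma₀ N M').f n (show (HomComplex N M').X n from z) =
        (Gamma₀.map t (𝟙 M')).f n x + (Gamma₀ N M').d m n q := by
  obtain ⟨N, hN, t, ht, q, hq⟩ := exists_psi_eq_gamma₁_map hM hM' m y
  -- Since ψ(x) = -dy and ψ(q) = y t, one gets ψ(x t + dq) = -d(y t) + d(y t) = 0.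
  obtain ⟨z, hz⟩ := exists_homToGamma₀_eq
    ((Gamma₀.map t (𝟙 M')).f n x + (Gamma₀ N M').d m n q) (by
      have h' : (psi M M').f n x = -((Gamma₁ M M').d m n y) := (sub_eq_zero.1 h).symm
      rw [map_add, gamma₀_map_psi_apply, f_d_apply, hq, h', map_neg, f_d_apply, neg_add_cancel])
  exact ⟨N, hN, t, ht, q, z, hq, hz⟩

/-- Every class becomes the class of a cocycle which is compatible with all the structures, after a
componentwise homotopy equivalence. -/
lemma exists_homologyMap_eq_cocycleClass (hM : isHodgeComplex K σ M) (hM' : isHodgeComplex K σ M')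
    (ξ : (Gamma M M').homology n) :
    ∃ (N : CochainComplex (Sys K σ) ℤ) (_ : isHodgeComplex K σ N) (t : N ⟶ M)
      (_ : ComponentwiseEquiv t) (z : Cocycle N M' n),
      HomologicalComplex.homologyMap (Gamma.map t (𝟙 M')) n ξ = cocycleClass z := by
  obtain ⟨w, hw⟩ := exists_isClass ξ
  obtain ⟨x, y, rfl⟩ := exists_coneElt (psi M M') (n - 1) n (by omega) w
  have hd := hw.d_eq_zero (n + 1)
  obtain ⟨hx, hy⟩ := (coneElt_eq_iff (psi M M') n (n + 1) rfl _ _ _ _).1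
    (((d_coneElt (psi M M') (n - 1) n (n + 1) (by omega) rfl x y).symm.trans hd).trans
      (coneElt_zero (psi M M') n (n + 1) rfl).symm)
  obtain ⟨N, hN, t, ht, q, z, hq, hz⟩ := exists_strict hM hM' (n - 1) x y hy
  have hδ : δ n (n + 1) z = 0 := by
    refine homToGamma₀_injective _ ((f_d_apply (homToGamma₀ N M') n (n + 1) z).trans ?_)
    refine (congrArg ((Gamma₀ N M').d n (n + 1)) hz).trans ?_
    rw [map_add, d_d_apply, add_zero, ← f_d_apply, hx, map_zero]
  refine ⟨N, hN, t, ht, Cocycle.mk z _ rfl hδ, ?_⟩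
  have h₁ := hw.map (Gamma.map t (𝟙 M'))
  have h₂ := isClass_cocycleClass (Cocycle.mk z _ rfl hδ)
  rw [gamma_map_coneElt] at h₁
  rw [homToGamma_eq_coneElt (n - 1) n (by omega)] at h₂
  refine (sub_eq_zero.1 (((h₂.sub h₁).eq_zero_iff (n - 1) (by omega)).2 ?_)).symm
  -- The difference of representatives is (z, 0) - (x t, y t) = (dq, -ψ(q)) = d(q, 0).
  refine ⟨coneElt (psi N M') (n - 1 - 1) (n - 1) (by omega) q 0, ?_⟩
  refine (d_coneElt (psi N M') (n - 1 - 1) (n - 1) n (by omega) (by omega) q 0).trans ?_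
  refine Eq.trans ?_ (coneElt_sub (psi N M') (n - 1) n (by omega) _ _ _ _).symm
  rw [coneElt_eq_iff, map_zero, neg_zero, hq]
  exact ⟨eq_sub_of_add_eq' hz.symm, rfl⟩

/-- A cocycle whose class vanishes becomes a coboundary after a componentwise homotopy
equivalence. -/
lemma exists_precomp_mem_coboundaries (hM : isHodgeComplex K σ M) (hM' : isHodgeComplex K σ M')
    (z : Cocycle M M' n) (hz : cocycleClass z = 0) :
    ∃ (N : CochainComplex (Sys K σ) ℤ) (_ : isHodgeComplex K σ N) (t : N ⟶ M)
      (_ : ComponentwiseEquiv t), z.precomp t ∈ coboundaries N M' n := by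
  obtain ⟨w, hw⟩ := ((isClass_cocycleClass z).eq_zero_iff (n - 1) (by omega)).1 hz
  obtain ⟨x, y, rfl⟩ := exists_coneElt (psi M M') (n - 1 - 1) (n - 1) (by omega) w
  obtain ⟨hx, hy⟩ := (coneElt_eq_iff (psi M M') (n - 1) n (by omega) _ _ _ _).1
    (((d_coneElt (psi M M') (n - 1 - 1) (n - 1) n (by omega) (by omega) x y).symm.trans hw).trans
      (homToGamma_eq_coneElt (n - 1) n (by omega) z.1))
  -- Here (z, 0) = d(x, y), and the correction is applied one degree lower: β = x t + dq is strict,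
  -- and δβ = d(x t) = z t.
  obtain ⟨N, hN, t, ht, q, β, hq, hβ⟩ := exists_strict hM hM' (n - 1 - 1) x y hy
  refine ⟨N, hN, t, ht, (mem_coboundaries_iff _ (n - 1) (by omega)).2 ⟨β, ?_⟩⟩
  rw [← sub_eq_zero]
  refine homToGamma₀_injective _ ?_
  refine (map_sub ((homToGamma₀ N M').f n).hom (show (HomComplex N M').X n from δ (n - 1) n β)
    (show (HomComplex N M').X n from (z.precomp t).1)).trans (sub_eq_zero.2 ?_)
  refine (f_d_apply (homToGamma₀ N M') (n - 1) n β).trans ?_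
  refine (congrArg ((Gamma₀ N M').d (n - 1) n) hβ).trans ?_
  rw [map_add, d_d_apply, add_zero, ← f_d_apply, hx]
  refine (homToGamma₀_map_apply t (𝟙 M') z.1).trans ?_
  rw [Cochain.comp_id]
  rfl

end CocycleClasses

/-! ### Additive localization and representability by fractions -/

section Localization

variable {C D : Type*} [Category* C] [Category* D] [Preadditive C]

/-- A preadditive structure on the opposite category induces one on the category. -/
@[reducible]
def preadditiveOfOp (_ : Preadditive Dᵒᵖ) : Preadditive D where
  homGroup X Y := (Quiver.Hom.opEquiv (X := X) (Y := Y)).addCommGroup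
  add_comp _ _ _ f f' g := Quiver.Hom.op_inj (Preadditive.comp_add _ _ _ g.op f.op f'.op)
  comp_add _ _ _ f g g' := Quiver.Hom.op_inj (Preadditive.add_comp _ _ _ g.op g'.op f.op)

/-- The localization of a preadditive category with respect to a class of morphisms which has a
right calculus of fractions is preadditive. -/
lemma exists_preadditive_localization (W : MorphismProperty C) [W.HasRightCalculusOfFractions] :
    ∃ _ : Preadditive W.Localization, W.Q.Additive := by
  -- The opposite category has a left calculus of fractions, and the additive structure is
  -- transported back from there.
  let P : Preadditive W.Localizationᵒᵖ := Localization.preadditive W.Q.op W.op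
  have h := Localization.functor_additive W.Q.op W.op
  let P' : Preadditive W.Localization := preadditiveOfOp P
  exact ⟨P', ⟨fun {X Y f g} => Quiver.Hom.op_inj (h.map_add (f := f.op) (g := g.op))⟩⟩

variable [Preadditive D]

open Opposite in
/-- A criterion for an additive functor which inverts `W` to become representable on the localized
category. -/
lemma exists_addEquiv_of_localization (L : C ⥤ D) [L.Additive] (W : MorphismProperty C)
    [L.IsLocalization W] [W.HasRightCalculusOfFractions] (G : Cᵒᵖ ⥤ AddCommGrpCat.{u}) [G.Additive]
    (hG : W.op.IsInvertedBy G) (X : C) (u : G.obj (op X))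
    (hsurj : ∀ (M : C) (ξ : G.obj (op M)), ∃ (N : C) (t : N ⟶ M) (_ : W t) (f : N ⟶ X),
      G.map t.op ξ = G.map f.op u)
    (hinj : ∀ (M : C) (f : M ⟶ X), G.map f.op u = 0 → ∃ (N : C) (t : N ⟶ M) (_ : W t), t ≫ f = 0) :
    ∃ e : ∀ M : C, (L.obj M ⟶ L.obj X) ≃+ G.obj (op M),
      (∀ (M : C) (f : M ⟶ X), e M (L.map f) = G.map f.op u) ∧
      ∀ (M N : C) (a : N ⟶ M) (x : L.obj M ⟶ L.obj X),
        e N (L.map a ≫ x) = G.map a.op (e M x) := by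
  let G' : Dᵒᵖ ⥤ AddCommGrpCat.{u} := Localization.lift G hG L.op
  let i : L.op ⋙ G' ≅ G := Localization.fac G hG L.op
  have : G'.Additive := (Localization.functor_additive_iff L.op W.op G').2
    (Functor.additive_of_iso i.symm)
  -- By Yoneda, u' determines the natural map x ↦ G'(x)(u'), which is additive in x because G' is.
  let u' := i.inv.app (op X) u
  let e₀ (M : C) : (L.obj M ⟶ L.obj X) →+ G.obj (op M) := AddMonoidHom.mk'
    (fun x => i.hom.app (op M) (G'.map x.op u')) (fun x y => by
      have e : G'.map (x + y).op = G'.map x.op + G'.map y.op := G'.map_add (f := x.op) (g := y.op)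
      rw [e]
      exact map_add (i.hom.app (op M)).hom _ _)
  have h₁ (M : C) (f : M ⟶ X) : e₀ M (L.map f) = G.map f.op u := by
    have e := ConcreteCategory.congr_hom (i.hom.naturality f.op) u'
    refine e.trans (congrArg (G.map f.op) ?_)
    exact ConcreteCategory.congr_hom (i.inv_hom_id_app (op X)) u
  have h₂ (M N : C) (a : N ⟶ M) (x : L.obj M ⟶ L.obj X) :
      e₀ N (L.map a ≫ x) = G.map a.op (e₀ M x) := by
    have e := ConcreteCategory.congr_hom (i.hom.naturality a.op) (G'.map x.op u')
    refine Eq.trans ?_ e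
    exact congrArg (i.hom.app (op N))
      (ConcreteCategory.congr_hom (G'.map_comp x.op (L.map a).op) u')
  have hW {N M : C} (t : N ⟶ M) (ht : W t) : Function.Injective (G.map t.op) := by
    have := hG t.op ht
    exact ((forget AddCommGrpCat).mapIso (asIso (G.map t.op))).toEquiv.injective
  refine ⟨fun M => AddEquiv.ofBijective (e₀ M) ⟨?_, fun ξ => ?_⟩, h₁, h₂⟩
  · rw [injective_iff_map_eq_zero]
    -- Write x as a right fraction with numerator f and denominator s. If x goes to 0 then so does L
    -- f, hence G(f)(u) = 0, some t in W satisfies t ≫ f = 0, and L f = 0.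
    intro x hx
    obtain ⟨φ, rfl⟩ := Localization.exists_rightFraction L W x
    have := Localization.inverts L W φ.s φ.hs
    have h₃ := h₂ _ _ φ.s (φ.map L (Localization.inverts L W))
    rw [hx, map_zero, MorphismProperty.RightFraction.map_s_comp_map, h₁] at h₃
    obtain ⟨N, t, ht, h₄⟩ := hinj _ _ h₃
    have h₅ : L.map φ.f = 0 := by
      have := Localization.inverts L W t ht
      rw [← cancel_epi (L.map t), comp_zero, ← L.map_comp, h₄, L.map_zero]
    rw [← cancel_epi (L.map φ.s), comp_zero, MorphismProperty.RightFraction.map_s_comp_map, h₅]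
  · obtain ⟨N, t, ht, f, hf⟩ := hsurj M ξ
    have := Localization.inverts L W t ht
    refine ⟨inv (L.map t) ≫ L.map f, hW t ht ?_⟩
    rw [← h₂, IsIso.hom_inv_id_assoc, h₁, hf]

end Localization

/-! ### Passage between pHC and pHK -/

section HodgeCategories

open CochainComplex HomComplex

variable {K₀ K : Type u} [Field K₀] [Field K] [Algebra K₀ K] {σ : K₀ →+* K₀}

instance : (toHK K σ).Full where
  map_surjective f := by
    obtain ⟨g, hg⟩ := (HomotopyCategory.quotient (Sys K σ) (ComplexShape.up ℤ)).map_surjective f.hom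
    exact ⟨ObjectProperty.homMk g, ObjectProperty.hom_ext _ hg⟩

instance : (toHK K σ).Additive where
  map_add := rfl

lemma toHK_obj_surjective (X : pHK K σ) : ∃ M : pHC K σ, (toHK K σ).obj M = X :=
  ⟨⟨X.obj.as, X.property⟩, rfl⟩

lemma toHK_map_eq_zero_iff {M N : pHC K σ} (f : M ⟶ N) :
    (toHK K σ).map f = 0 ↔ Nonempty (Homotopy f.hom 0) := by
  rw [← HomotopyCategory.quotient_map_eq_zero_iff]
  exact ⟨fun h => congrArg (fun g : (toHK K σ).obj M ⟶ (toHK K σ).obj N => g.hom) h,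
    fun h => ObjectProperty.hom_ext _ h⟩

lemma toHK_map_eq_zero_iff_mem_coboundaries {M N : pHC K σ} (f : M ⟶ N) :
    (toHK K σ).map f = 0 ↔ Cocycle.ofHom f.hom ∈ coboundaries M.obj N.obj 0 := by
  rw [toHK_map_eq_zero_iff, mem_coboundaries_iff _ (-1) (neg_add_cancel 1)]
  refine ⟨fun ⟨h⟩ => ⟨(Cochain.equivHomotopy _ _ h).1, ?_⟩,
    fun ⟨β, hβ⟩ => ⟨(Cochain.equivHomotopy _ _).symm ⟨β, ?_⟩⟩⟩
  · have := (Cochain.equivHomotopy _ _ h).2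
    exact (this.trans ((congrArg _ (Cochain.ofHom_zero _ _)).trans (add_zero _))).symm
  · rw [Cochain.ofHom_zero, add_zero]
    exact hβ.symm

lemma cocycleClass_eq_zero_of_mem_coboundaries {M N : CochainComplex (Sys K σ) ℤ} {n : ℤ}
    (z : Cocycle M N n) (hz : z ∈ coboundaries M N n) : cocycleClass z = 0 := by
  have h : (homologyAddEquiv M N n).symm (CohomologyClass.mk z) = 0 := by
    rw [(CohomologyClass.mk_eq_zero_iff z).2 hz, map_zero]
  exact (congrArg (HomologicalComplex.homologyMap (homToGamma M N) n) h).trans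
    (map_zero (HomologicalComplex.homologyMap (homToGamma M N) n).hom)

instance : (quasiIso K σ).IsMultiplicative where
  id_mem X := by
    obtain ⟨M, rfl⟩ := toHK_obj_surjective X
    rw [← (toHK K σ).map_id, quasiIso_toHK_map_iff]
    exact componentwiseEquiv_id M.obj
  comp_mem f g hf hg := by
    refine ⟨?_, ?_, fun i => ?_⟩
    · intro n
      have := hf.1 n
      have := hg.1 n
      rw [Functor.map_comp, Functor.map_comp]
      infer_instance
    · intro n
      have := hf.2.1 n
      have := hg.2.1 n
      rw [Functor.map_comp, Functor.map_comp]
      infer_instance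
    · intro n
      have := hf.2.2 i n
      have := hg.2.2 i n
      rw [Functor.map_comp, Functor.map_comp]
      infer_instance

lemma homologyMap_gamma_ofHom_post {X Y Z : CochainComplex (Sys K σ) ℤ} (f : X ⟶ Y) (s : Y ⟶ Z) :
    HomologicalComplex.homologyMap (Gamma.map (𝟙 X) s) 0 (cocycleClass (Cocycle.ofHom f)) =
      cocycleClass (Cocycle.ofHom (f ≫ s)) := by
  rw [homologyMap_gamma_cocycleClass]
  congr 1
  ext1
  simp

/-- A morphism of `p`-adic Hodge complexes whose class vanishes is homotopic to zero after a
quasi-isomorphism. -/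
lemma exists_quasiIso_comp_eq_zero {M N : pHC K σ} (f : M ⟶ N)
    (hf : cocycleClass (Cocycle.ofHom f.hom) = 0) :
    ∃ (L : pHC K σ) (t : L ⟶ M) (_ : quasiIso K σ ((toHK K σ).map t)),
      (toHK K σ).map t ≫ (toHK K σ).map f = 0 := by
  obtain ⟨L, hL, t, ht, h⟩ := exists_precomp_mem_coboundaries M.property N.property _ hf
  refine ⟨⟨L, hL⟩, ObjectProperty.homMk t, (quasiIso_toHK_map_iff _).2 ht, ?_⟩
  rw [← Functor.map_comp, toHK_map_eq_zero_iff_mem_coboundaries]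
  convert h using 1
  ext1
  simp

lemma bijective_homologyMap_gamma {M M' N N' : CochainComplex (Sys K σ) ℤ} (f : N ⟶ M)
    (g : M' ⟶ N') (hf : ComponentwiseEquiv f) (hg : ComponentwiseEquiv g) (n : ℤ) :
    Function.Bijective (HomologicalComplex.homologyMap (Gamma.map f g) n) := by
  have := isIso_homologyMap_gamma f g hf hg n
  exact ((forget AddCommGrpCat).mapIso
    (asIso (HomologicalComplex.homologyMap (Gamma.map f g) n))).toEquiv.bijective

end HodgeCategories

/-! ### Right calculus of fractions on pHK -/

section Calculus

open CochainComplex HomComplex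

variable {K₀ K : Type u} [Field K₀] [Field K] [Algebra K₀ K] {σ : K₀ →+* K₀}

lemma homologyMap_gamma_comp_apply {M M' N N' P P' : CochainComplex (Sys K σ) ℤ} (f : N ⟶ M)
    (g : M' ⟶ N') (f' : P ⟶ N) (g' : N' ⟶ P') (n : ℤ) (ξ : (Gamma M M').homology n) :
    HomologicalComplex.homologyMap (Gamma.map f' g') n
      (HomologicalComplex.homologyMap (Gamma.map f g) n ξ) =
      HomologicalComplex.homologyMap (Gamma.map (f' ≫ f) (g ≫ g')) n ξ := by
  rw [gamma_map_comp, HomologicalComplex.homologyMap_comp]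
  rfl

lemma homologyMap_gamma_ofHom_pre {X Y Z : CochainComplex (Sys K σ) ℤ} (t : X ⟶ Y) (f : Y ⟶ Z) :
    HomologicalComplex.homologyMap (Gamma.map t (𝟙 Z)) 0 (cocycleClass (Cocycle.ofHom f)) =
      cocycleClass (Cocycle.ofHom (t ≫ f)) := by
  rw [homologyMap_gamma_cocycleClass]
  congr 1
  ext1
  simp

lemma cocycle_ofHom_sub {X Y : CochainComplex (Sys K σ) ℤ} (f g : X ⟶ Y) :
    Cocycle.ofHom (f - g) = Cocycle.ofHom f - Cocycle.ofHom g := by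
  ext1
  simp

/-- No triangulated structure on pHK enters; everything is read on H⁰Γ, on which s acts bijectively.
For the Ore condition, the class of f lifts along s to some ξ, which a quasi-isomorphism t turns
into the class of a genuine morphism g. Then g ≫ s and t ≫ f have the same class, so they agree in
pHK after a further quasi-isomorphism. For cancellation, a morphism killed by s has class zero, so a
quasi-isomorphism kills it on the other side. -/
instance : (quasiIso K σ).HasRightCalculusOfFractions where
  exists_rightFraction X Y φ := by
    obtain ⟨f, s, hs⟩ := φ
    rename_i Y'
    obtain ⟨M, rfl⟩ := toHK_obj_surjective X
    obtain ⟨N, rfl⟩ := toHK_obj_surjective Y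
    obtain ⟨N', rfl⟩ := toHK_obj_surjective Y'
    obtain ⟨f, rfl⟩ := (toHK K σ).map_surjective f
    obtain ⟨s, rfl⟩ := (toHK K σ).map_surjective s
    obtain ⟨ξ, hξ⟩ := (bijective_homologyMap_gamma (𝟙 M.obj) s.hom (componentwiseEquiv_id _)
      ((quasiIso_toHK_map_iff _).1 hs) 0).2 (cocycleClass (Cocycle.ofHom f.hom))
    obtain ⟨L, hL, t, ht, z, hz⟩ := exists_homologyMap_eq_cocycleClass M.property N.property ξ
    obtain ⟨g, rfl⟩ : ∃ g : L ⟶ N.obj, Cocycle.ofHom g = z :=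
      ⟨Cocycle.homOf z, Cocycle.ofHom_homOf_eq_self z⟩
    let L' : pHC K σ := ⟨L, hL⟩
    let t' : L' ⟶ M := ObjectProperty.homMk t
    let g' : L' ⟶ N := ObjectProperty.homMk g
    have key : cocycleClass (Cocycle.ofHom (g' ≫ s - t' ≫ f).hom) = 0 := by
      have e : cocycleClass (Cocycle.ofHom (g ≫ s.hom)) =
          cocycleClass (Cocycle.ofHom (t ≫ f.hom)) := by
        rw [← homologyMap_gamma_ofHom_post, ← homologyMap_gamma_ofHom_pre, ← hz, ← hξ,
          homologyMap_gamma_comp_apply, homologyMap_gamma_comp_apply, Category.id_comp,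
          Category.id_comp, Category.comp_id, Category.comp_id]
      refine (congrArg cocycleClass (cocycle_ofHom_sub (g ≫ s.hom) (t ≫ f.hom))).trans ?_
      rw [map_sub, e, sub_self]
    obtain ⟨P, r, hr, hr'⟩ := exists_quasiIso_comp_eq_zero _ key
    refine ⟨⟨(toHK K σ).map r ≫ (toHK K σ).map t', (quasiIso K σ).comp_mem _ _ hr
      ((quasiIso_toHK_map_iff _).2 ht), (toHK K σ).map r ≫ (toHK K σ).map g'⟩, ?_⟩
    rw [Functor.map_sub, Functor.map_comp, Functor.map_comp, Preadditive.comp_sub,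
      sub_eq_zero] at hr'
    rw [Category.assoc, Category.assoc]
    exact hr'.symm
  ext X Y Y' f₁ f₂ s hs h := by
    obtain ⟨M, rfl⟩ := toHK_obj_surjective X
    obtain ⟨N, rfl⟩ := toHK_obj_surjective Y
    obtain ⟨N', rfl⟩ := toHK_obj_surjective Y'
    obtain ⟨f, hf⟩ := (toHK K σ).map_surjective (f₁ - f₂)
    obtain ⟨s, rfl⟩ := (toHK K σ).map_surjective s
    have h' : (toHK K σ).map (f ≫ s) = 0 := by
      rw [Functor.map_comp, hf, Preadditive.sub_comp, h, sub_self]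
    have hfs := cocycleClass_eq_zero_of_mem_coboundaries _
      ((toHK_map_eq_zero_iff_mem_coboundaries _).1 h')
    obtain ⟨P, r, hr, hr'⟩ := exists_quasiIso_comp_eq_zero f
      ((bijective_homologyMap_gamma (𝟙 M.obj) s.hom (componentwiseEquiv_id _)
        ((quasiIso_toHK_map_iff _).1 hs) 0).1
        (((homologyMap_gamma_ofHom_post f.hom s.hom).trans hfs).trans (map_zero
          (HomologicalComplex.homologyMap (Gamma.map (𝟙 M.obj) s.hom) 0).hom).symm))
    refine ⟨_, (toHK K σ).map r, hr, ?_⟩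
    rw [hf, Preadditive.comp_sub, sub_eq_zero] at hr'
    exact hr'

end Calculus

/-! ### Hⁿ(Γ(-, M')) as an additive functor inverting quasi-isomorphisms -/

section GammaFunctor

open CochainComplex HomComplex Opposite

variable {K₀ K : Type u} [Field K₀] [Field K] [Algebra K₀ K] {σ : K₀ →+* K₀}

/-- The functor `M ↦ H^n(Γ(M, M'))` on complexes of systems. -/
def gammaCochain (n : ℤ) (M' : CochainComplex (Sys K σ) ℤ) :
    CochainComplex (Sys K σ) ℤ ⥤ AddCommGrpCat.{u}ᵒᵖ where
  obj M := op ((Gamma M M').homology n)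
  map f := (HomologicalComplex.homologyMap (Gamma.map f (𝟙 M')) n).op
  map_id M := by
    rw [gamma_map_id, HomologicalComplex.homologyMap_id, op_id]
  map_comp f g := by
    rw [← op_comp, ← HomologicalComplex.homologyMap_comp, ← gamma_map_comp, Category.comp_id]

lemma gammaCochain_map_eq (n : ℤ) (M' : CochainComplex (Sys K σ) ℤ)
    {M N : CochainComplex (Sys K σ) ℤ} {f g : M ⟶ N} (h : Homotopy f g) :
    (gammaCochain n M').map f = (gammaCochain n M').map g := by
  -- A functor that inverts homotopy equivalences identifies homotopic morphisms, so no homotopy on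
  -- Γ has to be written down. The first argument says that each degree j has the predecessor j - 1.
  refine h.map_eq_of_inverts_homotopyEquivalences (fun j => ⟨j - 1, by simp⟩) _ ?_
  intro X Y φ hφ
  have := isIso_homologyMap_gamma φ (𝟙 M') (.of_isIso _
    (HomotopyCategory.quotient_inverts_homotopyEquivalences _ _ φ hφ)) (componentwiseEquiv_id _) n
  exact inferInstanceAs (IsIso (HomologicalComplex.homologyMap (Gamma.map φ (𝟙 M')) n).op)

/-- The functor `M ↦ H^n(Γ(M, M'))` on `p`-adic Hodge complexes modulo homotopy. -/
def gammaFunctor (n : ℤ) (M' : CochainComplex (Sys K σ) ℤ) : (pHK K σ)ᵒᵖ ⥤ AddCommGrpCat.{u} :=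
  (ObjectProperty.ι _ ⋙ (CategoryTheory.Quotient.lift _ (gammaCochain n M')
    (fun _ _ _ _ ⟨h⟩ => gammaCochain_map_eq n M' h) :
      HomotopyCategory (Sys K σ) (ComplexShape.up ℤ) ⥤ AddCommGrpCat.{u}ᵒᵖ)).leftOp

lemma gammaFunctor_map (n : ℤ) (M' : CochainComplex (Sys K σ) ℤ) {M N : pHC K σ} (f : M ⟶ N) :
    (gammaFunctor n M').map ((toHK K σ).map f).op =
      HomologicalComplex.homologyMap (Gamma.map f.hom (𝟙 M')) n := rfl

lemma biprod_map_add {B : Type*} [Category* B] [Preadditive B] [HasBinaryBiproducts B]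
    {X Y X' Y' : B} (a a' : X ⟶ X') (b b' : Y ⟶ Y') :
    biprod.map (a + a') (b + b') = biprod.map a b + biprod.map a' b' := by
  ext <;> simp

variable {M M' N N' : CochainComplex (Sys K σ) ℤ}

lemma gamma₀_map_add (f f' : N ⟶ M) (g : M' ⟶ N') :
    Gamma₀.map (f + f') g = Gamma₀.map f g + Gamma₀.map f' g := by
  simp only [Gamma₀.map, Functor.map_add, homPre_add, Preadditive.add_comp, biprod_map_add]

lemma gamma₁_map_add (f f' : N ⟶ M) (g : M' ⟶ N') :
    Gamma₁.map (f + f') g = Gamma₁.map f g + Gamma₁.map f' g := by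
  simp only [Gamma₁.map, Functor.map_add, homPre_add, Preadditive.add_comp, biprod_map_add]

lemma coneElt_add {C D : CochainComplex AddCommGrpCat.{u} ℤ} (ψ : C ⟶ D) (m n : ℤ) (h : m + 1 = n)
    (x x' : C.X n) (y y' : D.X m) :
    coneElt ψ m n h x y + coneElt ψ m n h x' y' = coneElt ψ m n h (x + x') (y + y') := by
  rw [coneElt, coneElt, coneElt, map_add, map_add]
  abel

lemma homologyMap_gamma_add (f f' : N ⟶ M) (g : M' ⟶ N') (n : ℤ) :
    HomologicalComplex.homologyMap (Gamma.map (f + f') g) n =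
      HomologicalComplex.homologyMap (Gamma.map f g) n +
        HomologicalComplex.homologyMap (Gamma.map f' g) n := by
  ext ξ
  obtain ⟨w, hw⟩ := exists_isClass ξ
  obtain ⟨x, y, rfl⟩ := exists_coneElt (psi M M') (n - 1) n (by omega) w
  refine (hw.map (Gamma.map (f + f') g)).eq ?_
  have h := (hw.map (Gamma.map f g)).add (hw.map (Gamma.map f' g))
  refine Eq.subst (motive := IsClass _) ?_ h
  rw [gamma_map_coneElt, gamma_map_coneElt, gamma_map_coneElt, gamma₀_map_add, gamma₁_map_add]
  exact coneElt_add (psi N N') (n - 1) n _ _ _ _ _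

instance (n : ℤ) (M' : CochainComplex (Sys K σ) ℤ) : (gammaFunctor n M').Additive where
  map_add {X Y f g} := by
    obtain ⟨X⟩ := X
    obtain ⟨Y⟩ := Y
    obtain ⟨M, rfl⟩ := toHK_obj_surjective X
    obtain ⟨N, rfl⟩ := toHK_obj_surjective Y
    obtain ⟨f, rfl⟩ : ∃ h, f = Quiver.Hom.op h := ⟨f.unop, rfl⟩
    obtain ⟨g, rfl⟩ : ∃ h, g = Quiver.Hom.op h := ⟨g.unop, rfl⟩
    obtain ⟨f, rfl⟩ := (toHK K σ).map_surjective f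
    obtain ⟨g, rfl⟩ := (toHK K σ).map_surjective g
    rw [← op_add, ← Functor.map_add, gammaFunctor_map, gammaFunctor_map, gammaFunctor_map]
    exact homologyMap_gamma_add f.hom g.hom (𝟙 M') n

lemma isInvertedBy_gammaFunctor (n : ℤ) (M' : CochainComplex (Sys K σ) ℤ) :
    (quasiIso K σ).op.IsInvertedBy (gammaFunctor n M') := by
  intro X Y f hf
  obtain ⟨X⟩ := X
  obtain ⟨Y⟩ := Y
  obtain ⟨M, rfl⟩ := toHK_obj_surjective X
  obtain ⟨N, rfl⟩ := toHK_obj_surjective Y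
  obtain ⟨f, rfl⟩ : ∃ h, f = Quiver.Hom.op h := ⟨f.unop, rfl⟩
  obtain ⟨f, rfl⟩ := (toHK K σ).map_surjective f
  rw [gammaFunctor_map]
  exact isIso_homologyMap_gamma _ _ ((quasiIso_toHK_map_iff f).1 hf) (componentwiseEquiv_id _) n

end GammaFunctor

/-! ### Hom groups in pHD -/

section Main

open CochainComplex HomComplex Opposite

variable {K₀ K : Type u} [Field K₀] [Field K] [Algebra K₀ K] {σ : K₀ →+* K₀}

lemma homClass_eq_cocycleClass {M M' : CochainComplex (Sys K σ) ℤ} {n : ℤ} (f : M ⟶ M'⟦n⟧) :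
    homClass f = cocycleClass (Cocycle.equivHomShift f) := rfl

lemma homologyMap_gamma_homClass_pre {M M' N : CochainComplex (Sys K σ) ℤ} {n : ℤ} (t : N ⟶ M)
    (f : M ⟶ M'⟦n⟧) :
    HomologicalComplex.homologyMap (Gamma.map t (𝟙 M')) n (homClass f) = homClass (t ≫ f) := by
  rw [homClass_eq_cocycleClass, homClass_eq_cocycleClass, homologyMap_gamma_cocycleClass,
    Cocycle.equivHomShift_comp]
  congr 1
  ext1
  simp

lemma homologyMap_gamma_homClass_post {M M' N' : CochainComplex (Sys K σ) ℤ} {n : ℤ}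
    (f : M ⟶ M'⟦n⟧) (g : M' ⟶ N') :
    HomologicalComplex.homologyMap (Gamma.map (𝟙 M) g) n (homClass f) = homClass (f ≫ g⟦n⟧') := by
  rw [homClass_eq_cocycleClass, homClass_eq_cocycleClass, homologyMap_gamma_cocycleClass,
    Cocycle.equivHomShift_comp_shift]
  congr 1
  ext1
  simp

lemma toHK_map_shift_eq_zero_of_mem_coboundaries {M M' : pHC K σ} {n : ℤ}
    (f : M ⟶ (shift K σ n).obj M')
    (hf : Cocycle.equivHomShift (show M.obj ⟶ M'.obj⟦n⟧ from f.hom) ∈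
      coboundaries M.obj M'.obj n) : (toHK K σ).map f = 0 := by
  have h := (CohomologyClass.toHom_mk_eq_zero_iff _).2 hf
  rw [CohomologyClass.toHom_mk, AddEquiv.symm_apply_apply] at h
  exact ObjectProperty.hom_ext _ h

lemma homologyMap_gamma_homClass_id {n : ℤ} {M' M : pHC K σ} (f : M ⟶ (shift K σ n).obj M') :
    HomologicalComplex.homologyMap (Gamma.map f.hom (𝟙 M'.obj)) n
      (show (Gamma (M'.obj⟦n⟧) M'.obj).homology n from homClass (𝟙 (M'.obj⟦n⟧))) =
        homClass f.hom :=
  (homologyMap_gamma_homClass_pre f.hom (𝟙 (M'.obj⟦n⟧))).trans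
    (congrArg homClass (Category.comp_id _))

lemma exists_homologyMap_eq_homClass {n : ℤ} {M M' : pHC K σ}
    (ξ : (Gamma M.obj M'.obj).homology n) :
    ∃ (N : pHC K σ) (t : N ⟶ M) (_ : ComponentwiseEquiv t.hom) (f : N ⟶ (shift K σ n).obj M'),
      HomologicalComplex.homologyMap (Gamma.map t.hom (𝟙 M'.obj)) n ξ = homClass f.hom := by
  obtain ⟨N, hN, t, ht, z, hz⟩ := exists_homologyMap_eq_cocycleClass M.property M'.property ξ
  refine ⟨⟨N, hN⟩, ObjectProperty.homMk t, ht,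
    ObjectProperty.homMk (Cocycle.equivHomShift.symm z), hz.trans ?_⟩
  exact congrArg cocycleClass (Cocycle.equivHomShift.apply_symm_apply z).symm

lemma exists_toHK_map_comp_eq_zero {n : ℤ} {M M' : pHC K σ} (f : M ⟶ (shift K σ n).obj M')
    (hf : homClass (show M.obj ⟶ M'.obj⟦n⟧ from f.hom) = 0) :
    ∃ (N : pHC K σ) (t : N ⟶ M) (_ : ComponentwiseEquiv t.hom),
      (toHK K σ).map t ≫ (toHK K σ).map f = 0 := by
  obtain ⟨N, hN, t, ht, h⟩ := exists_precomp_mem_coboundaries M.property M'.property _ hf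
  refine ⟨⟨N, hN⟩, ObjectProperty.homMk t, ht, ((toHK K σ).map_comp _ _).symm.trans ?_⟩
  refine toHK_map_shift_eq_zero_of_mem_coboundaries _ ?_
  have e := Cocycle.equivHomShift_comp (n := n) t (show M.obj ⟶ M'.obj⟦n⟧ from f.hom)
  exact Eq.subst (motive := fun z => z ∈ coboundaries N M'.obj n) e.symm h

/-- Hom groups in `pHD` are computed by the complexes `Γ(M, M')`. -/
lemma exists_addEquiv_homology_gamma [Preadditive (pHD K σ)] [(quasiIso K σ).Q.Additive] (n : ℤ)
    (M' : pHC K σ) :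
    ∃ e : ∀ M : pHC K σ, ((toHD K σ).obj M ⟶ (toHD K σ).obj ((shift K σ n).obj M')) ≃+
        (Gamma M.obj M'.obj).homology n,
      (∀ (M : pHC K σ) (f : M ⟶ (shift K σ n).obj M'),
        e M ((toHD K σ).map f) = homClass f.hom) ∧
      ∀ (M N : pHC K σ) (a : N ⟶ M)
        (x : (toHD K σ).obj M ⟶ (toHD K σ).obj ((shift K σ n).obj M')),
        e N ((toHD K σ).map a ≫ x) =
          HomologicalComplex.homologyMap (Gamma.map a.hom (𝟙 M'.obj)) n (e M x) := by
  -- The universal element is the class of the identity of M'[n] in Hⁿ(Γ(M'[n], M')); its pullback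
  -- along f is the class of f.
  obtain ⟨e, he, he'⟩ := exists_addEquiv_of_localization (quasiIso K σ).Q (quasiIso K σ)
    (gammaFunctor n M'.obj) (isInvertedBy_gammaFunctor n M'.obj)
    ((toHK K σ).obj ((shift K σ n).obj M')) (homClass (𝟙 (M'.obj⟦n⟧))) (fun X ξ => by
      obtain ⟨M, rfl⟩ := toHK_obj_surjective X
      obtain ⟨N, t, ht, f, hf⟩ := exists_homologyMap_eq_homClass (M := M) (M' := M') (n := n) ξ
      exact ⟨_, (toHK K σ).map t, (quasiIso_toHK_map_iff _).2 ht, (toHK K σ).map f,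
        hf.trans (homologyMap_gamma_homClass_id f).symm⟩)
    (fun X f hf => by
      obtain ⟨M, rfl⟩ := toHK_obj_surjective X
      obtain ⟨f, rfl⟩ := (toHK K σ).map_surjective f
      obtain ⟨N, t, ht, h⟩ := exists_toHK_map_comp_eq_zero f
        ((homologyMap_gamma_homClass_id f).symm.trans hf)
      exact ⟨_, (toHK K σ).map t, (quasiIso_toHK_map_iff _).2 ht, h⟩)
  exact ⟨fun M => e ((toHK K σ).obj M),
    fun M f => (he _ _).trans (homologyMap_gamma_homClass_id f),
    fun M N a x => he' _ _ ((toHK K σ).map a) x⟩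

/-- Clearing the denominator of a right fraction reduces identities in pHD to identities between
genuine morphisms. -/
lemma exists_toHD_comp_eq (M X : pHC K σ) (x : (toHD K σ).obj M ⟶ (toHD K σ).obj X) :
    ∃ (N : pHC K σ) (t : N ⟶ M) (_ : ComponentwiseEquiv t.hom) (f : N ⟶ X),
      (toHD K σ).map t ≫ x = (toHD K σ).map f := by
  obtain ⟨φ, hφ⟩ := Localization.exists_rightFraction (quasiIso K σ).Q (quasiIso K σ)
    (X := (toHK K σ).obj M) (Y := (toHK K σ).obj X) x
  have h := φ.map_s_comp_map (quasiIso K σ).Q (Localization.inverts _ _)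
  rw [← hφ] at h
  have hs := φ.hs
  generalize φ.s = s at h hs
  generalize φ.f = f at h
  generalize φ.X' = Z at s f h hs
  obtain ⟨N, rfl⟩ := toHK_obj_surjective Z
  obtain ⟨t, rfl⟩ := (toHK K σ).map_surjective s
  obtain ⟨f, rfl⟩ := (toHK K σ).map_surjective f
  exact ⟨N, t, (quasiIso_toHK_map_iff t).1 hs, f, h⟩

/-- The isomorphisms of Hom groups in `pHD` with `Hⁿ(Γ(M, M'))`, functorial in both variables. -/
lemma exists_natural_addEquiv_homology_gamma [Preadditive (pHD K σ)]
    [(quasiIso K σ).Q.Additive] :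
    ∃ e : ∀ (n : ℤ) (M M' : pHC K σ),
        ((toHD K σ).obj M ⟶ (toHD K σ).obj ((shift K σ n).obj M')) ≃+
          (Gamma M.obj M'.obj).homology n,
      (∀ (n : ℤ) (M M' N N' : pHC K σ) (f : N ⟶ M) (g : M' ⟶ N')
        (x : (toHD K σ).obj M ⟶ (toHD K σ).obj ((shift K σ n).obj M')),
        e n N N' ((toHD K σ).map f ≫ x ≫ (toHD K σ).map ((shift K σ n).map g)) =
          HomologicalComplex.homologyMap (Gamma.map f.hom g.hom) n (e n M M' x)) ∧
      ∀ (n : ℤ) (M M' : pHC K σ) (f : M ⟶ (shift K σ n).obj M'),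
        e n M M' ((toHD K σ).map f) = homClass f.hom := by
  choose e he he' using
    fun (n : ℤ) (M' : pHC K σ) => exists_addEquiv_homology_gamma n M'
  -- Naturality in M' is not part of the Yoneda construction. Pullback along t is injective on
  -- Hⁿ(Γ), and after it x is the image of a morphism of pHC, for which both sides are explicit
  -- classes.
  have h (n : ℤ) (M M' N' : pHC K σ) (g : M' ⟶ N')
      (x : (toHD K σ).obj M ⟶ (toHD K σ).obj ((shift K σ n).obj M')) :
      e n N' M (x ≫ (toHD K σ).map ((shift K σ n).map g)) =
        HomologicalComplex.homologyMap (Gamma.map (𝟙 M.obj) g.hom) n (e n M' M x) := by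
    obtain ⟨P, t, ht, f, hf⟩ := exists_toHD_comp_eq _ _ x
    refine (bijective_homologyMap_gamma t.hom (𝟙 N'.obj) ht (componentwiseEquiv_id _) n).1 ?_
    have h₁ : (toHD K σ).map t ≫ x ≫ (toHD K σ).map ((shift K σ n).map g) =
        (toHD K σ).map (f ≫ (shift K σ n).map g) := by
      rw [reassoc_of% hf, Functor.map_comp]
    have h₂ : HomologicalComplex.homologyMap (Gamma.map (𝟙 P.obj) g.hom) n
        (HomologicalComplex.homologyMap (Gamma.map t.hom (𝟙 M'.obj)) n (e n M' M x)) =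
          HomologicalComplex.homologyMap (Gamma.map t.hom (𝟙 N'.obj)) n
            (HomologicalComplex.homologyMap (Gamma.map (𝟙 M.obj) g.hom) n (e n M' M x)) := by
      rw [homologyMap_gamma_comp_apply, homologyMap_gamma_comp_apply, Category.comp_id,
        Category.comp_id, Category.id_comp, Category.id_comp]
    refine Eq.trans ?_ h₂
    rw [← he', ← he', h₁, hf, he, he]
    exact (homologyMap_gamma_homClass_post f.hom g.hom).symm
  refine ⟨fun n M M' => e n M' M, fun n M M' N N' f g x => ?_, fun n M M' f => he n M' M f⟩
  refine (he' n N' _ _ f _).trans ?_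
  rw [h, homologyMap_gamma_comp_apply, Category.comp_id, Category.comp_id]

lemma cochain_eq_zero {A : Type*} [Category* A] [Preadditive A] {X Y : CochainComplex A ℤ}
    (hX : ∀ i : ℤ, i ≠ 0 → IsZero (X.X i)) (hY : ∀ i : ℤ, i ≠ 0 → IsZero (Y.X i)) {n : ℤ}
    (hn : n ≠ 0) (z : Cochain X Y n) : z = 0 := by
  refine Cochain.ext _ _ fun p q hpq => ?_
  by_cases hp : p = 0
  · exact (hY q (by omega)).eq_of_tgt _ _
  · exact (hX p hp).eq_of_src _ _

lemma isZero_cx_obj {A B : Type*} [Category* A] [Preadditive A] [Category* B] [Preadditive B]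
    (Φ : A ⥤ B) [Φ.Additive] {X : CochainComplex A ℤ}
    (hX : ∀ i : ℤ, i ≠ 0 → IsZero (X.X i)) (i : ℤ) (hi : i ≠ 0) : IsZero (((cx Φ).obj X).X i) :=
  Φ.map_isZero (hX i hi)

lemma isZero_homology_gamma {M M' : CochainComplex (Sys K σ) ℤ}
    (hM : ∀ i : ℤ, i ≠ 0 → IsZero (M.X i)) (hM' : ∀ i : ℤ, i ≠ 0 → IsZero (M'.X i)) {n : ℤ}
    (hn : 2 ≤ n ∨ n < 0) : IsZero ((Gamma M M').homology n) := by
  have h : ∀ ξ : (Gamma M M').homology n, ξ = 0 := fun ξ => by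
    obtain ⟨w, hw⟩ := exists_isClass ξ
    obtain ⟨x, y, rfl⟩ := exists_coneElt (psi M M') (n - 1) n (by omega) w
    -- For complexes in degree 0, Γ₀ lives only in degree 0 and Γ₁ only in degree 0. So x, of degree
    -- n, and y, of degree n - 1, both vanish when n is neither 0 nor 1.
    have hx : x = 0 := triple_ext
      ((cochain_eq_zero (isZero_cx_obj _ hM) (isZero_cx_obj _ hM') (by omega) _).trans
        (map_zero _).symm)
      ((cochain_eq_zero (isZero_cx_obj _ hM) (isZero_cx_obj _ hM') (by omega) _).trans
        (map_zero _).symm)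
      ((cochain_eq_zero (isZero_cx_obj _ hM) (isZero_cx_obj _ hM') (by omega) _).trans
        (map_zero _).symm)
    have hy : y = 0 := triple_ext
      ((cochain_eq_zero (isZero_cx_obj _ (isZero_cx_obj _ hM)) (isZero_cx_obj _ hM')
        (by omega) _).trans (map_zero _).symm)
      ((cochain_eq_zero (isZero_cx_obj _ (isZero_cx_obj _ hM)) (isZero_cx_obj _ hM')
        (by omega) _).trans (map_zero _).symm)
      ((cochain_eq_zero (isZero_cx_obj _ (isZero_cx_obj _ hM)) (isZero_cx_obj _ hM')
        (by omega) _).trans (map_zero _).symm)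
    refine (hw.eq_zero_iff (n - 1) (by omega)).2 ⟨0, ?_⟩
    rw [hx, hy, map_zero]
    exact (coneElt_zero _ _ _ _).symm
  have : Subsingleton ((Gamma M M').homology n) := ⟨fun a b => (h a).trans (h b).symm⟩
  exact AddCommGrpCat.isZero_of_subsingleton _

end Main

end PadicHodge

end

/-! ### The arithmetic case, with σ the Frobenius of Frac W(k) -/

theorem mainTheorem11 (p : ℕ) [Fact p.Prime] (R K : Type u)
    [CommRing R] [IsDomain R] [IsDiscreteValuationRing R]
    [IsAdicComplete (IsLocalRing.maximalIdeal R) R]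
    [Field K] [Algebra R K] [IsFractionRing R K] [CharZero K]
    [CharP (IsLocalRing.ResidueField R) p] [PerfectRing (IsLocalRing.ResidueField R) p]
    -- `j : W(k) → R` is the canonical homomorphism (the one lifting the identity of `k`),
    -- and `K` is an extension of `K₀ = Frac W(k)` through it
    (j : WittVector p (IsLocalRing.ResidueField R) →+* R)
    (hj : ∀ w, IsLocalRing.residue R (j w) = w.coeff 0)
    [Algebra (Kzero p R) K]
    (hK : ∀ w : WittVector p (IsLocalRing.ResidueField R),
      algebraMap (Kzero p R) K (algebraMap _ (Kzero p R) w) = algebraMap R K (j w)) :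
    -- `pHD` is additive (the group structure on the `Hom` sets is the unique one for which
    -- the localization functor is additive)
    ∃ (_ : Preadditive (pHD K (sigma p R))) (_ : (quasiIso K (sigma p R)).Q.Additive),
      -- the isomorphisms `Hom_{pHD}(M, M'[n]) ≃ H^n(Γ(M, M'))`
      (∃ e : ∀ (n : ℤ) (M M' : pHC K (sigma p R)),
          ((toHD K (sigma p R)).obj M ⟶
              (toHD K (sigma p R)).obj ((shift K (sigma p R) n).obj M')) ≃+
            (Gamma M.obj M'.obj).homology n,
        -- they are functorial in `M` and `M'`
        (∀ (n : ℤ) (M M' N N' : pHC K (sigma p R)) (f : N ⟶ M) (g : M' ⟶ N')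
          (x : (toHD K (sigma p R)).obj M ⟶
            (toHD K (sigma p R)).obj ((shift K (sigma p R) n).obj M')),
          e n N N' ((toHD K (sigma p R)).map f ≫ x ≫
              (toHD K (sigma p R)).map ((shift K (sigma p R) n).map g)) =
            HomologicalComplex.homologyMap (Gamma.map f.hom g.hom) n (e n M M' x)) ∧
        -- they send a morphism of `p`-adic Hodge complexes to its class
        (∀ (n : ℤ) (M M' : pHC K (sigma p R)) (f : M ⟶ (shift K (sigma p R) n).obj M'),
          e n M M' ((toHD K (sigma p R)).map f) = homClass f.hom)) ∧
      -- vanishing for `M`, `M'` concentrated in degree `0`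
      (∀ M M' : pHC K (sigma p R), (∀ i : ℤ, i ≠ 0 → IsZero (M.obj.X i)) →
        (∀ i : ℤ, i ≠ 0 → IsZero (M'.obj.X i)) → ∀ n : ℤ, 2 ≤ n ∨ n < 0 →
          IsZero ((Gamma M.obj M'.obj).homology n) ∧
          ∀ x : (toHD K (sigma p R)).obj M ⟶
            (toHD K (sigma p R)).obj ((shift K (sigma p R) n).obj M'), x = 0) := by
  obtain ⟨_, _⟩ := exists_preadditive_localization (quasiIso K (sigma p R))
  obtain ⟨e, he, he'⟩ :=
    exists_natural_addEquiv_homology_gamma (K := K) (σ := sigma p R)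
  refine ⟨inferInstance, inferInstance, ⟨e, he, he'⟩, fun M M' hM hM' n hn => ?_⟩
  have h := isZero_homology_gamma hM hM' hn
  have := AddCommGrpCat.subsingleton_of_isZero h
  exact ⟨h, fun x => (e n M M').injective (Subsingleton.elim _ _)⟩
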